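/- **Setting.** A *bigerm* $\phi=[\phi_1,\phi_2]$ is a pair of primitive convergent parametrizations $\phi_i=(\phi_{i1},\phi_{i2}):(\mathbb C,0)\to(\mathbb C^2,0)$ (with parameter $t_i$) of the two distinct branches of a reduced plane analytic curve germ; $m_i$ is the multiplicity of the $i$-th branch and $m=(m_1,m_2)$. Let $\delta\in\{1,2\}$. The bigerm is in *Puiseux form* (for $\delta$) if $\phi_1=(t_1^{m_1},\sum_{j>m_1}a_{1j}t_1^j)$ and $\phi_2=(\sum_{j>m_2}a_{2j}t_2^j,\,t_2^{m_2})$ when $\delta=1$ (distinct tangents), respectively $\phi_2=(t_2^{m_2},\sum_{j>m_2}a_{2j}t_2^j)$ when $\delta=2$ (same tangent). The group $\mathcal A[\delta]$ consists of the triples $(\rho_1,\rho_2,\sigma)$ of analytic automorphism germs of $(\mathbb C,0)$, $(\mathbb C,0)$, $(\mathbb C^2,0)$ with $j^1\rho_i=t_i$ and $j^1\sigma=(x+b(\delta-1)y,\,y)$ for some $b\in\mathbb C$; it acts by $(\rho_1,\rho_2,\sigma)\cdot\phi=[\sigma\circ\phi_1\circ\rho_1^{-1},\ \sigma\circ\phi_2\circ\rho_2^{-1}]$,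 and bigerms in the same orbit are called $\mathcal A[\delta]$-equivalent. Here $j^k$ denotes the $k$-jet. The semigroup of values of $\phi$ is $\Gamma=\{(\mathrm{ord}_{t_1}\eta(\phi_1),\mathrm{ord}_{t_2}\eta(\phi_2)) : \eta\in\mathbb C\{x,y\}\}$, with $\mathrm{ord}\,0=\infty$; its conductor $(c_1,c_2)$ is the least element of $\mathbb N^2$ with $(c_1,c_2)+\mathbb N^2\subseteq\Gamma$, and $c=\max\{c_1,c_2\}$. Put $$\Omega[\delta]=\{\eta_1dx+(\beta(\delta-1)y+\eta_2)dy:\ \eta_1,\eta_2\in(x,y)^2\mathbb C\{x,y\},\ \beta\in\mathbb C\},$$ $$\Lambda[\delta]=\{(\nu_1(\omega)-m_1,\ \nu_2(\omega)-m_2):\ \omega\in\Omega[\delta]\},$$ where $\nu_i(\omega)=\mathrm{ord}_{t_i}\big(\eta_1(\phi_i)\phi_{i1}'+\eta_2(\phi_i)\phi_{i2}'\big)+1$ for $\omega=\eta_1dx+\eta_2dy$. For $a\in\mathbb N^2$ let $F_i(a)=\{b\in\Lambda[\delta]: b_i=a_i,\ b_j>a_j \text{ for } j\ne i\}$, and let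 $M$ be the set of $a\in\Lambda[\delta]\cap\mathbb N^2$ with $F_1(a)=F_2(a)=\emptyset$. Fix sets $\Gamma$ and $\Lambda[\delta]$, and a truncation order $N\in\mathbb N\cup\{\infty\}$ with $N\ge c-1$. Let $\Sigma_{\Gamma,\Lambda[\delta]}$ be the set of bigerms in Puiseux form with these $\Gamma$ and $\Lambda[\delta]$ whose coefficients $a_{ij}$ vanish for $j>N$ (for $N<\infty$ these are given by finitely many parameters; $N=\infty$ means no truncation). **Proposition.** Let $\phi\in\Sigma_{\Gamma,\Lambda[\delta]}$, $k\in\mathbb N$ and $i\in\{1,2\}$. Suppose that either $F_i(k,k)\ne\emptyset$ and $k>m_i$, or $(k,k)\in M$. Then there is $\varphi\in\Sigma_{\Gamma,\Lambda[\delta]}$ that is $\mathcal A[\delta]$-equivalent to $\phi$ and satisfies $j^{k-1}\varphi=j^{k-1}\phi$ and $j^k\varphi_i=j^{k-1}\phi_i$. (In particular, if $(k,k)\in M$, the degree-$k$ term can be removed from either branch, chosen freely.) -/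

import Mathlib

namespace PlaneBigerm

open PowerSeries

/-- A formal power series over `ℂ` in finitely many variables is convergent when it converges
absolutely on some polydisc around the origin.  Since `ℂ⟦X⟧` is `MvPowerSeries Unit ℂ`, this covers
both `ℂ{t}` and `ℂ{x, y}`. -/
def IsConvergent {ι : Type*} (f : MvPowerSeries ι ℂ) : Prop :=
  ∃ r : ℝ, 0 < r ∧ Summable fun d : ι →₀ ℕ => ‖MvPowerSeries.coeff d f‖ * r ^ d.degree

/-- `f ∈ Aut(ℂ{t})`, seen as a change of the coordinate `t`. -/
def IsReparam (f : ℂ⟦X⟧) : Prop :=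
  IsConvergent f ∧ constantCoeff f = 0 ∧ coeff 1 f ≠ 0

/-- A pair of branches; `φ i l` is the `l`-th coordinate (`0` for `x`, `1` for `y`) of the
parametrization of branch `i` as a series in the parameter of that branch. -/
abbrev BranchPair : Type := Fin 2 → Fin 2 → ℂ⟦X⟧

/-- The parametrization of a branch is primitive: it does not factor through a parameter change of
order at least two.  (In particular it is not constant.) -/
def IsPrimitive (p : Fin 2 → ℂ⟦X⟧) : Prop :=
  ∀ (q : Fin 2 → ℂ⟦X⟧) (ρ : ℂ⟦X⟧), (∀ l, IsConvergent (q l)) → IsConvergent ρ →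
    constantCoeff ρ = 0 → (∀ l, p l = (q l).subst ρ) → coeff 1 ρ ≠ 0

/-- `φ` is a bigerm: a pair of parametrizations `(ℂ, 0) → (ℂ², 0)` of the two branches of a
reduced plane curve germ with exactly two branches. -/
structure IsBigerm (φ : BranchPair) : Prop where
  convergent : ∀ i l, IsConvergent (φ i l)
  zero : ∀ i l, constantCoeff (φ i l) = 0
  primitive : ∀ i, IsPrimitive (φ i)
  distinct : ¬ ∃ ρ : ℂ⟦X⟧, IsReparam ρ ∧ ∀ l, φ 1 l = (φ 0 l).subst ρ

/-- The multiplicity `m_i` of branch `i`. -/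
noncomputable def mult (φ : BranchPair) (i : Fin 2) : ℕ∞ :=
  min (φ i 0).order (φ i 1).order

/-- The coordinate which is a pure power in the Puiseux form of branch `i`: `x` for the first
branch; for the second one `y` when the tangents are distinct (`δ = 1`) and `x` when they are
equal (`δ = 2`). -/
def mainCoord (δ : ℕ) (i : Fin 2) : Fin 2 := if δ = 1 then i else 0

/-- Puiseux form: the main coordinate of each branch is `t ^ m` with `m ≥ 1`, and the other one
has only terms of degree greater than `m`.  For `δ = 1` the tangents are distinct, for `δ = 2` they
are equal. -/
def IsPuiseux (δ : ℕ) (φ : BranchPair) : Prop :=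
  ∀ i, ∃ m : ℕ, 1 ≤ m ∧ φ i (mainCoord δ i) = X ^ m ∧
    ∀ l, l ≠ mainCoord δ i → ∀ n ≤ m, coeff n (φ i l) = 0

/-- The series in the non-main coordinates have no term of degree greater than `N`
(no condition for `N = ⊤`). -/
def DegreeLE (δ : ℕ) (N : ℕ∞) (φ : BranchPair) : Prop :=
  ∀ i l, l ≠ mainCoord δ i → ∀ n : ℕ, N < n → coeff n (φ i l) = 0

/-- The semigroup of values `Γ` of a bigerm; `⊤` is the order of the zero series. -/
def valueSemigroup (φ : BranchPair) : Set (Fin 2 → ℕ∞) :=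
  {a | ∃ η : MvPowerSeries (Fin 2) ℂ, IsConvergent η ∧
    ∀ i, a i = PowerSeries.order (MvPowerSeries.subst (φ i) η : ℂ⟦X⟧)}

/-- The conductor `(c₁, c₂)` of `Γ`, the least `c ∈ ℕ²` with `c + ℕ² ⊆ Γ`, coordinate by
coordinate. -/
noncomputable def conductor (Γ : Set (Fin 2 → ℕ∞)) (i : Fin 2) : ℕ :=
  sInf {n | ∃ c : Fin 2 → ℕ, c i = n ∧ ∀ a : Fin 2 → ℕ, c ≤ a → (fun j => (a j : ℕ∞)) ∈ Γ}

/-- The pullback `ω(φ_i)` of the differential `ω = ω₀ dx + ω₁ dy` to branch `i`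
(its coefficient with respect to `dt_i`). -/
noncomputable def pullback (φ : BranchPair) (i : Fin 2)
    (ω : Fin 2 → MvPowerSeries (Fin 2) ℂ) : ℂ⟦X⟧ :=
  ∑ l, (MvPowerSeries.subst (φ i) (ω l) : ℂ⟦X⟧) * derivative ℂ (φ i l)

/-- The differentials `Ω[δ]`: `η₁ dx + (β (δ - 1) y + η₂) dy` with `η₁, η₂ ∈ (x, y)² ℂ{x, y}` and
`β ∈ ℂ`. -/
def Omega (δ : ℕ) : Set (Fin 2 → MvPowerSeries (Fin 2) ℂ) :=
  {ω | ∃ (η : Fin 2 → MvPowerSeries (Fin 2) ℂ) (β : ℂ),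
    (∀ l, IsConvergent (η l)) ∧ (∀ l, 2 ≤ (η l).order) ∧
    ω 0 = η 0 ∧ ω 1 = MvPowerSeries.C (β * ((δ : ℂ) - 1)) * MvPowerSeries.X 1 + η 1}

/-- The set `Λ[δ] = {ν(ω) - m ; ω ∈ Ω[δ]}`, where `ν_i(ω)` is the order of `ω(φ_i)` plus one. -/
def Lambda (δ : ℕ) (φ : BranchPair) : Set (Fin 2 → ℕ∞) :=
  {a | ∃ ω ∈ Omega δ, ∀ i, a i + mult φ i = (pullback φ i ω).order + 1}

/-- The fibre `F_i(a)` of a set `L` of values. -/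
def fiber (L : Set (Fin 2 → ℕ∞)) (i : Fin 2) (a : Fin 2 → ℕ∞) : Set (Fin 2 → ℕ∞) :=
  {b | b ∈ L ∧ b i = a i ∧ ∀ j, j ≠ i → a j < b j}

/-- The maximal points of a set `L` of values. -/
def maximalPoints (L : Set (Fin 2 → ℕ∞)) : Set (Fin 2 → ℕ∞) :=
  {a | a ∈ L ∧ (∀ i, a i ≠ ⊤) ∧ ∀ i, fiber L i a = ∅}

/-- `Σ_{Γ, Λ[δ]}`, truncated at degree `N`: the bigerms in Puiseux form with semigroup of values
`Γ`, set of values `Λ[δ]` equal to `L`, and no term of degree greater than `N`. -/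
def SigmaSpace (δ : ℕ) (Γ L : Set (Fin 2 → ℕ∞)) (N : ℕ∞) : Set BranchPair :=
  {φ | IsBigerm φ ∧ IsPuiseux δ φ ∧ valueSemigroup φ = Γ ∧ Lambda δ φ = L ∧ DegreeLE δ N φ}

/-- `(ρ₁, ρ₂, s)` belongs to the group `𝒜[δ]` of changes of coordinates with `j¹ρ_i = t_i` and
`j¹s = (x + b (δ - 1) y, y)` for some `b ∈ ℂ`.  Such `ρ_i`, `s` are automorphisms. -/
structure MemGroup (δ : ℕ) (ρ : Fin 2 → ℂ⟦X⟧) (s : Fin 2 → MvPowerSeries (Fin 2) ℂ) : Prop where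
  convergent_source : ∀ i, IsConvergent (ρ i)
  zero_source : ∀ i, constantCoeff (ρ i) = 0
  linear_source : ∀ i, coeff 1 (ρ i) = 1
  convergent_target : ∀ l, IsConvergent (s l)
  zero_target : ∀ l, MvPowerSeries.constantCoeff (s l) = 0
  linear_target_x : MvPowerSeries.coeff (Finsupp.single 0 1) (s 0) = 1 ∧
    ∃ b : ℂ, MvPowerSeries.coeff (Finsupp.single 1 1) (s 0) = b * ((δ : ℂ) - 1)
  linear_target_y : MvPowerSeries.coeff (Finsupp.single 0 1) (s 1) = 0 ∧
    MvPowerSeries.coeff (Finsupp.single 1 1) (s 1) = 1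

/-- `ψ` is `𝒜[δ]`-equivalent to `φ`: `ψ_i = s ∘ φ_i ∘ ρ_i⁻¹` for some `(ρ₁, ρ₂, s) ∈ 𝒜[δ]`, written
as `ψ_i ∘ ρ_i = s ∘ φ_i`. -/
def AEquiv (δ : ℕ) (φ ψ : BranchPair) : Prop :=
  ∃ ρ s, MemGroup δ ρ s ∧ ∀ i l, (ψ i l).subst (ρ i) = (MvPowerSeries.subst (φ i) (s l) : ℂ⟦X⟧)

end PlaneBigerm

open PlaneBigerm

/-! The proof moves `φ` along the flow of a plane vector field dual to a differential. Both
alternatives of the hypothesis supply `ω ∈ Ω[δ]` whose value in `Λ[δ]` is `k` at branch `i` and at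
least `k` at the other branch. Put `V = -ω₁ ∂/∂x + ω₀ ∂/∂y`. Along a branch in Puiseux form, `V`
splits into a tangential part `τ φ_j'` and a displacement `± ε_j` in the non-main coordinate, where
`ω(φ_j) = (t^m_j)' ε_j`. The order of `ε_j` is exactly the `j`-th entry of the value of `ω`.

The exponential of `V` is a coordinate change of the plane, that of `τ d/dt` a reparametrization,
and their combined effect is to add `± ε_j` to the non-main coordinate modulo higher order
(`exists_flow_branch`, `exists_flow`). After scaling `ω`, the term of degree `k` on branch `i`
cancels and nothing below degree `k` changes. Exponentials are cut off at a finite order: a finite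
sum is visibly convergent, and the error is smaller than the terms being controlled. Returning to
Puiseux form is `exists_puiseux_of_close`.

The flow may create terms of degree greater than `N`. Since `N + 1` is at least the conductor, every
pair of convergent series of order greater than `N` is pulled back from the plane
(`exists_mvSubst_eq`), so the tails are removed by one more coordinate change (`exists_truncation`).
For equal tangents the linear part of that change needs an argument, `coeff_eq_zero_of_X_pow_dvd`.

The semigroup, the set `Λ[δ]` and the property of being a bigerm are invariant under the group
(`valueSemigroup_eq`, `Lambda_eq`, `isBigerm_of_aEquiv`), so the result stays in the same stratum.
Inverse series, inverse coordinate changes and roots all come from one fixed point theorem,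
`exists_convergent_fixpoint`. -/

namespace PlaneBigerm
open scoped NNReal ENNReal Topology
open Filter

/-! ### Convergent power series via weighted `ℓ¹`-norms -/

section Convergence
open MvPowerSeries
variable {ι κ : Type*}

/-- The weighted `ℓ¹`-norm of a power series on the polydisc of radius `r`. -/
noncomputable def wnorm (r : ℝ≥0∞) (f : MvPowerSeries ι ℂ) : ℝ≥0∞ :=
  ∑' d, ‖coeff d f‖ₑ * r ^ d.degree

lemma wnorm_mono {r s : ℝ≥0∞} (h : r ≤ s) (f : MvPowerSeries ι ℂ) : wnorm r f ≤ wnorm s f :=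
  ENNReal.tsum_le_tsum fun _ => by gcongr

lemma isConvergent_iff_exists {f : MvPowerSeries ι ℂ} :
    IsConvergent f ↔ ∃ r : ℝ≥0∞, 0 < r ∧ wnorm r f < ⊤ := by
  constructor
  · rintro ⟨r, hr, h⟩
    refine ⟨ENNReal.ofReal r, by simpa using hr, ?_⟩
    have : wnorm (ENNReal.ofReal r) f
        = ∑' d, ENNReal.ofReal (‖coeff d f‖ * r ^ d.degree) := by
      refine tsum_congr fun d => ?_
      rw [ENNReal.ofReal_mul (norm_nonneg _), ENNReal.ofReal_pow hr.le, ofReal_norm]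
    rw [this, lt_top_iff_ne_top]
    exact h.tsum_ofReal_ne_top
  · rintro ⟨r, hr, h⟩
    have hm : (min r 1) ≠ ⊤ := ne_top_of_le_ne_top ENNReal.one_ne_top (min_le_right _ _)
    refine ⟨(min r 1).toReal, ENNReal.toReal_pos (lt_min hr one_pos).ne' hm, ?_⟩
    have h1 : wnorm (min r 1) f ≠ ⊤ := ((wnorm_mono (min_le_left _ _) f).trans_lt h).ne
    refine (ENNReal.summable_toReal h1).congr fun d => ?_
    simp [ENNReal.toReal_mul]

/-- Stating convergence for all small radii lets finitely many series share one radius by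
intersecting filter sets. -/
lemma isConvergent_iff {f : MvPowerSeries ι ℂ} :
    IsConvergent f ↔ ∀ᶠ r : ℝ≥0∞ in 𝓝[>] 0, wnorm r f < ⊤ := by
  rw [isConvergent_iff_exists]
  constructor
  · rintro ⟨r, hr, h⟩
    filter_upwards [Ioo_mem_nhdsGT hr] with s hs
    exact (wnorm_mono hs.2.le f).trans_lt h
  · intro h
    obtain ⟨r, h1, h2⟩ := (h.and self_mem_nhdsWithin).exists
    exact ⟨r, h2, h1⟩

lemma wnorm_add_le (r : ℝ≥0∞) (f g : MvPowerSeries ι ℂ) :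
    wnorm r (f + g) ≤ wnorm r f + wnorm r g := by
  rw [wnorm, wnorm, wnorm, ← ENNReal.tsum_add]
  refine ENNReal.tsum_le_tsum fun d => ?_
  rw [← add_mul, map_add]
  gcongr
  exact enorm_add_le _ _

/-- The product of the norms is a double sum; grouping it by the sum of the exponents dominates the
Cauchy product by the triangle inequality. Values in `ℝ≥0∞` make summability questions disappear. -/
lemma wnorm_mul_le (r : ℝ≥0∞) (f g : MvPowerSeries ι ℂ) :
    wnorm r (f * g) ≤ wnorm r f * wnorm r g := by
  classical
  have h : wnorm r f * wnorm r g = ∑' p : (ι →₀ ℕ) × (ι →₀ ℕ),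
      (‖coeff p.1 f‖ₑ * r ^ p.1.degree) * (‖coeff p.2 g‖ₑ * r ^ p.2.degree) := by
    rw [ENNReal.tsum_prod', wnorm, wnorm, ← ENNReal.tsum_mul_right]
    exact tsum_congr fun a => ENNReal.tsum_mul_left.symm
  rw [h, ← (Finset.HasAntidiagonal.sigmaAntidiagonalEquivProd (A := ι →₀ ℕ)).tsum_eq, ENNReal.tsum_sigma']
  refine ENNReal.tsum_le_tsum fun d => ?_
  rw [tsum_fintype, coeff_mul]
  calc ‖∑ p ∈ Finset.HasAntidiagonal.antidiagonal d, coeff p.1 f * coeff p.2 g‖ₑ * r ^ d.degree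
      ≤ (∑ p ∈ Finset.HasAntidiagonal.antidiagonal d, ‖coeff p.1 f * coeff p.2 g‖ₑ) * r ^ d.degree := by
        gcongr; exact enorm_sum_le _ _
    _ = _ := by
        rw [Finset.sum_mul, ← Finset.sum_coe_sort]
        refine Finset.sum_congr rfl fun p _ => ?_
        have hp := Finset.HasAntidiagonal.mem_antidiagonal.1 p.2
        have hd : d.degree = p.1.1.degree + p.1.2.degree := by
          rw [← map_add]; exact congrArg _ hp.symm
        rw [hd, enorm_mul, pow_add]
        simp only [Finset.HasAntidiagonal.sigmaAntidiagonalEquivProd_apply]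
        ring

lemma wnorm_C (r : ℝ≥0∞) (a : ℂ) : wnorm r (C a : MvPowerSeries ι ℂ) = ‖a‖ₑ := by
  classical
  rw [wnorm, tsum_eq_single 0]
  · simp
  · intro d hd
    simp [coeff_C, hd]

lemma wnorm_one (r : ℝ≥0∞) : wnorm r (1 : MvPowerSeries ι ℂ) = 1 := by
  rw [← map_one C, wnorm_C]; simp

lemma wnorm_X (r : ℝ≥0∞) (l : ι) : wnorm r (X l : MvPowerSeries ι ℂ) = r := by
  classical
  rw [wnorm, tsum_eq_single (Finsupp.single l 1)]
  · simp
  · intro d hd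
    simp [coeff_X, hd]

lemma wnorm_pow_le (r : ℝ≥0∞) (f : MvPowerSeries ι ℂ) (n : ℕ) :
    wnorm r (f ^ n) ≤ wnorm r f ^ n := by
  induction n with
  | zero => simp [wnorm_one]
  | succ n ih =>
    rw [pow_succ, pow_succ]
    exact (wnorm_mul_le _ _ _).trans (by gcongr)

lemma wnorm_prod_le {σ : Type*} (r : ℝ≥0∞) (s : Finset σ) (f : σ → MvPowerSeries ι ℂ) :
    wnorm r (∏ i ∈ s, f i) ≤ ∏ i ∈ s, wnorm r (f i) := by
  classical
  induction s using Finset.induction_on with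
  | empty => simp [wnorm_one]
  | insert a s ha ih =>
    rw [Finset.prod_insert ha, Finset.prod_insert ha]
    exact (wnorm_mul_le _ _ _).trans (by gcongr)

/-- Exchange the two summations: each monomial of degree `|d|` in the `g l` has norm at most `R ^
|d|` by submultiplicativity. -/
lemma wnorm_subst_le {r R : ℝ≥0∞} {g : ι → MvPowerSeries κ ℂ} (hg : HasSubst g)
    (h : ∀ l, wnorm r (g l) ≤ R) (f : MvPowerSeries ι ℂ) :
    wnorm r (subst g f) ≤ wnorm R f := by
  have h1 : ∀ e, ‖coeff e (subst g f)‖ₑ ≤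
      ∑' d : ι →₀ ℕ, ‖coeff d f‖ₑ * ‖coeff e (d.prod fun s n => g s ^ n)‖ₑ := by
    intro e
    rw [coeff_subst hg, finsum_eq_sum _ (coeff_subst_finite hg f e)]
    refine (enorm_sum_le _ _).trans ?_
    simp only [smul_eq_mul, enorm_mul]
    exact ENNReal.sum_le_tsum _
  calc wnorm r (subst g f)
      ≤ ∑' e : κ →₀ ℕ, (∑' d : ι →₀ ℕ,
          ‖coeff d f‖ₑ * ‖coeff e (d.prod fun s n => g s ^ n)‖ₑ) * r ^ e.degree :=
        ENNReal.tsum_le_tsum fun e => by gcongr; exact h1 e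
    _ = ∑' d : ι →₀ ℕ, ‖coeff d f‖ₑ * wnorm r (d.prod fun s n => g s ^ n) := by
        simp_rw [← ENNReal.tsum_mul_right]
        rw [ENNReal.tsum_comm]
        refine tsum_congr fun d => ?_
        rw [wnorm, ← ENNReal.tsum_mul_left]
        exact tsum_congr fun e => by ring
    _ ≤ wnorm R f := by
        refine ENNReal.tsum_le_tsum fun d => ?_
        gcongr
        refine (wnorm_prod_le _ _ _).trans ?_
        rw [Finsupp.degree_apply, ← Finset.prod_pow_eq_pow_sum]
        refine Finset.prod_le_prod' fun s _ => ?_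
        exact (wnorm_pow_le _ _ _).trans (by gcongr; exact h s)

lemma wnorm_mul_radius_le {ε : ℝ≥0∞} (hε : ε ≤ 1) (r : ℝ≥0∞) {n : ℕ} {f : MvPowerSeries ι ℂ}
    (hf : n ≤ f.order) : wnorm (ε * r) f ≤ ε ^ n * wnorm r f := by
  rw [wnorm, wnorm, ← ENNReal.tsum_mul_left]
  refine ENNReal.tsum_le_tsum fun d => ?_
  by_cases hd : d.degree < n
  · rw [coeff_of_lt_order (lt_of_lt_of_le (by exact_mod_cast hd) hf)]
    simp
  · rw [mul_pow, mul_left_comm]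
    gcongr ?_ * _
    exact pow_le_pow_right_of_le_one' hε (not_lt.1 hd)

lemma tendsto_wnorm {f : MvPowerSeries ι ℂ} (hf : IsConvergent f) (h0 : constantCoeff f = 0) :
    Tendsto (fun r => wnorm r f) (𝓝[>] 0) (𝓝 0) := by
  obtain ⟨r, hr, h⟩ := isConvergent_iff_exists.1 hf
  rw [ENNReal.tendsto_nhds_zero]
  intro δ hδ
  wlog hrt : r ≠ ⊤ generalizing r
  · exact this 1 one_pos ((wnorm_mono (by simp_all) f).trans_lt h) ENNReal.one_ne_top
  have hC : wnorm r f ≠ ⊤ := h.ne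
  obtain ⟨ε, hε, hε1⟩ : ∃ ε : ℝ≥0∞, 0 < ε ∧ ε ≤ 1 ∧ ε * wnorm r f ≤ δ := by
    refine ⟨min 1 (δ / (wnorm r f + 1)), lt_min one_pos (ENNReal.div_pos hδ.ne' (by simp [hC])),
      min_le_left _ _, ?_⟩
    calc _ ≤ δ / (wnorm r f + 1) * (wnorm r f + 1) := by
          gcongr
          · exact min_le_right _ _
          · exact le_self_add
      _ ≤ δ := (ENNReal.div_mul_cancel (by simp) (by simp [hC])).le 
  filter_upwards [Ioo_mem_nhdsGT (ENNReal.mul_pos hε.ne' hr.ne')] with s hs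
  refine (wnorm_mono hs.2.le f).trans ?_
  refine (wnorm_mul_radius_le (n := 1) hε1.1 r ?_).trans (by simpa using hε1.2)
  simpa using one_le_order_iff_constCoeff_eq_zero.2 h0

/-- A series of order at least two has norm `O(r²)`. This smallness keeps the fixed point iteration
inside a ball. -/
lemma eventually_wnorm_le_half {f : MvPowerSeries ι ℂ} (hf : IsConvergent f) (h0 : 2 ≤ f.order) :
    ∀ᶠ r in 𝓝[>] 0, wnorm r f ≤ r / 2 := by
  obtain ⟨r, hr, h⟩ := isConvergent_iff_exists.1 hf
  wlog hrt : r ≠ ⊤ generalizing r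
  · exact this 1 one_pos ((wnorm_mono (by simp_all) f).trans_lt h) ENNReal.one_ne_top
  have hC : wnorm r f ≠ ⊤ := h.ne
  have hpos : 0 < min 1 ((r / 2) / (wnorm r f + 1)) :=
    lt_min one_pos (ENNReal.div_pos (ENNReal.div_pos hr.ne' (by simp)).ne' (by simp [hC]))
  filter_upwards [Ioo_mem_nhdsGT (ENNReal.mul_pos hpos.ne' hr.ne')] with s hs
  have hs' : s = (s / r) * r := (ENNReal.div_mul_cancel hr.ne' hrt).symm
  have hle : s / r ≤ min 1 ((r / 2) / (wnorm r f + 1)) := ENNReal.div_le_of_le_mul hs.2.le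
  calc wnorm s f = wnorm (s / r * r) f := by rw [← hs']
    _ ≤ (s / r) ^ 2 * wnorm r f :=
        wnorm_mul_radius_le (hle.trans (min_le_left _ _)) r (by simpa using h0)
    _ ≤ (s / r) * (((r / 2) / (wnorm r f + 1)) * (wnorm r f + 1)) := by
        rw [pow_two, mul_assoc]
        gcongr (s / r) * (?_ * ?_)
        · exact hle.trans (min_le_right _ _)
        · exact le_self_add
    _ ≤ (s / r) * (r / 2) := by gcongr ; exact (ENNReal.div_mul_cancel (by simp) (by simp [hC])).le
    _ = s / 2 := by
        rw [← mul_div_assoc, ← hs']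

lemma IsConvergent.add {f g : MvPowerSeries ι ℂ} (hf : IsConvergent f) (hg : IsConvergent g) :
    IsConvergent (f + g) := by
  rw [isConvergent_iff] at *
  filter_upwards [hf, hg] with r h1 h2
  exact (wnorm_add_le _ _ _).trans_lt (ENNReal.add_lt_top.2 ⟨h1, h2⟩)

lemma IsConvergent.mul {f g : MvPowerSeries ι ℂ} (hf : IsConvergent f) (hg : IsConvergent g) :
    IsConvergent (f * g) := by
  rw [isConvergent_iff] at *
  filter_upwards [hf, hg] with r h1 h2
  exact (wnorm_mul_le _ _ _).trans_lt (ENNReal.mul_lt_top h1 h2)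

lemma isConvergent_C (a : ℂ) : IsConvergent (C a : MvPowerSeries ι ℂ) :=
  isConvergent_iff_exists.2 ⟨1, one_pos, by simp [wnorm_C]⟩

lemma isConvergent_X (l : ι) : IsConvergent (X l : MvPowerSeries ι ℂ) :=
  isConvergent_iff_exists.2 ⟨1, one_pos, by simp [wnorm_X]⟩

variable (ι) in
/-- The ring of convergent power series. -/
noncomputable def convergentSubalgebra : Subalgebra ℂ (MvPowerSeries ι ℂ) where
  carrier := {f | IsConvergent f}
  mul_mem' := IsConvergent.mul
  add_mem' := IsConvergent.add
  algebraMap_mem' := isConvergent_C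

lemma isConvergent_one : IsConvergent (1 : MvPowerSeries ι ℂ) :=
  (convergentSubalgebra ι).one_mem

lemma IsConvergent.neg {f : MvPowerSeries ι ℂ} (hf : IsConvergent f) : IsConvergent (-f) :=
  (convergentSubalgebra ι).neg_mem hf

lemma IsConvergent.sub {f g : MvPowerSeries ι ℂ} (hf : IsConvergent f) (hg : IsConvergent g) :
    IsConvergent (f - g) :=
  (convergentSubalgebra ι).sub_mem hf hg

lemma IsConvergent.smul {f : MvPowerSeries ι ℂ} (hf : IsConvergent f) (a : ℂ) :
    IsConvergent (a • f) :=
  (convergentSubalgebra ι).smul_mem hf a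

lemma IsConvergent.pow {f : MvPowerSeries ι ℂ} (hf : IsConvergent f) (n : ℕ) :
    IsConvergent (f ^ n) :=
  (convergentSubalgebra ι).pow_mem hf n

lemma IsConvergent.sum {σ : Type*} {s : Finset σ} {f : σ → MvPowerSeries ι ℂ}
    (hf : ∀ i ∈ s, IsConvergent (f i)) : IsConvergent (∑ i ∈ s, f i) :=
  (convergentSubalgebra ι).sum_mem hf

lemma IsConvergent.subst [Finite ι] {f : MvPowerSeries ι ℂ} {g : ι → MvPowerSeries κ ℂ}
    (hf : IsConvergent f) (hg : ∀ l, IsConvergent (g l)) (h0 : ∀ l, constantCoeff (g l) = 0) :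
    IsConvergent (subst g f) := by
  obtain ⟨R, hR, h⟩ := isConvergent_iff_exists.1 hf
  have : ∀ᶠ r in 𝓝[>] 0, ∀ l, wnorm r (g l) ≤ R :=
    eventually_all.2 fun l => ((tendsto_wnorm (hg l) (h0 l)).eventually (gt_mem_nhds hR)).mono
      fun _ h => le_of_lt h
  rw [isConvergent_iff]
  filter_upwards [this] with r hr
  exact (wnorm_subst_le (hasSubst_of_constantCoeff_zero h0) hr f).trans_lt h

/-- Halving the radius absorbs the factor `d l + 1 ≤ 2 ^ |d|` produced by differentiation. -/
lemma IsConvergent.pderiv {f : MvPowerSeries ι ℂ} (hf : IsConvergent f) (l : ι) :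
    IsConvergent (pderiv ℂ l f) := by
  classical
  obtain ⟨r, hr, h⟩ := isConvergent_iff_exists.1 hf
  wlog hrt : r ≠ ⊤ generalizing r
  · exact this 1 one_pos ((wnorm_mono (by simp_all) f).trans_lt h) ENNReal.one_ne_top
  refine isConvergent_iff_exists.2 ⟨r / 2, ENNReal.div_pos hr.ne' (by simp), ?_⟩
  have key : r * wnorm (r / 2) (MvPowerSeries.pderiv ℂ l f) ≤ wnorm r f := by
    calc r * wnorm (r / 2) (MvPowerSeries.pderiv ℂ l f)
        ≤ ∑' d : ι →₀ ℕ, ‖coeff (d + Finsupp.single l 1) f‖ₑ *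
            r ^ (d + Finsupp.single l 1).degree := by
          rw [wnorm, ← ENNReal.tsum_mul_left]
          refine ENNReal.tsum_le_tsum fun d => ?_
          rw [coeff_pderiv, enorm_mul, map_add, Finsupp.degree_single, pow_succ']
          have h1 : ‖((d l : ℂ) + 1)‖ₑ ≤ 2 ^ d.degree := by
            have h2 : ((d l : ℂ) + 1) = ((d l + 1 : ℕ) : ℂ) := by push_cast; rfl
            rw [h2, ← ofReal_norm, Complex.norm_natCast, ENNReal.ofReal_natCast]
            have h3 : d l + 1 ≤ 2 ^ d.degree :=
              (Nat.lt_two_pow_self (n := d l)).trans_le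
                (Nat.pow_le_pow_right (by norm_num) (Finsupp.le_degree l d))
            exact_mod_cast h3
          calc _ ≤ r * (‖coeff (d + Finsupp.single l 1) f‖ₑ * 2 ^ d.degree *
                (r / 2) ^ d.degree) := by gcongr
            _ = _ := by
              rw [mul_assoc, ← mul_pow, ENNReal.mul_div_cancel (by simp) (by simp)]
              ring
      _ ≤ wnorm r f :=
          ENNReal.tsum_comp_le_tsum_of_injective
            (add_left_injective (Finsupp.single l 1)) fun d => ‖coeff d f‖ₑ * r ^ d.degree
  exact lt_top_iff_ne_top.2 fun h' => by
    rw [h', ENNReal.mul_top hr.ne'] at key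
    exact absurd h (not_lt.2 key)

end Convergence
end PlaneBigerm

namespace PlaneBigerm
open scoped NNReal ENNReal Topology
open Filter

/-! ### Order estimates for substitution and a convergent fixed point theorem -/

section Fixpoint
open MvPowerSeries
variable {ι κ : Type*}

lemma natCast_le_order_iff {n : ℕ} {f : MvPowerSeries ι ℂ} :
    (n : ℕ∞) ≤ f.order ↔ ∀ d : ι →₀ ℕ, d.degree < n → coeff d f = 0 :=
  ⟨fun h _ hd => coeff_of_lt_order (lt_of_lt_of_le (by exact_mod_cast hd) h), nat_le_order⟩

lemma le_order_add {n : ℕ∞} {f g : MvPowerSeries ι ℂ} (hf : n ≤ f.order) (hg : n ≤ g.order) :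
    n ≤ (f + g).order :=
  (le_min hf hg).trans min_order_le_add

lemma le_order_sub {n : ℕ∞} {f g : MvPowerSeries ι ℂ} (hf : n ≤ f.order) (hg : n ≤ g.order) :
    n ≤ (f - g).order := by
  rw [sub_eq_add_neg]
  exact le_order_add hf (by rwa [order_neg])

lemma add_le_order_mul {m n : ℕ∞} {f g : MvPowerSeries ι ℂ} (hf : m ≤ f.order)
    (hg : n ≤ g.order) : m + n ≤ (f * g).order :=
  (add_le_add hf hg).trans le_order_mul

lemma one_le_order {f : MvPowerSeries ι ℂ} (hf : constantCoeff f = 0) : 1 ≤ f.order :=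
  one_le_order_iff_constCoeff_eq_zero.2 hf

lemma degree_le_order_monomial {a : ι → MvPowerSeries κ ℂ} (ha : ∀ l, constantCoeff (a l) = 0)
    (d : ι →₀ ℕ) : (d.degree : ℕ∞) ≤ (d.prod fun l n => a l ^ n).order := by
  refine le_trans ?_ (le_order_prod _ _)
  rw [Finsupp.degree_apply, Nat.cast_sum]
  exact Finset.sum_le_sum fun l _ => le_order_pow_of_constantCoeff_eq_zero _ (ha l)

/-- Telescoping through `A x - B y = (A - B) x + B (x - y)`: one factor contributes the difference,
of order at least `n`, and each of the other `j` factors at least one more. -/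
lemma le_order_monomial_sub {a b : ι → MvPowerSeries κ ℂ} (ha : ∀ l, constantCoeff (a l) = 0)
    (hb : ∀ l, constantCoeff (b l) = 0) {n : ℕ} (h : ∀ l, (n : ℕ∞) ≤ (a l - b l).order) (j : ℕ) :
    ∀ d : ι →₀ ℕ, d.degree = j + 1 →
      ((n + j : ℕ) : ℕ∞) ≤
        ((d.prod fun l n => a l ^ n) - (d.prod fun l n => b l ^ n)).order := by
  classical
  induction j with
  | zero =>
    intro d hd
    obtain ⟨l, hl⟩ : ∃ l, d l ≠ 0 := by
      by_contra! hc
      have : d = 0 := Finsupp.ext hc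
      simp [this] at hd
    obtain ⟨d', rfl⟩ : ∃ d', d = d' + Finsupp.single l 1 :=
      ⟨d - Finsupp.single l 1, by
        ext k
        by_cases hk : l = k
        · subst hk; simp; omega
        · simp [hk]⟩
    have hd' : d' = 0 := (Finsupp.degree_eq_zero_iff d').1 (by simpa using hd)
    simpa [hd'] using h l
  | succ j ih =>
    intro d hd
    obtain ⟨l, hl⟩ : ∃ l, d l ≠ 0 := by
      by_contra! hc
      have : d = 0 := Finsupp.ext hc
      simp [this] at hd
    obtain ⟨d', rfl⟩ : ∃ d', d = d' + Finsupp.single l 1 :=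
      ⟨d - Finsupp.single l 1, by
        ext k
        by_cases hk : l = k
        · subst hk; simp; omega
        · simp [hk]⟩
    have hd' : d'.degree = j + 1 := by simpa using hd
    rw [Finsupp.prod_add_index' (by simp) (by simp [pow_add]),
      Finsupp.prod_add_index' (by simp) (by simp [pow_add])]
    simp only [Finsupp.prod_single_index, pow_zero, pow_one]
    have e : ∀ A B x y : MvPowerSeries κ ℂ, A * x - B * y = (A - B) * x + B * (x - y) := by
      intros; ring
    rw [e]
    refine le_order_add ?_ ?_
    · refine le_trans ?_ (add_le_order_mul (ih d' hd') (one_le_order (ha l)))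
      push_cast; rw [add_assoc]
    · refine le_trans ?_ (add_le_order_mul (degree_le_order_monomial hb d') (h l))
      rw [hd']
      push_cast; rw [add_comm]

/-- Substituting two families which agree below degree `n` into a series without terms of degree
`1, …, j` gives series which agree below degree `n + j`. -/
lemma le_order_subst_sub_subst [Finite ι] {a b : ι → MvPowerSeries κ ℂ}
    (ha : ∀ l, constantCoeff (a l) = 0)
    (hb : ∀ l, constantCoeff (b l) = 0) {n : ℕ} (h : ∀ l, (n : ℕ∞) ≤ (a l - b l).order) {j : ℕ}
    {f : MvPowerSeries ι ℂ} (hf : ∀ d, d ≠ 0 → d.degree ≤ j → coeff d f = 0) :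
    ((n + j : ℕ) : ℕ∞) ≤ (subst a f - subst b f).order := by
  rw [natCast_le_order_iff]
  intro e he
  rw [map_sub, sub_eq_zero, coeff_subst (hasSubst_of_constantCoeff_zero ha),
    coeff_subst (hasSubst_of_constantCoeff_zero hb)]
  refine finsum_congr fun d => ?_
  rcases eq_or_ne d 0 with rfl | hd
  · simp
  rcases le_or_gt d.degree j with hdj | hdj
  · simp [hf d hd hdj]
  · obtain ⟨i, hi⟩ : ∃ i, d.degree = i + 1 := ⟨d.degree - 1, by omega⟩
    have := natCast_le_order_iff.1 (le_order_monomial_sub ha hb h i d hi) e (by omega)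
    rw [map_sub, sub_eq_zero] at this
    rw [this]

lemma le_order_subst_of_le [Finite ι] {a : ι → MvPowerSeries κ ℂ}
    (ha : ∀ l, constantCoeff (a l) = 0) {n : ℕ} {f : MvPowerSeries ι ℂ} (hf : n ≤ f.order) :
    (n : ℕ∞) ≤ (subst a f).order := by
  rw [natCast_le_order_iff]
  intro e he
  rw [coeff_subst (hasSubst_of_constantCoeff_zero ha)]
  refine finsum_eq_zero_of_forall_eq_zero fun d => ?_
  rcases lt_or_ge d.degree n with hd | hd
  · rw [natCast_le_order_iff.1 hf d hd, zero_smul]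
  · rw [natCast_le_order_iff.1 (degree_le_order_monomial ha d) e (by omega), smul_zero]

lemma constantCoeff_subst_zero [Finite ι] {a : ι → MvPowerSeries κ ℂ}
    (ha : ∀ l, constantCoeff (a l) = 0) {f : MvPowerSeries ι ℂ} (hf : constantCoeff f = 0) :
    constantCoeff (subst a f) = 0 :=
  constantCoeff_subst_eq_zero (hasSubst_of_constantCoeff_zero ha) ha hf

/-- The system `G = P + h(G)` with `h` of order at least two has a convergent solution. -/
theorem exists_convergent_fixpoint [Finite ι] {P : ι → MvPowerSeries κ ℂ}
    {h : ι → MvPowerSeries ι ℂ} (hP : ∀ l, IsConvergent (P l))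
    (hP0 : ∀ l, constantCoeff (P l) = 0) (hh : ∀ l, IsConvergent (h l))
    (hh2 : ∀ l, 2 ≤ (h l).order) :
    ∃ G : ι → MvPowerSeries κ ℂ, (∀ l, IsConvergent (G l)) ∧ (∀ l, constantCoeff (G l) = 0) ∧
      ∀ l, G l = P l + subst G (h l) := by
  have hh0 : ∀ l, constantCoeff (h l) = 0 := fun l =>
    one_le_order_iff_constCoeff_eq_zero.1 (le_trans (by norm_num) (hh2 l))
  have hhj : ∀ l d, d ≠ 0 → d.degree ≤ 1 → coeff d (h l) = 0 := fun l d _ hd =>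
    (natCast_le_order_iff (n := 2)).1 (by exact_mod_cast hh2 l) d (by omega)
  -- Picard iteration from zero. As `h` has no linear term, each step makes one more degree
  -- stationary.
  obtain ⟨G, Gz, Gs⟩ : ∃ G : ℕ → ι → MvPowerSeries κ ℂ, (∀ l, G 0 l = 0) ∧
      ∀ n l, G (n + 1) l = P l + subst (G n) (h l) :=
    ⟨fun n => Nat.rec (fun _ => 0) (fun _ g l => P l + subst g (h l)) n, fun _ => rfl,
      fun _ _ => rfl⟩
  have G0 : ∀ n l, constantCoeff (G n l) = 0 := by
    intro n
    induction n with
    | zero => intro l; rw [Gz, map_zero]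
    | succ n ih => intro l; rw [Gs, map_add, hP0, constantCoeff_subst_zero ih (hh0 l), add_zero]
  have Gstep : ∀ n l, ((n + 1 : ℕ) : ℕ∞) ≤ (G (n + 1) l - G n l).order := by
    intro n
    induction n with
    | zero =>
      intro l
      simpa using one_le_order (by rw [map_sub, G0, G0, sub_zero])
    | succ n ih =>
      intro l
      rw [Gs (n + 1), Gs n, add_sub_add_left_eq_sub]
      exact le_order_subst_sub_subst (G0 _) (G0 _) ih (hhj l)
  have Gle : ∀ n k l, ((n + 1 : ℕ) : ℕ∞) ≤ (G (n + k) l - G n l).order := by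
    intro n k l
    induction k with
    | zero => simp
    | succ k ih =>
      rw [← sub_add_sub_cancel _ (G (n + k) l)]
      refine le_order_add (le_trans ?_ (Gstep (n + k) l)) ih
      exact_mod_cast (by omega)
  -- The formal limit: a coefficient of degree `|d|` no longer changes from the iterate of index
  -- `|d|` on.
  obtain ⟨F, hF⟩ : ∃ F : ι → MvPowerSeries κ ℂ, ∀ l d, coeff d (F l) = coeff d (G d.degree l) :=
    ⟨fun l d => coeff d (G d.degree l), fun _ _ => rfl⟩
  have hFG : ∀ n l d, d.degree ≤ n → coeff d (F l) = coeff d (G n l) := by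
    intro n l d hd
    obtain ⟨k, rfl⟩ := Nat.exists_eq_add_of_le hd
    have := natCast_le_order_iff.1 (Gle d.degree k l) d (by omega)
    rw [map_sub, sub_eq_zero] at this
    rw [hF, this]
  have hF0 : ∀ l, constantCoeff (F l) = 0 := fun l => by
    rw [← coeff_zero_eq_constantCoeff_apply, hFG 0 l 0 (by simp), coeff_zero_eq_constantCoeff_apply,
      G0]
  refine ⟨F, fun l => ?_, hF0, fun l => ?_⟩
  -- Choose `s` so that `h` contributes at most `s / 2`, then `r` so that `P` does. All iterates
  -- then have norm at most `s` on the polydisc of radius `r`, and so has the limit, since any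
  -- finite partial sum of its norm is seen by one iterate.
  · obtain ⟨s, hs0, hs⟩ : ∃ s : ℝ≥0∞, (0 < s ∧ s < 1) ∧ ∀ l, wnorm s (h l) ≤ s / 2 := by
      have := (eventually_all.2 fun l => eventually_wnorm_le_half (hh l) (hh2 l)).and
        (Ioo_mem_nhdsGT one_pos)
      obtain ⟨s, h1, h2⟩ := this.exists
      exact ⟨s, h2, h1⟩
    obtain ⟨r, hr, hr'⟩ : ∃ r : ℝ≥0∞, 0 < r ∧ ∀ l, wnorm r (P l) ≤ s / 2 := by
      have := (eventually_all.2 fun l => (tendsto_wnorm (hP l) (hP0 l)).eventually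
        (gt_mem_nhds (ENNReal.half_pos hs0.1.ne'))).and self_mem_nhdsWithin
      obtain ⟨r, h1, h2⟩ := this.exists
      exact ⟨r, h2, fun l => (h1 l).le⟩
    have hG : ∀ n l, wnorm r (G n l) ≤ s := by
      intro n
      induction n with
      | zero => intro l; simp [Gz, wnorm]
      | succ n ih =>
        intro l
        rw [Gs]
        refine (wnorm_add_le _ _ _).trans ?_
        calc _ ≤ s / 2 + s / 2 := by
              gcongr
              · exact hr' l
              · exact (wnorm_subst_le (hasSubst_of_constantCoeff_zero (G0 n)) ih _).trans (hs l)
          _ = s := ENNReal.add_halves s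
    refine isConvergent_iff_exists.2 ⟨r, hr, lt_of_le_of_lt ?_ (hs0.2.trans ENNReal.one_lt_top)⟩
    rw [wnorm, ENNReal.tsum_eq_iSup_sum]
    refine iSup_le fun S => ?_
    refine le_trans ?_ (hG (S.sup Finsupp.degree) l)
    refine le_trans (le_of_eq ?_) (ENNReal.sum_le_tsum S)
    exact Finset.sum_congr rfl fun d hd => by rw [hFG _ l d (Finset.le_sup hd)]
  · ext d
    rw [hFG (d.degree + 1) l d (by omega), Gs, map_add, map_add]
    congr 1
    have h1 : ∀ l, ((d.degree + 1 : ℕ) : ℕ∞) ≤ (G d.degree l - F l).order := by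
      intro l
      rw [natCast_le_order_iff]
      intro e he
      rw [map_sub, hFG d.degree l e (by omega), sub_self]
    have := natCast_le_order_iff.1 (le_order_subst_sub_subst (G0 _) hF0 h1 (hhj l)) d (by omega)
    rwa [map_sub, sub_eq_zero] at this

end Fixpoint
end PlaneBigerm

namespace PlaneBigerm
open PowerSeries

/-! ### Compositional inverses, units and roots in one variable -/

section OneVariable
variable {κ : Type*}

lemma X_pow_dvd_iff_le_order {n : ℕ} {f : ℂ⟦X⟧} : (X : ℂ⟦X⟧) ^ n ∣ f ↔ (n : ℕ∞) ≤ f.order := by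
  rw [X_pow_dvd_iff]
  exact ⟨nat_le_order f n, fun h m hm => coeff_of_lt_order m (lt_of_lt_of_le (by exact_mod_cast hm) h)⟩

lemma X_pow_dvd_iff_le_mvOrder {n : ℕ} {f : ℂ⟦X⟧} :
    (X : ℂ⟦X⟧) ^ n ∣ f ↔ (n : ℕ∞) ≤ MvPowerSeries.order f := by
  rw [X_pow_dvd_iff_le_order, order_eq_order]

lemma hasSubst_of_zero {ι : Type*} [Finite ι] {g : ι → MvPowerSeries κ ℂ}
    (h : ∀ l, MvPowerSeries.constantCoeff (g l) = 0) : MvPowerSeries.HasSubst g :=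
  MvPowerSeries.hasSubst_of_constantCoeff_zero h

lemma IsConvergent.powerSeries_subst {f : ℂ⟦X⟧} {g : MvPowerSeries κ ℂ} (hf : IsConvergent f)
    (hg : IsConvergent g) (h0 : MvPowerSeries.constantCoeff g = 0) : IsConvergent (f.subst g) := by
  rw [PowerSeries.subst_def]
  exact IsConvergent.subst hf (fun _ => hg) (fun _ => h0)

lemma isConvergent_powerSeries_X : IsConvergent (X : ℂ⟦X⟧) := isConvergent_X ()

lemma constantCoeff_subst' {f g : ℂ⟦X⟧} (hf : constantCoeff f = 0) (hg : constantCoeff g = 0) :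
    constantCoeff (f.subst g : ℂ⟦X⟧) = 0 :=
  constantCoeff_subst_zero (ι := Unit) (fun _ => hg) hf

lemma X_pow_dvd_subst {f g : ℂ⟦X⟧} (hg : constantCoeff g = 0) {n : ℕ} (hf : X ^ n ∣ f) :
    X ^ n ∣ (f.subst g : ℂ⟦X⟧) := by
  obtain ⟨h, rfl⟩ := hf
  have hs := HasSubst.of_constantCoeff_zero' hg
  rw [subst_mul hs, subst_pow hs, subst_X hs]
  exact Dvd.dvd.mul_right (pow_dvd_pow_of_dvd (X_dvd_iff.2 hg) n) _

/-- One-variable form of `le_order_subst_sub_subst`; divisibility by a power of `X` serves as the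
order condition from here on. -/
lemma X_pow_dvd_subst_sub_subst {f a b : ℂ⟦X⟧} (ha : constantCoeff a = 0)
    (hb : constantCoeff b = 0) {n j : ℕ} (h : X ^ n ∣ a - b) (hf : X ^ (j + 1) ∣ f) :
    X ^ (n + j) ∣ (f.subst a - f.subst b : ℂ⟦X⟧) := by
  rw [X_pow_dvd_iff_le_mvOrder] at *
  refine le_order_subst_sub_subst (ι := Unit) (fun _ => ha) (fun _ => hb) (fun _ => h)
    (f := f) (j := j) fun d _ hd => ?_
  exact natCast_le_order_iff.1 hf d (by omega)

lemma coeff_one_subst {f g : ℂ⟦X⟧} (hf : constantCoeff f = 0) (hg : constantCoeff g = 0) :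
    coeff 1 (f.subst g : ℂ⟦X⟧) = coeff 1 f * coeff 1 g := by
  have hs := HasSubst.of_constantCoeff_zero' hg
  obtain ⟨h, rfl⟩ := X_dvd_iff.2 hf
  obtain ⟨k, rfl⟩ := X_dvd_iff.2 hg
  rw [subst_mul hs, subst_X hs, mul_assoc]
  have h1 : ∀ u : ℂ⟦X⟧, coeff 1 (X * u) = constantCoeff u := fun u => by
    simp
  rw [h1, h1, h1, map_mul, mul_comm]
  congr 1
  have hc := constantCoeff_subst' (f := h - C (constantCoeff h)) (by simp) hg
  rw [subst_sub hs, map_sub, sub_eq_zero] at hc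
  rw [hc]
  exact (congrArg constantCoeff (PowerSeries.subst_C (constantCoeff h)
    (a := (X * k : ℂ⟦X⟧)))).trans (constantCoeff_C _)

lemma subst_subst {f a b : ℂ⟦X⟧} (ha : constantCoeff a = 0) (hb : constantCoeff b = 0) :
    (subst b (subst a f : ℂ⟦X⟧) : ℂ⟦X⟧) = subst (subst b a : ℂ⟦X⟧) f :=
  subst_comp_subst_apply (HasSubst.of_constantCoeff_zero' ha) (HasSubst.of_constantCoeff_zero' hb) f

/-- With `a` the linear coefficient of `ρ` and `h = X - a⁻¹ ρ`, of order two, the equation `ρ(σ) =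
X` becomes the fixed point equation `σ = a⁻¹ X + h(σ)`. -/
lemma exists_right_inverse {ρ : ℂ⟦X⟧} (hρ : IsReparam ρ) :
    ∃ σ : ℂ⟦X⟧, IsReparam σ ∧ ρ.subst σ = (X : ℂ⟦X⟧) := by
  obtain ⟨hc, h0, h1⟩ := hρ
  set a := coeff 1 ρ with ha
  let h : ℂ⟦X⟧ := X - a⁻¹ • ρ
  have hconv : IsConvergent h := isConvergent_powerSeries_X.sub (hc.smul _)
  have hh2 : 2 ≤ MvPowerSeries.order h := by
    have : X ^ 2 ∣ h := by
      rw [X_pow_dvd_iff]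
      intro m hm
      interval_cases m
      · simp [h, h0]
      · simp only [h, map_sub, coeff_one_X, map_smul, smul_eq_mul, ← ha]
        rw [inv_mul_cancel₀ h1, sub_self]
    exact_mod_cast X_pow_dvd_iff_le_mvOrder.1 this
  obtain ⟨G, hG1, hG2, hG3⟩ := exists_convergent_fixpoint (ι := Unit) (κ := Unit)
    (P := fun _ => (a⁻¹ • X : ℂ⟦X⟧)) (h := fun _ => h)
    (fun _ => isConvergent_powerSeries_X.smul _)
    (fun _ => show constantCoeff (a⁻¹ • X : ℂ⟦X⟧) = 0 by simp)
    (fun _ => hconv) (fun _ => hh2)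
  let σ : ℂ⟦X⟧ := G ()
  have hσ0 : constantCoeff σ = 0 := hG2 ()
  have hs := HasSubst.of_constantCoeff_zero' hσ0
  have e : σ = a⁻¹ • X + h.subst σ := hG3 ()
  have e2 : ρ.subst σ = (X : ℂ⟦X⟧) := by
    simp only [h] at e
    rw [subst_sub hs, subst_X hs, subst_smul hs] at e
    have e3 : a⁻¹ • (X - ρ.subst σ : ℂ⟦X⟧) = 0 := by
      rw [smul_sub]; linear_combination -e
    rcases smul_eq_zero.1 e3 with h4 | h4
    · exact absurd h4 (inv_ne_zero h1)
    · exact (sub_eq_zero.1 h4).symm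
  refine ⟨σ, ⟨hG1 (), hσ0, fun hz => ?_⟩, e2⟩
  have := coeff_one_subst h0 hσ0
  rw [e2, hz] at this
  simp at this

lemma exists_inverse {ρ : ℂ⟦X⟧} (hρ : IsReparam ρ) :
    ∃ σ : ℂ⟦X⟧, IsReparam σ ∧ ρ.subst σ = (X : ℂ⟦X⟧) ∧ σ.subst ρ = (X : ℂ⟦X⟧) := by
  obtain ⟨σ, hσ, e⟩ := exists_right_inverse hρ
  obtain ⟨τ, hτ, e'⟩ := exists_right_inverse hσ
  refine ⟨σ, hσ, e, ?_⟩
  have : ρ = τ := by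
    rw [← X_subst ρ, ← e', ← subst_subst hσ.2.1 hτ.2.1, e, subst_X (HasSubst.of_constantCoeff_zero' hτ.2.1)]
  rw [this, e']

lemma wnorm_eq_tsum (r : ENNReal) (f : ℂ⟦X⟧) : wnorm r f = ∑' n : ℕ, ‖coeff n f‖ₑ * r ^ n := by
  rw [wnorm, ← (Finsupp.uniqueEquiv (M := ℕ) ()).symm.tsum_eq]
  refine tsum_congr fun n => ?_
  have e : (Finsupp.uniqueEquiv (M := ℕ) ()).symm n = Finsupp.single () n := by
    ext; simp
  rw [e, Finsupp.degree_single]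
  rfl

/-- Shifting the coefficients by `n` multiplies the norm by `r ^ n`. -/
lemma isConvergent_of_X_pow_mul {n : ℕ} {f : ℂ⟦X⟧} (h : IsConvergent (X ^ n * f : ℂ⟦X⟧)) :
    IsConvergent f := by
  obtain ⟨r, hr, hr'⟩ := isConvergent_iff_exists.1 h
  wlog hrt : r ≠ ⊤ generalizing r
  · exact this 1 one_pos ((wnorm_mono (by simp_all) _).trans_lt hr') ENNReal.one_ne_top
  refine isConvergent_iff_exists.2 ⟨r, hr, ?_⟩
  have h1 : r ^ n * wnorm r f ≤ wnorm r (X ^ n * f : ℂ⟦X⟧) := by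
    rw [wnorm_eq_tsum, wnorm_eq_tsum, ← ENNReal.tsum_mul_left]
    calc _ = ∑' k : ℕ, ‖coeff (k + n) (X ^ n * f : ℂ⟦X⟧)‖ₑ * r ^ (k + n) := by
          refine tsum_congr fun k => ?_
          rw [coeff_X_pow_mul, pow_add]
          ring
      _ ≤ _ := ENNReal.tsum_comp_le_tsum_of_injective (add_left_injective n)
          fun k => ‖coeff k (X ^ n * f : ℂ⟦X⟧)‖ₑ * r ^ k
  refine lt_top_iff_ne_top.2 fun h' => ?_
  rw [h', ENNReal.mul_top (pow_ne_zero n hr.ne')] at h1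
  exact absurd hr' (not_lt.2 h1)

/-- Substitute `u = 1 - f / f(0)` into the geometric series. -/
lemma exists_inv {f : ℂ⟦X⟧} (hf : IsConvergent f) (h0 : constantCoeff f ≠ 0) :
    ∃ g : ℂ⟦X⟧, IsConvergent g ∧ f * g = 1 := by
  set a := constantCoeff f with ha
  let u : ℂ⟦X⟧ := 1 - a⁻¹ • f
  have hu : IsConvergent u := isConvergent_one.sub (hf.smul _)
  have hu0 : constantCoeff u = 0 := by
    simp only [u, map_sub, map_one, ← coeff_zero_eq_constantCoeff_apply, map_smul, smul_eq_mul]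
    rw [coeff_zero_eq_constantCoeff_apply, ← ha, inv_mul_cancel₀ h0, sub_self]
  let q : ℂ⟦X⟧ := PowerSeries.mk fun _ => 1
  have hq : IsConvergent q := by
    refine isConvergent_iff_exists.2 ⟨2⁻¹, by simp, ?_⟩
    have : wnorm 2⁻¹ q = ∑' n : ℕ, (2⁻¹ : ENNReal) ^ n := by
      rw [wnorm_eq_tsum]
      exact tsum_congr fun n => by simp [q]
    rw [this, ENNReal.tsum_geometric]
    simp [lt_top_iff_ne_top]
  have hs := HasSubst.of_constantCoeff_zero' hu0
  have hmul : q * (1 - X) = 1 := PowerSeries.mk_one_mul_one_sub_eq_one ℂ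
  have e := congrArg (substAlgHom hs) hmul
  rw [map_mul, map_sub, map_one, substAlgHom_X, coe_substAlgHom] at e
  refine ⟨a⁻¹ • q.subst u, (hq.powerSeries_subst hu hu0).smul _, ?_⟩
  simp only [u, sub_sub_cancel] at e ⊢
  rw [mul_smul_comm, ← smul_mul_assoc, mul_comm]
  exact e

/-- Writing the root as `1 + z`, the equation is `z = (f - 1) / m + h(z)` with `h = X - ((1 + X) ^ m
- 1) / m`, which has order two. -/
lemma exists_root {f : ℂ⟦X⟧} (hf : IsConvergent f) (h0 : constantCoeff f = 1) {m : ℕ}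
    (hm : m ≠ 0) :
    ∃ w : ℂ⟦X⟧, IsConvergent w ∧ constantCoeff w = 1 ∧ w ^ m = f := by
  have hm' : (m : ℂ) ≠ 0 := by exact_mod_cast hm
  let h : ℂ⟦X⟧ := X - (m : ℂ)⁻¹ • ((1 + X) ^ m - 1)
  have hconv : IsConvergent h := isConvergent_powerSeries_X.sub
    ((((isConvergent_one.add isConvergent_powerSeries_X).pow m).sub isConvergent_one).smul _)
  have hh2 : 2 ≤ MvPowerSeries.order h := by
    have : X ^ 2 ∣ h := by
      have h1 : (X : ℂ⟦X⟧) ^ 2 ∣ (1 + X) ^ m - (1 + (m : ℂ⟦X⟧) * X) := by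
        clear * -
        induction m with
        | zero => simp
        | succ m ih =>
          obtain ⟨c, hc⟩ := ih
          refine ⟨c * (1 + X) + (m : ℂ⟦X⟧), ?_⟩
          push_cast
          linear_combination (1 + X) * hc
      have h2 : h = - ((m : ℂ)⁻¹ • ((1 + X) ^ m - (1 + (m : ℂ⟦X⟧) * X))) := by
        have h3 : (m : ℂ)⁻¹ • ((m : ℂ⟦X⟧) * X) = X := by
          have : (m : ℂ⟦X⟧) * X = (m : ℂ) • X := by
            rw [Nat.cast_smul_eq_nsmul, nsmul_eq_mul]
          rw [this, smul_smul, inv_mul_cancel₀ hm', one_smul]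
        simp only [h]
        nth_rewrite 1 [← h3]
        simp only [smul_sub, smul_add]
        ring
      rw [h2]
      rw [smul_eq_C_mul]
      exact (h1.mul_left _).neg_right 
    exact_mod_cast X_pow_dvd_iff_le_mvOrder.1 this
  obtain ⟨G, hG1, hG2, hG3⟩ := exists_convergent_fixpoint (ι := Unit) (κ := Unit)
    (P := fun _ => ((m : ℂ)⁻¹ • (f - 1) : ℂ⟦X⟧)) (h := fun _ => h)
    (fun _ => (hf.sub isConvergent_one).smul _)
    (fun _ => show constantCoeff ((m : ℂ)⁻¹ • (f - 1) : ℂ⟦X⟧) = 0 by simp [h0])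
    (fun _ => hconv) (fun _ => hh2)
  let z : ℂ⟦X⟧ := G ()
  have hz0 : constantCoeff z = 0 := hG2 ()
  have hs := HasSubst.of_constantCoeff_zero' hz0
  have e : z = (m : ℂ)⁻¹ • (f - 1) + h.subst z := hG3 ()
  refine ⟨1 + z, isConvergent_one.add (hG1 ()), by simp [hz0], ?_⟩
  have e1 : h.subst z = z - (m : ℂ)⁻¹ • ((1 + z) ^ m - 1) := by
    rw [← coe_substAlgHom hs]
    simp only [h, map_sub, map_smul, map_pow, map_add, map_one, substAlgHom_X]
  rw [e1] at e
  have e2 : (m : ℂ)⁻¹ • (f - (1 + z) ^ m) = 0 := by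
    simp only [smul_sub] at e ⊢
    linear_combination -e
  rcases smul_eq_zero.1 e2 with h4 | h4
  · exact absurd h4 (inv_ne_zero hm')
  · exact (sub_eq_zero.1 h4).symm

end OneVariable
end PlaneBigerm

namespace PlaneBigerm
open PowerSeries

/-! ### The chain rule along a parametrized curve -/

section ChainRule
variable {ι : Type*}

lemma le_order_pderiv {n : ℕ} {f : MvPowerSeries ι ℂ} (hf : ((n + 1 : ℕ) : ℕ∞) ≤ f.order) (l : ι) :
    (n : ℕ∞) ≤ (MvPowerSeries.pderiv ℂ l f).order := by
  rw [natCast_le_order_iff] at *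
  intro d hd
  rw [MvPowerSeries.coeff_pderiv, hf _ (by simpa using hd), zero_mul]

lemma X_pow_dvd_derivative {n : ℕ} {f : ℂ⟦X⟧} (hf : X ^ (n + 1) ∣ f) :
    X ^ n ∣ derivative ℂ f := by
  rw [X_pow_dvd_iff] at *
  intro m hm
  rw [coeff_derivative, hf _ (by omega), zero_mul]

lemma derivative_subst_coe [Fintype ι] {p : ι → ℂ⟦X⟧} (hp : ∀ l, constantCoeff (p l) = 0)
    (f : MvPolynomial ι ℂ) :
    derivative ℂ (MvPowerSeries.subst p (f : MvPowerSeries ι ℂ) : ℂ⟦X⟧) =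
      ∑ l, (MvPowerSeries.subst p (MvPowerSeries.pderiv ℂ l (f : MvPowerSeries ι ℂ)) : ℂ⟦X⟧) *
        derivative ℂ (p l) := by
  classical
  have hs := hasSubst_of_zero (κ := Unit) hp
  simp_rw [MvPowerSeries.pderiv_coe, MvPowerSeries.subst_coe (S := ℂ)]
  induction f using MvPolynomial.induction_on with
  | C a => simp
  | add f g hf hg =>
    simp only [map_add, hf, hg, add_mul, Finset.sum_add_distrib]
  | mul_X f i hf =>
    simp only [map_mul, MvPolynomial.aeval_X, Derivation.leibniz, hf, smul_eq_mul, map_add,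
      MvPolynomial.pderiv_X, add_mul, Finset.sum_add_distrib, Finset.mul_sum]
    congr 1
    · rw [Finset.sum_eq_single i]
      · simp
      · intro j _ hj
        simp [hj.symm]
      · simp
    · exact Finset.sum_congr rfl fun l _ => by ring

/-- The chain rule for the composition of a power series with a parametrized curve. -/
theorem derivative_mvSubst [Fintype ι] {p : ι → ℂ⟦X⟧} (hp : ∀ l, constantCoeff (p l) = 0)
    (f : MvPowerSeries ι ℂ) :
    derivative ℂ (MvPowerSeries.subst p f : ℂ⟦X⟧) =
      ∑ l, (MvPowerSeries.subst p (MvPowerSeries.pderiv ℂ l f) : ℂ⟦X⟧) *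
        derivative ℂ (p l) := by
  have hs := hasSubst_of_zero (κ := Unit) hp
  rw [← sub_eq_zero]
  -- Truncating `f` at degree `n + 1` reduces to polynomials; a derivative costs one order, so the
  -- remainder affects both sides only modulo `X ^ n`.
  have key : ∀ n : ℕ, X ^ n ∣ derivative ℂ (MvPowerSeries.subst p f : ℂ⟦X⟧) -
      ∑ l, (MvPowerSeries.subst p (MvPowerSeries.pderiv ℂ l f) : ℂ⟦X⟧) * derivative ℂ (p l) := by
    intro n
    set g : MvPowerSeries ι ℂ := (MvPowerSeries.truncTotal (n + 1) f).toMvPowerSeries with hg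
    have h1 : ((n + 1 : ℕ) : ℕ∞) ≤ (f - g).order := by
      rw [natCast_le_order_iff]
      intro d hd
      rw [map_sub, hg, MvPolynomial.coeff_coe, MvPowerSeries.coeff_truncTotal _ hd, sub_self]
    have h2 := derivative_subst_coe hp (MvPowerSeries.truncTotal (n + 1) f)
    rw [← hg] at h2
    have h3 : X ^ n ∣ derivative ℂ (MvPowerSeries.subst p (f - g) : ℂ⟦X⟧) :=
      X_pow_dvd_derivative (X_pow_dvd_iff_le_mvOrder.2 (le_order_subst_of_le hp h1))
    have h4 : X ^ n ∣ ∑ l, (MvPowerSeries.subst p (MvPowerSeries.pderiv ℂ l (f - g)) : ℂ⟦X⟧) *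
        derivative ℂ (p l) := by
      refine Finset.dvd_sum fun l _ => Dvd.dvd.mul_right ?_ _
      exact X_pow_dvd_iff_le_mvOrder.2 (le_order_subst_of_le hp (le_order_pderiv h1 l))
    have e := dvd_sub h3 h4
    convert e using 1
    simp only [map_sub, MvPowerSeries.subst_sub hs, sub_mul, Finset.sum_sub_distrib]
    rw [h2]
    ring
  ext n
  exact X_pow_dvd_iff.1 (key (n + 1)) n (by omega)

end ChainRule

/-! ### Coordinate changes of the plane with unipotent linear part -/

section Plane

lemma eq_of_degree_lt_two {d : Fin 2 →₀ ℕ} (h : d.degree < 2) :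
    d = 0 ∨ d = Finsupp.single 0 1 ∨ d = Finsupp.single 1 1 := by
  rw [Finsupp.degree_eq_sum, Fin.sum_univ_two] at h
  have : (d 0 = 0 ∧ d 1 = 0) ∨ (d 0 = 1 ∧ d 1 = 0) ∨ (d 0 = 0 ∧ d 1 = 1) := by omega
  rcases this with h | h | h
  · left; ext i; fin_cases i <;> simp [h]
  · right; left; ext i; fin_cases i <;> simp [h]
  · right; right; ext i; fin_cases i <;> simp [h]

lemma two_le_order_iff {f : MvPowerSeries (Fin 2) ℂ} :
    2 ≤ f.order ↔ MvPowerSeries.constantCoeff f = 0 ∧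
      ∀ l, MvPowerSeries.coeff (Finsupp.single l 1) f = 0 := by
  have := natCast_le_order_iff (n := 2) (f := f)
  push_cast at this
  rw [this]
  constructor
  · exact fun h => ⟨h 0 (by simp), fun l => h _ (by simp)⟩
  · rintro ⟨h0, h1⟩ d hd
    rcases eq_of_degree_lt_two hd with rfl | rfl | rfl
    · exact h0
    · exact h1 0
    · exact h1 1

/-- Convergent coordinate changes of the plane with linear part `(x + b y, y)`. -/
structure IsUnipotent (b : ℂ) (s : Fin 2 → MvPowerSeries (Fin 2) ℂ) : Prop where
  convergent : ∀ l, IsConvergent (s l)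
  order_x : 2 ≤ (s 0 - MvPowerSeries.X 0 - MvPowerSeries.C b * MvPowerSeries.X 1).order
  order_y : 2 ≤ (s 1 - MvPowerSeries.X 1).order

lemma IsUnipotent.zero {b : ℂ} {s : Fin 2 → MvPowerSeries (Fin 2) ℂ} (h : IsUnipotent b s)
    (l : Fin 2) : MvPowerSeries.constantCoeff (s l) = 0 := by
  have h0 := (two_le_order_iff.1 h.order_x).1
  have h1 := (two_le_order_iff.1 h.order_y).1
  fin_cases l
  · simpa using h0
  · simpa using h1

/-- Order conditions compose and invert more easily than conditions on coefficients, and a free `b`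
treats both values of `δ` at once. -/
lemma memGroup_iff {δ : ℕ} {ρ : Fin 2 → ℂ⟦X⟧} {s : Fin 2 → MvPowerSeries (Fin 2) ℂ} :
    MemGroup δ ρ s ↔ (∀ i, IsConvergent (ρ i) ∧ constantCoeff (ρ i) = 0 ∧ coeff 1 (ρ i) = 1) ∧
      ∃ b : ℂ, IsUnipotent (b * ((δ : ℂ) - 1)) s := by
  constructor
  · rintro ⟨h1, h2, h3, h4, h5, ⟨h6, b, h7⟩, h8, h9⟩
    refine ⟨fun i => ⟨h1 i, h2 i, h3 i⟩, b, h4, ?_, ?_⟩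
    · rw [two_le_order_iff]
      refine ⟨by simp [h5], fun l => ?_⟩
      rw [map_sub, map_sub, MvPowerSeries.coeff_C_mul]
      fin_cases l <;> simp [h6, h7, MvPowerSeries.coeff_X, Finsupp.single_eq_single_iff]
    · rw [two_le_order_iff]
      refine ⟨by simp [h5], fun l => ?_⟩
      rw [map_sub]
      fin_cases l <;> simp [h8, h9, MvPowerSeries.coeff_X, Finsupp.single_eq_single_iff]
  · rintro ⟨h, b, hb⟩
    have h0 := (two_le_order_iff.1 hb.order_x).2
    have h1 := (two_le_order_iff.1 hb.order_y).2
    refine ⟨fun i => (h i).1, fun i => (h i).2.1, fun i => (h i).2.2, hb.convergent, hb.zero,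
      ⟨?_, b, ?_⟩, ?_, ?_⟩
    · have := h0 0
      rw [map_sub, map_sub, MvPowerSeries.coeff_C_mul] at this
      simpa [MvPowerSeries.coeff_X, Finsupp.single_eq_single_iff, sub_eq_zero] using this
    · have := h0 1
      rw [map_sub, map_sub, MvPowerSeries.coeff_C_mul] at this
      simpa [MvPowerSeries.coeff_X, Finsupp.single_eq_single_iff, sub_eq_zero] using this
    · have := h1 0
      rw [map_sub] at this
      simpa [MvPowerSeries.coeff_X, Finsupp.single_eq_single_iff, sub_eq_zero] using this
    · have := h1 1
      rw [map_sub] at this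
      simpa [MvPowerSeries.coeff_X, Finsupp.single_eq_single_iff, sub_eq_zero] using this

lemma two_le_order_subst {s : Fin 2 → MvPowerSeries (Fin 2) ℂ}
    (hs : ∀ l, MvPowerSeries.constantCoeff (s l) = 0) {f : MvPowerSeries (Fin 2) ℂ}
    (hf : 2 ≤ f.order) : 2 ≤ (MvPowerSeries.subst s f).order := by
  exact_mod_cast le_order_subst_of_le (n := 2) hs (by exact_mod_cast hf)

lemma IsUnipotent.comp {b c : ℂ} {s u : Fin 2 → MvPowerSeries (Fin 2) ℂ} (hs : IsUnipotent b s)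
    (hu : IsUnipotent c u) : IsUnipotent (b + c) (fun l => MvPowerSeries.subst s (u l)) := by
  have hS := hasSubst_of_zero hs.zero
  refine ⟨fun l => (hu.convergent l).subst hs.convergent hs.zero, ?_, ?_⟩
  · have h1 := two_le_order_subst hs.zero hu.order_x
    rw [← MvPowerSeries.coe_substAlgHom hS] at h1 ⊢
    have hC : MvPowerSeries.substAlgHom hS (MvPowerSeries.C c) = MvPowerSeries.C c := by
      rw [MvPowerSeries.coe_substAlgHom, MvPowerSeries.subst_C]
    have h2 : 2 ≤ (MvPowerSeries.C c * (s 1 - MvPowerSeries.X 1)).order := by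
      simpa using add_le_order_mul (m := 0) zero_le hs.order_y
    refine le_trans (le_order_add (le_order_add h1 hs.order_x) h2) (le_of_eq ?_)
    congr 1
    simp only [map_sub, map_mul, MvPowerSeries.substAlgHom_X, hC, map_add]
    ring
  · have h1 := two_le_order_subst hs.zero hu.order_y
    rw [← MvPowerSeries.coe_substAlgHom hS] at h1 ⊢
    refine le_trans (le_order_add h1 hs.order_y) (le_of_eq ?_)
    congr 1
    simp only [map_sub, MvPowerSeries.substAlgHom_X]
    ring

lemma IsUnipotent.exists_right_inverse {b : ℂ} {s : Fin 2 → MvPowerSeries (Fin 2) ℂ}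
    (hs : IsUnipotent b s) :
    ∃ u, IsUnipotent (-b) u ∧ ∀ l, MvPowerSeries.subst u (s l) = MvPowerSeries.X l := by
  set h0 := s 0 - MvPowerSeries.X 0 - MvPowerSeries.C b * MvPowerSeries.X 1 with hh0
  set h1 := s 1 - MvPowerSeries.X 1 with hh1
  have c0 : IsConvergent h0 :=
    ((hs.convergent 0).sub (isConvergent_X 0)).sub ((isConvergent_C b).mul (isConvergent_X 1))
  have c1 : IsConvergent h1 := (hs.convergent 1).sub (isConvergent_X 1)
  have ho : 2 ≤ (MvPowerSeries.C b * h1 - h0).order :=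
    le_order_sub (by simpa using add_le_order_mul (m := 0) zero_le hs.order_y) hs.order_x
  have ho1 : 2 ≤ (-h1).order := by rw [MvPowerSeries.order_neg]; exact hs.order_y
  -- With `s = (x + b y + h₀, y + h₁)`, solving `s(G) = (x, y)` gives `G₁ = y - h₁(G)`, and
  -- eliminating `G₁` from the first equation gives `G₀ = x - b y + (b h₁ - h₀)(G)`.
  obtain ⟨G, hG1, hG2, hG3⟩ := exists_convergent_fixpoint (ι := Fin 2) (κ := Fin 2)
    (P := ![MvPowerSeries.X 0 - MvPowerSeries.C b * MvPowerSeries.X 1, MvPowerSeries.X 1])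
    (h := ![MvPowerSeries.C b * h1 - h0, -h1])
    (by
      intro l
      fin_cases l
      · exact (isConvergent_X 0).sub ((isConvergent_C b).mul (isConvergent_X 1))
      · exact isConvergent_X 1)
    (by intro l; fin_cases l <;> simp)
    (by
      intro l
      fin_cases l
      · exact ((isConvergent_C b).mul c1).sub c0
      · exact c1.neg)
    (by
      intro l
      fin_cases l
      · exact ho
      · exact ho1)
  have hS := hasSubst_of_zero hG2
  have e0 : G 0 = MvPowerSeries.X 0 - MvPowerSeries.C b * MvPowerSeries.X 1 +
    MvPowerSeries.subst G (MvPowerSeries.C b * h1 - h0) := hG3 0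
  have e1 : G 1 = MvPowerSeries.X 1 + MvPowerSeries.subst G (-h1) := hG3 1
  refine ⟨G, ⟨hG1, ?_, ?_⟩, ?_⟩
  · refine le_trans (two_le_order_subst hG2 ho) (le_of_eq ?_)
    congr 1
    rw [e0, map_neg]; ring
  · refine le_trans (two_le_order_subst hG2 ho1) (le_of_eq ?_)
    congr 1
    rw [e1]; ring
  · have hC : MvPowerSeries.substAlgHom hS (MvPowerSeries.C b) = MvPowerSeries.C b := by
      rw [MvPowerSeries.coe_substAlgHom, MvPowerSeries.subst_C]
    rw [← MvPowerSeries.coe_substAlgHom hS] at *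
    have s0 : s 0 = h0 + MvPowerSeries.X 0 + MvPowerSeries.C b * MvPowerSeries.X 1 := by
      rw [hh0]; ring
    have s1 : s 1 = h1 + MvPowerSeries.X 1 := by rw [hh1]; ring
    rw [map_sub, map_mul, hC] at e0
    rw [map_neg] at e1
    intro l
    fin_cases l
    · change MvPowerSeries.substAlgHom hS (s 0) = MvPowerSeries.X 0
      rw [s0, map_add, map_add, map_mul, hC, MvPowerSeries.substAlgHom_X,
        MvPowerSeries.substAlgHom_X]
      linear_combination e0 + MvPowerSeries.C b * e1
    · change MvPowerSeries.substAlgHom hS (s 1) = MvPowerSeries.X 1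
      rw [s1, map_add, MvPowerSeries.substAlgHom_X]
      linear_combination e1

lemma IsUnipotent.exists_inverse {b : ℂ} {s : Fin 2 → MvPowerSeries (Fin 2) ℂ}
    (hs : IsUnipotent b s) :
    ∃ u, IsUnipotent (-b) u ∧ (∀ l, MvPowerSeries.subst u (s l) = MvPowerSeries.X l) ∧
      ∀ l, MvPowerSeries.subst s (u l) = MvPowerSeries.X l := by
  obtain ⟨u, hu, e⟩ := hs.exists_right_inverse
  obtain ⟨v, hv, e'⟩ := hu.exists_right_inverse
  refine ⟨u, hu, e, ?_⟩
  have : v = s := by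
    funext l
    have h1 : MvPowerSeries.subst v (MvPowerSeries.subst u (s l)) = s l := by
      rw [MvPowerSeries.subst_comp_subst_apply (hasSubst_of_zero hu.zero)
        (hasSubst_of_zero hv.zero)]
      simp only [e']
      rw [MvPowerSeries.subst_self, id]
    rw [← h1, e, MvPowerSeries.subst_X (hasSubst_of_zero hv.zero)]
  rw [← this]
  exact e'

end Plane
end PlaneBigerm

namespace PlaneBigerm
open PowerSeries

/-! ### The equivalence relation and its invariants -/

section Equivalence

lemma subst_mvSubst {p : Fin 2 → ℂ⟦X⟧} (hp : ∀ l, constantCoeff (p l) = 0) {ρ : ℂ⟦X⟧}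
    (hρ : constantCoeff ρ = 0) (f : MvPowerSeries (Fin 2) ℂ) :
    (PowerSeries.subst ρ (MvPowerSeries.subst p f : ℂ⟦X⟧) : ℂ⟦X⟧) =
      (MvPowerSeries.subst (fun l => (PowerSeries.subst ρ (p l) : ℂ⟦X⟧)) f : ℂ⟦X⟧) :=
  MvPowerSeries.subst_comp_subst_apply (hasSubst_of_zero (κ := Unit) hp)
    (hasSubst_of_zero (ι := Unit) (κ := Unit) fun _ => hρ) f

lemma mvSubst_mvSubst {p : Fin 2 → ℂ⟦X⟧} (hp : ∀ l, constantCoeff (p l) = 0)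
    {s : Fin 2 → MvPowerSeries (Fin 2) ℂ} (hs : ∀ l, MvPowerSeries.constantCoeff (s l) = 0)
    (f : MvPowerSeries (Fin 2) ℂ) :
    (MvPowerSeries.subst p (MvPowerSeries.subst s f) : ℂ⟦X⟧) =
      (MvPowerSeries.subst (fun l => (MvPowerSeries.subst p (s l) : ℂ⟦X⟧)) f : ℂ⟦X⟧) :=
  MvPowerSeries.subst_comp_subst_apply (hasSubst_of_zero hs) (hasSubst_of_zero (κ := Unit) hp) f

lemma mvSubst_X {p : Fin 2 → ℂ⟦X⟧} (hp : ∀ l, constantCoeff (p l) = 0) (l : Fin 2) :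
    (MvPowerSeries.subst p (MvPowerSeries.X l : MvPowerSeries (Fin 2) ℂ) : ℂ⟦X⟧) = p l :=
  MvPowerSeries.subst_X (hasSubst_of_zero (κ := Unit) hp) l

lemma constantCoeff_mvSubst {p : Fin 2 → ℂ⟦X⟧} (hp : ∀ l, constantCoeff (p l) = 0)
    {f : MvPowerSeries (Fin 2) ℂ} (hf : MvPowerSeries.constantCoeff f = 0) :
    constantCoeff (MvPowerSeries.subst p f : ℂ⟦X⟧) = 0 :=
  constantCoeff_subst_zero (κ := Unit) hp hf

lemma IsReparam.of_coeff_one {ρ : ℂ⟦X⟧}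
    (h : IsConvergent ρ ∧ constantCoeff ρ = 0 ∧ coeff 1 ρ = 1) : IsReparam ρ :=
  ⟨h.1, h.2.1, by rw [h.2.2]; exact one_ne_zero⟩

lemma subst_subst_inverse {ρ σ f : ℂ⟦X⟧} (hρ : constantCoeff ρ = 0) (hσ : constantCoeff σ = 0)
    (h : (ρ.subst σ : ℂ⟦X⟧) = X) : (subst σ (subst ρ f : ℂ⟦X⟧) : ℂ⟦X⟧) = f := by
  rw [subst_subst hρ hσ, h, X_subst]

lemma X_pow_dvd_subst_iff {ρ : ℂ⟦X⟧} (hρ : IsReparam ρ) {f : ℂ⟦X⟧} {n : ℕ} :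
    X ^ n ∣ (f.subst ρ : ℂ⟦X⟧) ↔ X ^ n ∣ f := by
  obtain ⟨σ, hσ, e, -⟩ := exists_inverse hρ
  refine ⟨fun h => ?_, X_pow_dvd_subst hρ.2.1⟩
  have := X_pow_dvd_subst hσ.2.1 h
  rwa [subst_subst_inverse hρ.2.1 hσ.2.1 e] at this

lemma order_eq_of_dvd_iff {f g : ℂ⟦X⟧} (h : ∀ n : ℕ, X ^ n ∣ f ↔ X ^ n ∣ g) :
    f.order = g.order := by
  simp_rw [X_pow_dvd_iff_le_order] at h
  exact le_antisymm (ENat.forall_natCast_le_iff_le.1 fun n hn => (h n).1 hn)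
    (ENat.forall_natCast_le_iff_le.1 fun n hn => (h n).2 hn)

lemma order_subst_reparam {ρ : ℂ⟦X⟧} (hρ : IsReparam ρ) (f : ℂ⟦X⟧) :
    PowerSeries.order (f.subst ρ : ℂ⟦X⟧) = f.order :=
  order_eq_of_dvd_iff fun _ => X_pow_dvd_subst_iff hρ

variable {δ : ℕ} {φ ψ χ : BranchPair}

lemma AEquiv.symm (hφ : ∀ i l, constantCoeff (φ i l) = 0) (hψ : ∀ i l, constantCoeff (ψ i l) = 0)
    (h : AEquiv δ φ ψ) : AEquiv δ ψ φ := by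
  obtain ⟨ρ, s, hm, e⟩ := h
  obtain ⟨hρ, b, hs⟩ := memGroup_iff.1 hm
  choose σ hσ e1 e2 using fun i => exists_inverse (IsReparam.of_coeff_one (hρ i))
  obtain ⟨u, hu, e3, e4⟩ := hs.exists_inverse
  refine ⟨σ, u, memGroup_iff.2 ⟨fun i => ⟨(hσ i).1, (hσ i).2.1, ?_⟩, -b, by rwa [neg_mul]⟩, ?_⟩
  · have := coeff_one_subst (hρ i).2.1 (hσ i).2.1
    rw [e1, (hρ i).2.2, one_mul] at this
    rw [← this, coeff_one_X]
  · intro i l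
    have h1 : (subst (ρ i) (MvPowerSeries.subst (ψ i) (u l) : ℂ⟦X⟧) : ℂ⟦X⟧) = φ i l := by
      rw [subst_mvSubst (hψ i) (hρ i).2.1]
      simp_rw [e]
      rw [← mvSubst_mvSubst (hφ i) hs.zero, e4, mvSubst_X (hφ i)]
    rw [← h1, subst_subst_inverse (hρ i).2.1 (hσ i).2.1 (e1 i)]

lemma AEquiv.trans (hφ : ∀ i l, constantCoeff (φ i l) = 0)
    (hψ : ∀ i l, constantCoeff (ψ i l) = 0) (h : AEquiv δ φ ψ) (h' : AEquiv δ ψ χ) :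
    AEquiv δ φ χ := by
  obtain ⟨ρ, s, hm, e⟩ := h
  obtain ⟨hρ, b, hs⟩ := memGroup_iff.1 hm
  obtain ⟨ρ', s', hm', e'⟩ := h'
  obtain ⟨hρ', b', hs'⟩ := memGroup_iff.1 hm'
  refine ⟨fun i => (ρ' i).subst (ρ i), fun l => MvPowerSeries.subst s (s' l),
    memGroup_iff.2 ⟨fun i => ⟨(hρ' i).1.powerSeries_subst (hρ i).1 (hρ i).2.1,
      constantCoeff_subst' (hρ' i).2.1 (hρ i).2.1, ?_⟩, b + b', ?_⟩, ?_⟩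
  · rw [coeff_one_subst (hρ' i).2.1 (hρ i).2.1, (hρ i).2.2, (hρ' i).2.2, one_mul]
  · rw [add_mul]
    exact hs.comp hs'
  · intro i l
    rw [← subst_subst (hρ' i).2.1 (hρ i).2.1, e', subst_mvSubst (hψ i) (hρ i).2.1,
      mvSubst_mvSubst (hφ i) hs.zero]
    simp_rw [e]

/-- A function `η` on the target pulls back to `η ∘ s`; its values agree because reparametrizations
preserve orders. -/
lemma valueSemigroup_subset (hφ : ∀ i l, constantCoeff (φ i l) = 0)
    (hψ : ∀ i l, constantCoeff (ψ i l) = 0) (h : AEquiv δ φ ψ) :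
    valueSemigroup ψ ⊆ valueSemigroup φ := by
  obtain ⟨ρ, s, hm, e⟩ := h
  obtain ⟨hρ, b, hs⟩ := memGroup_iff.1 hm
  rintro a ⟨η, hη, ha⟩
  refine ⟨MvPowerSeries.subst s η, hη.subst hs.convergent hs.zero, fun i => ?_⟩
  rw [ha, mvSubst_mvSubst (hφ i) hs.zero]
  simp_rw [← e]
  rw [← subst_mvSubst (hψ i) (hρ i).2.1, order_subst_reparam (IsReparam.of_coeff_one (hρ i))]

lemma valueSemigroup_eq (hφ : ∀ i l, constantCoeff (φ i l) = 0)
    (hψ : ∀ i l, constantCoeff (ψ i l) = 0) (h : AEquiv δ φ ψ) :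
    valueSemigroup ψ = valueSemigroup φ :=
  (valueSemigroup_subset hφ hψ h).antisymm (valueSemigroup_subset hψ hφ (h.symm hφ hψ))

/-- Differentials are transported by `s^*`. Two things have to be seen: `s^* ω` stays in `Ω[δ]`, and
its pullback to `φ i` is that of `ω` to `ψ i`, reparametrized and multiplied by the unit `ρ'`. -/
lemma Lambda_subset (hφ : ∀ i l, constantCoeff (φ i l) = 0)
    (hψ : ∀ i l, constantCoeff (ψ i l) = 0) (hmult : ∀ i, mult ψ i = mult φ i)
    (h : AEquiv δ φ ψ) : Lambda δ ψ ⊆ Lambda δ φ := by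
  obtain ⟨ρ, s, hm, e⟩ := h
  obtain ⟨hρ, b, hs⟩ := memGroup_iff.1 hm
  rintro a ⟨ω, ⟨η, β, hη, hη2, hω0, hω1⟩, ha⟩
  have hS := hasSubst_of_zero hs.zero
  set β' := β * ((δ : ℂ) - 1) with hβ'
  have hωc : ∀ l, IsConvergent (ω l) := by
    intro l
    fin_cases l
    · change IsConvergent (ω 0); rw [hω0]; exact hη 0
    · change IsConvergent (ω 1); rw [hω1]
      exact ((isConvergent_C _).mul (isConvergent_X 1)).add (hη 1)
  let ω' : Fin 2 → MvPowerSeries (Fin 2) ℂ := fun l =>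
    ∑ j, MvPowerSeries.subst s (ω j) * MvPowerSeries.pderiv ℂ l (s j)
  have hω'c : ∀ l, IsConvergent (ω' l) := fun l => IsConvergent.sum fun j _ =>
    ((hωc j).subst hs.convergent hs.zero).mul ((hs.convergent j).pderiv l)
  have hsub1 : MvPowerSeries.subst s (ω 1) = MvPowerSeries.C β' * s 1 +
      MvPowerSeries.subst s (η 1) := by
    rw [hω1, MvPowerSeries.subst_add hS, MvPowerSeries.subst_mul hS, MvPowerSeries.subst_C,
      MvPowerSeries.subst_X hS]
  have ord0 : 2 ≤ (MvPowerSeries.subst s (ω 0)).order := by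
    rw [hω0]; exact two_le_order_subst hs.zero (hη2 0)
  have ord1 : 2 ≤ (MvPowerSeries.subst s (η 1)).order := two_le_order_subst hs.zero (hη2 1)
  have mulr : ∀ {f g : MvPowerSeries (Fin 2) ℂ}, 2 ≤ f.order → 2 ≤ (f * g).order :=
    fun hf => by simpa using add_le_order_mul (n := 0) hf zero_le
  have mull : ∀ {f g : MvPowerSeries (Fin 2) ℂ}, 2 ≤ g.order → 2 ≤ (f * g).order :=
    fun hf => by simpa using add_le_order_mul (m := 0) zero_le hf
  have hd : ∀ l, 1 ≤ (MvPowerSeries.pderiv ℂ l (s 1 - MvPowerSeries.X 1)).order := fun l => by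
    exact_mod_cast le_order_pderiv (n := 1) (by exact_mod_cast hs.order_y) l
  have h11 : 2 ≤ (MvPowerSeries.C β' * s 1 *
      MvPowerSeries.pderiv ℂ 0 (s 1 - MvPowerSeries.X 1)).order := by
    have := add_le_order_mul (m := 1) (n := 1)
      (one_le_order (f := MvPowerSeries.C β' * s 1) (by simp [hs.zero])) (hd 0)
    refine le_trans (by norm_num) this
  have h12 : 2 ≤ (MvPowerSeries.C β' * s 1 *
      MvPowerSeries.pderiv ℂ 1 (s 1 - MvPowerSeries.X 1)).order := by
    have := add_le_order_mul (m := 1) (n := 1)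
      (one_le_order (f := MvPowerSeries.C β' * s 1) (by simp [hs.zero])) (hd 1)
    refine le_trans (by norm_num) this
  have hp0 : MvPowerSeries.pderiv ℂ 0 (MvPowerSeries.X 1 : MvPowerSeries (Fin 2) ℂ) = 0 :=
    MvPowerSeries.pderiv_X_of_ne (by decide)
  have hp1 : MvPowerSeries.pderiv ℂ 1 (MvPowerSeries.X 1 : MvPowerSeries (Fin 2) ℂ) = 1 :=
    MvPowerSeries.pderiv_X_self
  have ho0 : 2 ≤ (ω' 0).order := by
    rw [map_sub, hp0, sub_zero] at h11
    simp only [ω', Fin.sum_univ_two]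
    rw [hsub1, add_mul]
    exact le_order_add (mulr ord0) (le_order_add h11 (mulr ord1))
  -- The term `β' y dy` survives with the same coefficient, since `s₁ = y` up to order two and
  -- `∂s₁/∂y = 1` up to order one.
  have ho1 : 2 ≤ (ω' 1 - MvPowerSeries.C β' * MvPowerSeries.X 1).order := by
    rw [map_sub, hp1] at h12
    have h13 : 2 ≤ (MvPowerSeries.C β' * (s 1 - MvPowerSeries.X 1)).order := mull hs.order_y
    have e1 : ω' 1 - MvPowerSeries.C β' * MvPowerSeries.X 1 =
        MvPowerSeries.subst s (ω 0) * MvPowerSeries.pderiv ℂ 1 (s 0) +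
        (MvPowerSeries.C β' * s 1 * (MvPowerSeries.pderiv ℂ 1 (s 1) - 1) +
        (MvPowerSeries.subst s (η 1) * MvPowerSeries.pderiv ℂ 1 (s 1) +
          MvPowerSeries.C β' * (s 1 - MvPowerSeries.X 1))) := by
      simp only [ω', Fin.sum_univ_two]
      rw [hsub1]
      ring
    rw [e1]
    exact le_order_add (mulr ord0) (le_order_add h12 (le_order_add (mulr ord1) h13))
  refine ⟨ω', ⟨![ω' 0, ω' 1 - MvPowerSeries.C β' * MvPowerSeries.X 1], β, ?_, ?_, rfl, ?_⟩, ?_⟩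
  · intro l
    fin_cases l
    · exact hω'c 0
    · exact (hω'c 1).sub ((isConvergent_C _).mul (isConvergent_X 1))
  · intro l
    fin_cases l
    · exact ho0
    · exact ho1
  · rw [← hβ']
    simp
  · intro i
    have hρi := HasSubst.of_constantCoeff_zero' (hρ i).2.1
    -- Chain rule on both sides of `s ∘ φ_i = ψ_i ∘ ρ_i`.
    have key : pullback φ i ω' = (pullback ψ i ω).subst (ρ i) * derivative ℂ (ρ i) := by
      have hpull : ∀ l, (MvPowerSeries.subst (φ i) (ω' l) : ℂ⟦X⟧) =
          ∑ j, (MvPowerSeries.subst (φ i) (MvPowerSeries.subst s (ω j)) : ℂ⟦X⟧) *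
            (MvPowerSeries.subst (φ i) (MvPowerSeries.pderiv ℂ l (s j)) : ℂ⟦X⟧) := by
        intro l
        rw [← MvPowerSeries.coe_substAlgHom (hasSubst_of_zero (κ := Unit) (hφ i))]
        simp only [ω', map_sum, map_mul]
      have h1 : ∀ j, (MvPowerSeries.subst (φ i) (MvPowerSeries.subst s (ω j)) : ℂ⟦X⟧) =
          subst (ρ i) (MvPowerSeries.subst (ψ i) (ω j) : ℂ⟦X⟧) := by
        intro j
        rw [subst_mvSubst (hψ i) (hρ i).2.1, mvSubst_mvSubst (hφ i) hs.zero]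
        simp_rw [e]
      have h2 : ∀ j, ∑ l, (MvPowerSeries.subst (φ i) (MvPowerSeries.pderiv ℂ l (s j)) : ℂ⟦X⟧) *
          derivative ℂ (φ i l) = (derivative ℂ (ψ i j)).subst (ρ i) * derivative ℂ (ρ i) := by
        intro j
        rw [← derivative_mvSubst (hφ i), ← e, derivative_subst hρi]
      unfold pullback
      simp_rw [hpull, Finset.sum_mul]
      rw [Finset.sum_comm]
      rw [← coe_substAlgHom hρi, map_sum, Finset.sum_mul]
      refine Finset.sum_congr rfl fun j _ => ?_
      rw [map_mul, coe_substAlgHom hρi, mul_assoc, ← h2, ← h1, Finset.mul_sum]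
      exact Finset.sum_congr rfl fun l _ => mul_assoc _ _ _
    have hord : (derivative ℂ (ρ i)).order = 0 := by
      by_contra hne
      have := order_ne_zero_iff_constCoeff_eq_zero.1 hne
      rw [← coeff_zero_eq_constantCoeff_apply, coeff_derivative] at this
      simp [(hρ i).2.2] at this
    rw [key, order_mul, hord, add_zero, order_subst_reparam (IsReparam.of_coeff_one (hρ i)),
      ← hmult, ha]

lemma Lambda_eq (hφ : ∀ i l, constantCoeff (φ i l) = 0)
    (hψ : ∀ i l, constantCoeff (ψ i l) = 0) (hmult : ∀ i, mult ψ i = mult φ i)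
    (h : AEquiv δ φ ψ) : Lambda δ ψ = Lambda δ φ :=
  (Lambda_subset hφ hψ hmult h).antisymm
    (Lambda_subset hψ hφ (fun i => (hmult i).symm) (h.symm hφ hψ))

lemma IsReparam.comp {ρ σ : ℂ⟦X⟧} (hρ : IsReparam ρ) (hσ : IsReparam σ) :
    IsReparam (ρ.subst σ : ℂ⟦X⟧) :=
  ⟨hρ.1.powerSeries_subst hσ.1 hσ.2.1, constantCoeff_subst' hρ.2.1 hσ.2.1, by
    rw [coeff_one_subst hρ.2.1 hσ.2.1]; exact mul_ne_zero hρ.2.2 hσ.2.2⟩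

/-- Since `φ_i = u ∘ ψ_i ∘ σ_i` with `u` inverse to `s`, a factorization of a branch of `ψ`, or a
coincidence of its two branches, carries over to `φ`. -/
lemma isBigerm_of_aEquiv (hφ : IsBigerm φ) (hψc : ∀ i l, IsConvergent (ψ i l))
    (hψ : ∀ i l, constantCoeff (ψ i l) = 0) (h : AEquiv δ φ ψ) : IsBigerm ψ := by
  obtain ⟨σ, s, hm, e⟩ := h
  obtain ⟨hσ, b, hs⟩ := memGroup_iff.1 hm
  obtain ⟨u, hu, -, e4⟩ := hs.exists_inverse
  have hφψ : ∀ i l, φ i l = subst (σ i) (MvPowerSeries.subst (ψ i) (u l) : ℂ⟦X⟧) := by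
    intro i l
    rw [subst_mvSubst (hψ i) (hσ i).2.1]
    simp_rw [e]
    rw [← mvSubst_mvSubst (hφ.zero i) hs.zero, e4, mvSubst_X (hφ.zero i)]
  refine ⟨hψc, hψ, fun i q ρ hq hρ hρ0 hpq => ?_, ?_⟩
  -- The outer factor `q` has to pass through the origin before `u` can be composed with it; it does
  -- because `ψ i` does.
  · have hq0 : ∀ l, constantCoeff (q l) = 0 := by
      intro l
      have h0 := constantCoeff_subst' (f := q l - C (constantCoeff (q l))) (by simp) hρ0
      rw [subst_sub (HasSubst.of_constantCoeff_zero' hρ0), map_sub, ← hpq, hψ i l, zero_sub,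
        neg_eq_zero] at h0
      exact ((congrArg constantCoeff (PowerSeries.subst_C (constantCoeff (q l))
        (a := ρ))).trans (constantCoeff_C _)).symm.trans h0
    have h1 := hφ.primitive i (fun l => MvPowerSeries.subst q (u l)) (ρ.subst (σ i))
      (fun l => (hu.convergent l).subst hq hq0) (hρ.powerSeries_subst (hσ i).1 (hσ i).2.1)
      (constantCoeff_subst' hρ0 (hσ i).2.1) ?_
    · rw [coeff_one_subst hρ0 (hσ i).2.1, (hσ i).2.2, mul_one] at h1
      exact h1
    · intro l
      rw [hφψ, ← subst_subst hρ0 (hσ i).2.1, subst_mvSubst hq0 hρ0]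
      simp_rw [← hpq]
  · rintro ⟨ρ, hρ, hρe⟩
    obtain ⟨τ, hτ, e1, -⟩ := exists_inverse (IsReparam.of_coeff_one (hσ 0))
    have hr : IsReparam (subst (σ 1) (subst ρ τ : ℂ⟦X⟧) : ℂ⟦X⟧) :=
      (hτ.comp hρ).comp (IsReparam.of_coeff_one (hσ 1))
    refine hφ.distinct ⟨_, hr, fun l => ?_⟩
    have h1 : (MvPowerSeries.subst (ψ 0) (u l) : ℂ⟦X⟧) = subst τ (φ 0 l) := by
      rw [hφψ 0 l, subst_subst_inverse (hσ 0).2.1 hτ.2.1 e1]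
    have hτρ := constantCoeff_subst' hτ.2.1 hρ.2.1
    have h2 : (MvPowerSeries.subst (ψ 1) (u l) : ℂ⟦X⟧) =
        subst ρ (MvPowerSeries.subst (ψ 0) (u l) : ℂ⟦X⟧) := by
      rw [subst_mvSubst (hψ 0) hρ.2.1, funext hρe]
    have h3 : (MvPowerSeries.subst (ψ 1) (u l) : ℂ⟦X⟧) = subst (subst ρ τ : ℂ⟦X⟧) (φ 0 l) := by
      rw [h2, h1, subst_subst hτ.2.1 hρ.2.1]
    rw [hφψ 1 l, h3, subst_subst hτρ (hσ 1).2.1]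

end Equivalence
end PlaneBigerm

namespace PlaneBigerm
open PowerSeries

/-! ### Truncated exponentials of derivations and vector fields on the line -/

section TruncatedExponential

/-- `∑_{n < M} D ^ n / n!`. -/
noncomputable def truncExp {A : Type*} [AddCommGroup A] [Module ℂ A] (D : Module.End ℂ A) (M : ℕ) :
    Module.End ℂ A :=
  ∑ n ∈ Finset.range M, ((n.factorial : ℂ)⁻¹) • D ^ n

lemma truncExp_apply {A : Type*} [AddCommGroup A] [Module ℂ A] (D : Module.End ℂ A) (M : ℕ)
    (f : A) : truncExp D M f = ∑ n ∈ Finset.range M, ((n.factorial : ℂ)⁻¹) • (D ^ n) f := by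
  simp [truncExp, LinearMap.sum_apply]

/-- Divided powers `D ^ n / n!` remove the binomial coefficients. In the induction both sides are
multiplied by `n + 1`, which is split as the sum of the two indices. -/
lemma divided_leibniz {A : Type*} [CommRing A] [Algebra ℂ A] (D : Derivation ℂ A A) (f g : A)
    (n : ℕ) :
    ((n.factorial : ℂ)⁻¹) • ((D : Module.End ℂ A) ^ n) (f * g) =
      ∑ p ∈ Finset.HasAntidiagonal.antidiagonal n,
        (((p.1.factorial : ℂ)⁻¹) • ((D : Module.End ℂ A) ^ p.1) f) *
          (((p.2.factorial : ℂ)⁻¹) • ((D : Module.End ℂ A) ^ p.2) g) := by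
  have step : ∀ (k : ℕ) (h : A), D (((k.factorial : ℂ)⁻¹) • ((D : Module.End ℂ A) ^ k) h) =
      ((k : ℂ) + 1) • (((k + 1).factorial : ℂ)⁻¹) • ((D : Module.End ℂ A) ^ (k + 1)) h := by
    intro k h
    have hk : ((k : ℂ) + 1) ≠ 0 := by exact_mod_cast Nat.succ_ne_zero k
    rw [Derivation.map_smul, smul_smul, pow_succ', Nat.factorial_succ]
    push_cast
    rw [mul_inv, ← mul_assoc, mul_inv_cancel₀ hk, one_mul]
    rfl
  induction n with
  | zero => simp
  | succ n ih =>
    have hn : ((n : ℂ) + 1) ≠ 0 := by exact_mod_cast Nat.succ_ne_zero n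
    have h1 := congrArg D ih
    rw [step, map_sum] at h1
    refine smul_right_injective A hn ?_
    dsimp only
    rw [h1]
    simp only [Derivation.leibniz, step, smul_eq_mul]
    rw [Finset.sum_add_distrib, Finset.smul_sum]
    set F : ℕ → A := fun k => ((k.factorial : ℂ)⁻¹) • ((D : Module.End ℂ A) ^ k) f with hF
    set G : ℕ → A := fun k => ((k.factorial : ℂ)⁻¹) • ((D : Module.End ℂ A) ^ k) g with hG
    change ∑ p ∈ Finset.HasAntidiagonal.antidiagonal n, F p.1 * (((p.2 : ℂ) + 1) • G (p.2 + 1)) +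
      ∑ p ∈ Finset.HasAntidiagonal.antidiagonal n, G p.2 * (((p.1 : ℂ) + 1) • F (p.1 + 1)) =
      ∑ p ∈ Finset.HasAntidiagonal.antidiagonal (n + 1), ((n : ℂ) + 1) • (F p.1 * G p.2)
    have e : ∑ p ∈ Finset.HasAntidiagonal.antidiagonal (n + 1), ((n : ℂ) + 1) • (F p.1 * G p.2) =
        ∑ p ∈ Finset.HasAntidiagonal.antidiagonal (n + 1), ((p.2 : ℂ) • (F p.1 * G p.2)) +
        ∑ p ∈ Finset.HasAntidiagonal.antidiagonal (n + 1), ((p.1 : ℂ) • (F p.1 * G p.2)) := by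
      rw [← Finset.sum_add_distrib]
      refine Finset.sum_congr rfl fun p hp => ?_
      rw [← add_smul]
      congr 1
      have := Finset.HasAntidiagonal.mem_antidiagonal.1 hp
      have h2 : ((p.1 + p.2 : ℕ) : ℂ) = ((n + 1 : ℕ) : ℂ) := by rw [this]
      push_cast at h2
      rw [← h2]; ring
    rw [e]
    congr 1
    · rw [Finset.Nat.sum_antidiagonal_succ']
      simp
    · rw [Finset.Nat.sum_antidiagonal_succ]
      simp [mul_comm]

/-- The derivation `τ d/dt` of `ℂ⟦t⟧`. -/
noncomputable def vectorField (τ : ℂ⟦X⟧) : Module.End ℂ ℂ⟦X⟧ :=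
  ((τ • derivative ℂ : Derivation ℂ ℂ⟦X⟧ ℂ⟦X⟧) : Module.End ℂ ℂ⟦X⟧)

lemma vectorField_apply (τ f : ℂ⟦X⟧) : vectorField τ f = τ * derivative ℂ f := rfl

lemma vectorField_divided_leibniz (τ f g : ℂ⟦X⟧) (n : ℕ) :
    ((n.factorial : ℂ)⁻¹) • (vectorField τ ^ n) (f * g) =
      ∑ p ∈ Finset.HasAntidiagonal.antidiagonal n,
        (((p.1.factorial : ℂ)⁻¹) • (vectorField τ ^ p.1) f) *
          (((p.2.factorial : ℂ)⁻¹) • (vectorField τ ^ p.2) g) :=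
  divided_leibniz _ f g n

variable {τ : ℂ⟦X⟧}

/-- A field vanishing to order two raises orders by one. Hence the terms of index at least `M` in
the exponential lie in `(X ^ M)` and may be dropped. -/
lemma X_pow_dvd_vectorField (hτ : X ^ 2 ∣ τ) {f : ℂ⟦X⟧} {a : ℕ} (hf : X ^ a ∣ f) :
    X ^ (a + 1) ∣ vectorField τ f := by
  rw [vectorField_apply]
  rcases a with _ | a
  · exact ((pow_dvd_pow X (by norm_num)).trans hτ).mul_right _
  · have := mul_dvd_mul hτ (X_pow_dvd_derivative hf)
    rwa [← pow_add, show 2 + a = a + 1 + 1 by ring] at this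

lemma X_pow_dvd_vectorField_pow (hτ : X ^ 2 ∣ τ) {f : ℂ⟦X⟧} {a : ℕ} (hf : X ^ a ∣ f) (n : ℕ) :
    X ^ (a + n) ∣ ((vectorField τ) ^ n) f := by
  induction n with
  | zero => simpa using hf
  | succ n ih =>
    rw [pow_succ']
    exact X_pow_dvd_vectorField hτ ih

lemma X_pow_dvd_smul {n : ℕ} {f : ℂ⟦X⟧} (hf : X ^ n ∣ f) (c : ℂ) : X ^ n ∣ c • f := by
  rw [smul_eq_C_mul]
  exact hf.mul_left _

/-- By the Leibniz rule the truncated exponential of a product collects the index pairs of sum less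
than `M`; the product of the truncated exponentials has in addition only pairs of larger sum, each
lying in `(X ^ M)`. -/
lemma truncExp_mul (hτ : X ^ 2 ∣ τ) (M : ℕ) (f g : ℂ⟦X⟧) :
    X ^ M ∣ truncExp (vectorField τ) M (f * g) -
      truncExp (vectorField τ) M f *
      truncExp (vectorField τ) M g := by
  rw [truncExp_apply, truncExp_apply, truncExp_apply]
  simp_rw [vectorField_divided_leibniz]
  set D : Module.End ℂ ℂ⟦X⟧ := (vectorField τ)
    with hD
  set H : ℕ × ℕ → ℂ⟦X⟧ := fun p => (((p.1.factorial : ℂ)⁻¹) • (D ^ p.1) f) *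
          (((p.2.factorial : ℂ)⁻¹) • (D ^ p.2) g) with hH
  have h1 : ∑ n ∈ Finset.range M, ∑ p ∈ Finset.HasAntidiagonal.antidiagonal n, H p =
      ∑ p ∈ Finset.range M ×ˢ Finset.range M with p.1 + p.2 < M, H p := by
    rw [← Finset.sum_fiberwise_of_maps_to (t := Finset.range M) (g := fun p : ℕ × ℕ => p.1 + p.2)]
    · refine Finset.sum_congr rfl fun n hn => Finset.sum_congr ?_ fun _ _ => rfl
      ext p
      simp only [Finset.HasAntidiagonal.mem_antidiagonal, Finset.mem_filter, Finset.mem_product, Finset.mem_range]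
      have := Finset.mem_range.1 hn
      omega
    · intro p hp
      simpa using (Finset.mem_filter.1 hp).2
  rw [h1, Finset.sum_mul_sum, ← Finset.sum_product',
    ← Finset.sum_filter_add_sum_filter_not (Finset.range M ×ˢ Finset.range M)
      (fun p : ℕ × ℕ => p.1 + p.2 < M)]
  rw [sub_add_eq_sub_sub]
  change X ^ M ∣ ∑ p ∈ Finset.range M ×ˢ Finset.range M with p.1 + p.2 < M, H p -
    ∑ p ∈ Finset.range M ×ˢ Finset.range M with p.1 + p.2 < M, H p - _
  rw [sub_self, zero_sub, dvd_neg]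
  refine Finset.dvd_sum fun p hp => ?_
  have hp' := (Finset.mem_filter.1 hp).2
  have hle : M ≤ p.1 + p.2 := by omega
  refine (pow_dvd_pow X hle).trans ?_
  rw [pow_add]
  refine mul_dvd_mul (X_pow_dvd_smul ?_ _) (X_pow_dvd_smul ?_ _)
  · simpa using X_pow_dvd_vectorField_pow hτ (a := 0) (f := f) (by simp) p.1
  · simpa using X_pow_dvd_vectorField_pow hτ (a := 0) (f := g) (by simp) p.2

lemma X_pow_dvd_truncExp (hτ : X ^ 2 ∣ τ) (M : ℕ) {f : ℂ⟦X⟧} {a : ℕ} (hf : X ^ a ∣ f) :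
    X ^ a ∣ truncExp (vectorField τ) M f := by
  rw [truncExp_apply]
  exact Finset.dvd_sum fun n _ => X_pow_dvd_smul
    ((pow_dvd_pow X (Nat.le_add_right a n)).trans (X_pow_dvd_vectorField_pow hτ hf n)) _

lemma truncExp_sub_self (hτ : X ^ 2 ∣ τ) {M : ℕ} (hM : 1 ≤ M) {f : ℂ⟦X⟧} {a : ℕ}
    (hf : X ^ a ∣ f) :
    X ^ (a + 1) ∣
      truncExp (vectorField τ) M f - f := by
  obtain ⟨M, rfl⟩ : ∃ M', M = M' + 1 := ⟨M - 1, by omega⟩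
  rw [truncExp_apply, Finset.sum_range_succ']
  simp only [Nat.factorial_zero, Nat.cast_one, inv_one, pow_zero, one_smul, Module.End.one_apply,
    add_sub_cancel_right]
  exact Finset.dvd_sum fun n _ => X_pow_dvd_smul
    ((pow_dvd_pow X (by omega)).trans (X_pow_dvd_vectorField_pow hτ hf (n + 1))) _

/-- The truncated exponential of a vector field is a change of coordinate, up to high order. -/
theorem truncExp_sub_subst (hτ : X ^ 2 ∣ τ) {M : ℕ} (hM : 1 ≤ M) (f : ℂ⟦X⟧) :
    X ^ M ∣ truncExp (vectorField τ) M f -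
      f.subst (truncExp (vectorField τ) M (X : ℂ⟦X⟧)) := by
  set T := truncExp (vectorField τ) M with hT
  have h0 : constantCoeff (T X) = 0 := by
    rw [← X_dvd_iff]
    simpa using X_pow_dvd_truncExp hτ M (a := 1) (f := X) (by simp)
  have hs := HasSubst.of_constantCoeff_zero' h0
  -- Both operations are multiplicative modulo `X ^ M` and agree on constants and on `X`, hence on
  -- polynomials; a general `f` is a polynomial modulo `X ^ M`.
  have hpoly : ∀ p : Polynomial ℂ, X ^ M ∣ T (p : ℂ⟦X⟧) - (p : ℂ⟦X⟧).subst (T X) := by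
    intro p
    induction p using Polynomial.induction_on with
    | C a =>
      have h1 : T (C a) = C a := by
        obtain ⟨M, rfl⟩ : ∃ M', M = M' + 1 := ⟨M - 1, by omega⟩
        rw [hT, truncExp_apply, Finset.sum_range_succ', Finset.sum_eq_zero]
        · simp
        · intro n _
          rw [pow_succ, Module.End.mul_apply]
          simp [vectorField_apply]
      have h2 : (C a : ℂ⟦X⟧).subst (T X) = C a := PowerSeries.subst_C a
      rw [Polynomial.coe_C, h1, h2, sub_self]
      exact dvd_zero _
    | add p q hp hq =>
      have := dvd_add hp hq
      rw [Polynomial.coe_add, map_add, subst_add hs]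
      convert this using 1
      ring
    | monomial n a ih =>
      have e : ((Polynomial.C a * Polynomial.X ^ (n + 1) : Polynomial ℂ) : ℂ⟦X⟧) =
          ((Polynomial.C a * Polynomial.X ^ n : Polynomial ℂ) : ℂ⟦X⟧) * X := by
        rw [pow_succ, ← mul_assoc, Polynomial.coe_mul _ Polynomial.X, Polynomial.coe_X]
      rw [e, subst_mul hs, subst_X hs]
      have h1 := truncExp_mul hτ M
        ((Polynomial.C a * Polynomial.X ^ n : Polynomial ℂ) : ℂ⟦X⟧) X
      rw [← hT] at h1
      have h2 := dvd_add h1 (ih.mul_right (T X))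
      convert h2 using 1
      ring
  obtain ⟨g, hg⟩ : X ^ M ∣ f - (trunc M f : ℂ⟦X⟧) := by
    rw [X_pow_dvd_iff]
    intro n hn
    rw [map_sub, Polynomial.coeff_coe, coeff_trunc, if_pos hn, sub_self]
  have h1 : X ^ M ∣ T (f - (trunc M f : ℂ⟦X⟧)) := X_pow_dvd_truncExp hτ M ⟨g, hg⟩
  have h2 : X ^ M ∣ (f - (trunc M f : ℂ⟦X⟧)).subst (T X) := X_pow_dvd_subst h0 ⟨g, hg⟩
  have h3 := dvd_add (dvd_sub h1 h2) (hpoly (trunc M f))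
  convert h3 using 1
  rw [map_sub, subst_sub hs]
  ring

end TruncatedExponential
end PlaneBigerm

namespace PlaneBigerm
open PowerSeries

/-! ### Flows of plane vector fields and their effect on a curve -/

section PlaneFlow

/-- The derivation `V₀ ∂/∂x + V₁ ∂/∂y` of `ℂ⟦x, y⟧`. -/
noncomputable def planeField (V : Fin 2 → MvPowerSeries (Fin 2) ℂ) :
    Module.End ℂ (MvPowerSeries (Fin 2) ℂ) :=
  ∑ l, LinearMap.mulLeft ℂ (V l) ∘ₗ (MvPowerSeries.pderiv ℂ l : MvPowerSeries (Fin 2) ℂ →ₗ[ℂ] _)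

lemma planeField_apply (V : Fin 2 → MvPowerSeries (Fin 2) ℂ) (f : MvPowerSeries (Fin 2) ℂ) :
    planeField V f = ∑ l, V l * MvPowerSeries.pderiv ℂ l f := by
  simp [planeField]

variable {V : Fin 2 → MvPowerSeries (Fin 2) ℂ}

lemma planeField_X (V : Fin 2 → MvPowerSeries (Fin 2) ℂ) (l : Fin 2) :
    planeField V (MvPowerSeries.X l) = V l := by
  rw [planeField_apply, Finset.sum_eq_single l]
  · rw [MvPowerSeries.pderiv_X_self, mul_one]
  · intro j _ hj
    rw [MvPowerSeries.pderiv_X_of_ne hj.symm, mul_zero]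
  · simp

lemma IsConvergent.planeField (hV : ∀ l, IsConvergent (V l)) {f : MvPowerSeries (Fin 2) ℂ}
    (hf : IsConvergent f) : IsConvergent (planeField V f) := by
  rw [planeField_apply]
  exact IsConvergent.sum fun l _ => (hV l).mul (hf.pderiv l)

lemma IsConvergent.planeField_pow (hV : ∀ l, IsConvergent (V l)) {f : MvPowerSeries (Fin 2) ℂ}
    (hf : IsConvergent f) (n : ℕ) : IsConvergent ((PlaneBigerm.planeField V ^ n) f) := by
  induction n with
  | zero => simpa using hf
  | succ n ih =>
    rw [pow_succ', Module.End.mul_apply]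
    exact ih.planeField hV

lemma two_le_order_planeField (hV : ∀ l, 1 ≤ (V l).order) {f : MvPowerSeries (Fin 2) ℂ}
    (hf : 2 ≤ f.order) : 2 ≤ (planeField V f).order := by
  have h : ∀ l, 2 ≤ (V l * MvPowerSeries.pderiv ℂ l f).order := fun l => by
    have h1 : ((1 : ℕ) : ℕ∞) ≤ (MvPowerSeries.pderiv ℂ l f).order :=
      le_order_pderiv (by exact_mod_cast hf) l
    have := add_le_order_mul (hV l) h1
    refine le_trans (by norm_num) this
  rw [planeField_apply, Fin.sum_univ_two]
  exact le_order_add (h 0) (h 1)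

lemma two_le_order_planeField_pow (hV : ∀ l, 1 ≤ (V l).order) {f : MvPowerSeries (Fin 2) ℂ}
    (hf : 2 ≤ f.order) (n : ℕ) : 2 ≤ ((planeField V ^ n) f).order := by
  induction n with
  | zero => simpa using hf
  | succ n ih =>
    rw [pow_succ', Module.End.mul_apply]
    exact two_le_order_planeField hV ih

lemma two_le_order_smul {f : MvPowerSeries (Fin 2) ℂ} (hf : 2 ≤ f.order) (c : ℂ) :
    2 ≤ (c • f).order := hf.trans MvPowerSeries.le_order_smul

lemma two_le_order_sum {σ : Type*} (S : Finset σ) {f : σ → MvPowerSeries (Fin 2) ℂ}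
    (hf : ∀ i ∈ S, 2 ≤ (f i).order) : 2 ≤ (∑ i ∈ S, f i).order := by
  classical
  induction S using Finset.induction_on with
  | empty => simp
  | insert a S ha ih =>
    rw [Finset.sum_insert ha]
    exact le_order_add (hf a (by simp)) (ih fun i hi => hf i (by simp [hi]))

/-- The linear part of `V` is `b y ∂/∂x`, whose square is zero on coordinates. So only the terms of
index `0` and `1` contribute to the linear part of the exponential. -/
lemma isUnipotent_truncExp (hV : ∀ l, IsConvergent (V l)) {b : ℂ}
    (h0 : 2 ≤ (V 0 - MvPowerSeries.C b * MvPowerSeries.X 1).order) (h1 : 2 ≤ (V 1).order) {M : ℕ}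
    (hM : 2 ≤ M) :
    IsUnipotent b fun l => truncExp (planeField V) M (MvPowerSeries.X l) := by
  obtain ⟨M, rfl⟩ : ∃ M', M = M' + 1 + 1 := ⟨M - 2, by omega⟩
  have hV1 : ∀ l, 1 ≤ (V l).order := by
    intro l
    fin_cases l
    · have : V 0 = (V 0 - MvPowerSeries.C b * MvPowerSeries.X 1) +
          MvPowerSeries.C b * MvPowerSeries.X 1 := by ring
      change 1 ≤ (V 0).order
      rw [this]
      exact le_order_add (le_trans (by norm_num) h0) (one_le_order (by simp))
    · exact le_trans (by norm_num) h1
  have hX : ∀ l, truncExp (planeField V) (M + 1 + 1) (MvPowerSeries.X l) =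
      ∑ n ∈ Finset.range M, (((n + 1 + 1).factorial : ℂ)⁻¹) •
        (planeField V ^ (n + 1)) (V l) + V l + MvPowerSeries.X l := by
    intro l
    rw [truncExp_apply, Finset.sum_range_succ', Finset.sum_range_succ']
    simp only [zero_add, Nat.factorial_one, Nat.cast_one, inv_one, pow_one, one_smul,
      planeField_X, Nat.factorial_zero, pow_zero, Module.End.one_apply]
    congr 2
    refine Finset.sum_congr rfl fun n _ => ?_
    rw [pow_succ _ (n + 1), Module.End.mul_apply, planeField_X]
  refine ⟨fun l => ?_, ?_, ?_⟩
  · rw [truncExp_apply]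
    exact IsConvergent.sum fun n _ => (IsConvergent.planeField_pow hV (isConvergent_X l) n).smul _
  · have h2 : 2 ≤ (planeField V (V 0)).order := by
      have : V 0 = (V 0 - MvPowerSeries.C b * MvPowerSeries.X 1) +
          b • MvPowerSeries.X 1 := by rw [MvPowerSeries.smul_eq_C_mul]; ring
      have e : planeField V (V 0) = planeField V ((V 0 - MvPowerSeries.C b * MvPowerSeries.X 1) +
          b • MvPowerSeries.X 1) := congrArg _ this
      rw [e, map_add, map_smul, planeField_X]
      exact le_order_add (two_le_order_planeField hV1 h0) (two_le_order_smul h1 _)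
    have e : ∀ a y : MvPowerSeries (Fin 2) ℂ, a + V 0 + MvPowerSeries.X 0 - MvPowerSeries.X 0 - y
      = a + (V 0 - y) := by intros; ring
    rw [hX, e]
    refine le_order_add (two_le_order_sum _ fun n _ => two_le_order_smul ?_ _) h0
    rw [pow_succ, Module.End.mul_apply]
    exact two_le_order_planeField_pow hV1 h2 n
  · rw [hX, add_sub_cancel_right]
    exact le_order_add (two_le_order_sum _ fun n _ => two_le_order_smul
      (two_le_order_planeField_pow hV1 h1 (n + 1)) _) h1

variable {p : Fin 2 → ℂ⟦X⟧} {τ : ℂ⟦X⟧} {ε : Fin 2 → ℂ⟦X⟧} {K : ℕ}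

/-- If `V` along the curve is tangent up to `ε`, then restriction to the curve intertwines `V` with
`τ d/dt` up to an error linear in `ε`. -/
lemma mvSubst_planeField (hp : ∀ l, constantCoeff (p l) = 0)
    (hV : ∀ l, (MvPowerSeries.subst p (V l) : ℂ⟦X⟧) = τ * derivative ℂ (p l) + ε l)
    (f : MvPowerSeries (Fin 2) ℂ) :
    (MvPowerSeries.subst p (planeField V f) : ℂ⟦X⟧) =
      vectorField τ (MvPowerSeries.subst p f : ℂ⟦X⟧) +
        ∑ l, ε l * (MvPowerSeries.subst p (MvPowerSeries.pderiv ℂ l f) : ℂ⟦X⟧) := by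
  rw [vectorField_apply, derivative_mvSubst hp, planeField_apply,
    ← MvPowerSeries.coe_substAlgHom (hasSubst_of_zero (κ := Unit) hp)] at *
  simp only [map_sum, map_mul, hV, Finset.mul_sum, ← Finset.sum_add_distrib]
  exact Finset.sum_congr rfl fun l _ => by ring

lemma mvSubst_planeField_pow (hp : ∀ l, constantCoeff (p l) = 0) (hτ : X ^ 2 ∣ τ)
    (hV : ∀ l, (MvPowerSeries.subst p (V l) : ℂ⟦X⟧) = τ * derivative ℂ (p l) + ε l)
    (hε : ∀ l, X ^ K ∣ ε l) (n : ℕ) (f : MvPowerSeries (Fin 2) ℂ) :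
    X ^ K ∣ (MvPowerSeries.subst p ((planeField V ^ n) f) : ℂ⟦X⟧) -
      (vectorField τ ^ n) (MvPowerSeries.subst p f : ℂ⟦X⟧) := by
  induction n generalizing f with
  | zero => simp
  | succ n ih =>
    have h1 := ih (planeField V f)
    rw [mvSubst_planeField hp hV, map_add] at h1
    have h2 : X ^ K ∣ (vectorField τ ^ n)
        (∑ l, ε l * (MvPowerSeries.subst p (MvPowerSeries.pderiv ℂ l f) : ℂ⟦X⟧)) :=
      (pow_dvd_pow X (Nat.le_add_right K n)).trans (X_pow_dvd_vectorField_pow hτ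
        (Finset.dvd_sum fun l _ => (hε l).mul_right _) n)
    have h3 := dvd_add h1 h2
    rw [pow_succ (planeField V), pow_succ (vectorField τ), Module.End.mul_apply,
      Module.End.mul_apply]
    convert h3 using 1
    ring

/-- For `f` of order two the partial derivatives vanish at the origin, so each error `ε l` is
multiplied by a series of positive order; this is the additional power of `X`. -/
lemma mvSubst_planeField_pow_of_order (hp : ∀ l, constantCoeff (p l) = 0) (hτ : X ^ 2 ∣ τ)
    (hV1 : ∀ l, 1 ≤ (V l).order)
    (hV : ∀ l, (MvPowerSeries.subst p (V l) : ℂ⟦X⟧) = τ * derivative ℂ (p l) + ε l)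
    (hε : ∀ l, X ^ K ∣ ε l) (n : ℕ) {f : MvPowerSeries (Fin 2) ℂ} (hf : 2 ≤ f.order) :
    X ^ (K + 1) ∣ (MvPowerSeries.subst p ((planeField V ^ n) f) : ℂ⟦X⟧) -
      (vectorField τ ^ n) (MvPowerSeries.subst p f : ℂ⟦X⟧) := by
  induction n generalizing f with
  | zero => simp
  | succ n ih =>
    have h1 := ih (two_le_order_planeField hV1 hf)
    rw [mvSubst_planeField hp hV, map_add] at h1
    have h2 : X ^ (K + 1) ∣ (vectorField τ ^ n)
        (∑ l, ε l * (MvPowerSeries.subst p (MvPowerSeries.pderiv ℂ l f) : ℂ⟦X⟧)) := by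
      refine (pow_dvd_pow X (Nat.le_add_right _ n)).trans (X_pow_dvd_vectorField_pow hτ
        (Finset.dvd_sum fun l _ => ?_) n)
      rw [pow_add]
      refine mul_dvd_mul (hε l) (X_pow_dvd_iff_le_mvOrder.2 (le_order_subst_of_le hp ?_))
      exact le_order_pderiv (by exact_mod_cast hf) l
    have h3 := dvd_add h1 h2
    rw [pow_succ (planeField V), pow_succ (vectorField τ), Module.End.mul_apply,
      Module.End.mul_apply]
    convert h3 using 1
    ring

lemma mvSubst_truncExp_X (hp : ∀ l, constantCoeff (p l) = 0) (hτ : X ^ 2 ∣ τ)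
    (hV : ∀ l, (MvPowerSeries.subst p (V l) : ℂ⟦X⟧) = τ * derivative ℂ (p l) + ε l)
    (hε : ∀ l, X ^ K ∣ ε l) (M : ℕ) (l : Fin 2) :
    X ^ K ∣ (MvPowerSeries.subst p (truncExp (planeField V) M (MvPowerSeries.X l)) : ℂ⟦X⟧) -
      truncExp (vectorField τ) M (p l) := by
  rw [truncExp_apply, truncExp_apply,
    ← MvPowerSeries.coe_substAlgHom (hasSubst_of_zero (κ := Unit) hp), map_sum,
    ← Finset.sum_sub_distrib]
  refine Finset.dvd_sum fun n _ => ?_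
  rw [map_smul, ← smul_sub]
  have := mvSubst_planeField_pow hp hτ hV hε n (MvPowerSeries.X l)
  rw [mvSubst_X hp, ← MvPowerSeries.coe_substAlgHom (hasSubst_of_zero (κ := Unit) hp)] at this
  exact X_pow_dvd_smul this _

/-- In the difference of the two exponentials the terms of index `0` cancel, those of index `1`
differ by exactly `ε l`, and the later ones agree modulo `X ^ (K + 1)`. This is the first-order
effect of the flow. -/
lemma mvSubst_truncExp_X_of_order (hp : ∀ l, constantCoeff (p l) = 0) (hτ : X ^ 2 ∣ τ)
    (hV1 : ∀ l, 1 ≤ (V l).order)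
    (hV : ∀ l, (MvPowerSeries.subst p (V l) : ℂ⟦X⟧) = τ * derivative ℂ (p l) + ε l)
    (hε : ∀ l, X ^ K ∣ ε l) {M : ℕ} (hM : 2 ≤ M) {l : Fin 2} (hl : 2 ≤ (V l).order) :
    X ^ (K + 1) ∣ (MvPowerSeries.subst p (truncExp (planeField V) M (MvPowerSeries.X l)) : ℂ⟦X⟧) -
      truncExp (vectorField τ) M (p l) - ε l := by
  obtain ⟨M, rfl⟩ : ∃ M', M = M' + 1 + 1 := ⟨M - 2, by omega⟩
  rw [truncExp_apply, truncExp_apply,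
    ← MvPowerSeries.coe_substAlgHom (hasSubst_of_zero (κ := Unit) hp), map_sum,
    ← Finset.sum_sub_distrib, Finset.sum_range_succ', Finset.sum_range_succ']
  have e0 : (vectorField τ) (p l) = τ * derivative ℂ (p l) := rfl
  have e1 : MvPowerSeries.substAlgHom (hasSubst_of_zero (κ := Unit) hp) (V l) =
      τ * derivative ℂ (p l) + ε l := by
    rw [← hV, MvPowerSeries.coe_substAlgHom]
  have e2 : MvPowerSeries.substAlgHom (hasSubst_of_zero (κ := Unit) hp)
      (MvPowerSeries.X l : MvPowerSeries (Fin 2) ℂ) =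
      p l := MvPowerSeries.substAlgHom_X _ l
  simp only [zero_add, Nat.factorial_one, Nat.cast_one, inv_one, pow_one, one_smul, planeField_X,
    Nat.factorial_zero, pow_zero, Module.End.one_apply, e0, e1, e2, sub_self, add_zero]
  rw [add_sub_assoc, add_sub_cancel_left, sub_self, add_zero]
  refine Finset.dvd_sum fun n _ => ?_
  rw [map_smul, ← smul_sub]
  refine X_pow_dvd_smul ?_ _
  have h1 := mvSubst_planeField_pow_of_order hp hτ hV1 hV hε (n + 1) hl
  rw [hV, map_add] at h1
  have h2 : X ^ (K + 1) ∣ (vectorField τ ^ (n + 1)) (ε l) :=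
    (pow_dvd_pow X (by omega)).trans (X_pow_dvd_vectorField_pow hτ (hε l) (n + 1))
  have h3 := dvd_add h1 h2
  rw [pow_succ (planeField V) (n + 1), pow_succ (vectorField τ) (n + 1), Module.End.mul_apply, Module.End.mul_apply,
    planeField_X, e0]
  convert h3 using 1
  rw [MvPowerSeries.coe_substAlgHom]
  ring

/-- Normalization of a branch: given a curve which is close to a reparametrization of
`(t ^ m, y)`, its Puiseux form is close to `(t ^ m, y)`. -/
theorem exists_puiseux_of_close {m : ℕ} (hm : 1 ≤ m) (hK : m + 1 ≤ K) {y u v r e : ℂ⟦X⟧}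
    (hy : X ^ (m + 1) ∣ y) (hu : IsConvergent u) (hv : IsConvergent v)
    (hr0 : constantCoeff r = 0) (hr1 : coeff 1 r = 1) (he : X ^ K ∣ e)
    (h1 : X ^ K ∣ u - r ^ m) (h2 : X ^ (K + 1) ∣ v - y.subst r - e) :
    ∃ ρ z : ℂ⟦X⟧, IsConvergent ρ ∧ constantCoeff ρ = 0 ∧ coeff 1 ρ = 1 ∧ IsConvergent z ∧
      u = ρ ^ m ∧ z.subst ρ = v ∧ X ^ (K + 1) ∣ z - y - e := by
  obtain ⟨w, hw⟩ := X_dvd_iff.2 hr0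
  have hw0 : constantCoeff w = 1 := by
    rw [hw] at hr1
    simpa using hr1
  obtain ⟨c, hc⟩ := h1
  obtain ⟨d, hd⟩ : ∃ d, K = m + (d + 1) := ⟨K - m - 1, by omega⟩
  have hu' : u = X ^ m * (w ^ m + X ^ (d + 1) * c) := by
    rw [hw, mul_pow, hd, pow_add] at hc
    linear_combination hc
  obtain ⟨q, hq⟩ : ∃ q, q = w ^ m + X ^ (d + 1) * c := ⟨_, rfl⟩
  rw [← hq] at hu'
  have hqc : IsConvergent q := by
    rw [hu'] at hu
    exact isConvergent_of_X_pow_mul hu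
  have hq0 : constantCoeff q = 1 := by simp [hq, hw0]
  obtain ⟨x, hx, hx0, hxm⟩ := exists_root hqc hq0 (by omega : m ≠ 0)
  have hρ0 : constantCoeff (X * x : ℂ⟦X⟧) = 0 := by simp
  have hρ1 : coeff 1 (X * x : ℂ⟦X⟧) = 1 := by simpa using hx0
  have hρc : IsConvergent (X * x : ℂ⟦X⟧) := isConvergent_powerSeries_X.mul hx
  have hρ : IsReparam (X * x : ℂ⟦X⟧) := IsReparam.of_coeff_one ⟨hρc, hρ0, hρ1⟩
  -- From `u = (X x) ^ m` and `r = X w`, factor `x ^ m - w ^ m`: the cofactor of `x - w` has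
  -- constant term `m`, hence is a unit.
  have hclose : X ^ (d + 2) ∣ X * x - r := by
    have h3 : X ^ (d + 1) ∣ x - w := by
      have hS : IsUnit (∑ i ∈ Finset.range m, x ^ i * w ^ (m - 1 - i)) := by
        rw [isUnit_iff_constantCoeff]
        simp only [map_sum, map_mul, map_pow, hx0, hw0, one_pow, mul_one, Finset.sum_const,
          Finset.card_range, nsmul_eq_mul]
        exact isUnit_iff_ne_zero.2 (by exact_mod_cast (by omega : m ≠ 0))
      have h4 : X ^ (d + 1) ∣ (∑ i ∈ Finset.range m, x ^ i * w ^ (m - 1 - i)) * (x - w) := by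
        rw [(Commute.all x w).geom_sum₂_mul, hxm, hq]
        exact ⟨c, by ring⟩
      exact (hS.dvd_mul_left).1 h4
    rw [hw, ← mul_sub, pow_succ' X (d + 1)]
    exact mul_dvd_mul_left _ h3
  obtain ⟨σ, hσ, e1, e2⟩ := exists_inverse hρ
  have hzρ : (subst (X * x) (subst σ v : ℂ⟦X⟧) : ℂ⟦X⟧) = v :=
    subst_subst_inverse hσ.2.1 hρ0 e2
  refine ⟨X * x, v.subst σ, hρc, hρ0, hρ1, hv.powerSeries_subst hσ.1 hσ.2.1, ?_, hzρ, ?_⟩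
  · rw [hu', mul_pow, hxm]
  · rw [← X_pow_dvd_subst_iff hρ]
    have hs := HasSubst.of_constantCoeff_zero' hρ0
    rw [subst_sub hs, subst_sub hs, hzρ]
    -- As `y` starts in degree `m + 1`, it improves the precision `d + 2` of the parameter by `m`,
    -- and `d + 2 + m = K + 1`.
    have h3 : X ^ (K + 1) ∣ (y.subst (X * x) - y.subst r : ℂ⟦X⟧) := by
      have := X_pow_dvd_subst_sub_subst hρ0 hr0 hclose hy
      rwa [show d + 2 + m = K + 1 by omega] at this
    have h4 : X ^ (K + 1) ∣ (e.subst (X * x) - e.subst (X : ℂ⟦X⟧) : ℂ⟦X⟧) := by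
      obtain ⟨j, rfl⟩ : ∃ j, K = j + 1 := ⟨K - 1, by omega⟩
      have h5 : X ^ 2 ∣ X * x - (X : ℂ⟦X⟧) := by
        rw [show X * x - (X : ℂ⟦X⟧) = X * (x - 1) by ring, pow_two]
        exact mul_dvd_mul_left _ (X_dvd_iff.2 (by simp [hx0]))
      have := X_pow_dvd_subst_sub_subst hρ0 constantCoeff_X h5 he
      rwa [show 2 + j = j + 1 + 1 by omega] at this
    rw [X_subst] at h4
    have := dvd_sub (dvd_sub h2 h3) h4
    convert this using 1
    ring

end PlaneFlow
end PlaneBigerm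

namespace PlaneBigerm
open PowerSeries

/-! ### From series invariant under roots of unity to functions on the plane -/

section Descent

lemma isConvergent_rescale {f : ℂ⟦X⟧} (hf : IsConvergent f) (ζ : ℂ) :
    IsConvergent (rescale ζ f) := by
  rw [rescale_eq_subst]
  exact hf.powerSeries_subst (isConvergent_powerSeries_X.smul ζ)
    (show constantCoeff (ζ • X : ℂ⟦X⟧) = 0 by simp)

lemma constantCoeff_rescale (f : ℂ⟦X⟧) (ζ : ℂ) :
    constantCoeff (rescale ζ f) = constantCoeff f := by
  rw [← coeff_zero_eq_constantCoeff_apply, coeff_rescale, pow_zero, one_mul,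
    coeff_zero_eq_constantCoeff_apply]

/-- A convergent series invariant under `t ↦ ζ t`, `ζ` a primitive `d`-th root of unity, is a
convergent series in `t ^ d`. -/
lemma exists_subst_X_pow {f : ℂ⟦X⟧} (hf : IsConvergent f) {d : ℕ} (hd : d ≠ 0) {ζ : ℂ}
    (hζ : IsPrimitiveRoot ζ d) (h : rescale ζ f = f) :
    ∃ g : ℂ⟦X⟧, IsConvergent g ∧ f = g.subst (X ^ d : ℂ⟦X⟧) := by
  refine ⟨PowerSeries.mk fun n => coeff (d * n) f, ?_, ?_⟩
  · obtain ⟨r, hr, hr'⟩ := isConvergent_iff_exists.1 hf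
    refine isConvergent_iff_exists.2 ⟨r ^ d, ENNReal.pow_pos hr d, lt_of_le_of_lt ?_ hr'⟩
    rw [wnorm_eq_tsum, wnorm_eq_tsum]
    simp_rw [coeff_mk, ← pow_mul]
    exact ENNReal.tsum_comp_le_tsum_of_injective
      (mul_right_injective₀ hd) fun k => ‖coeff k f‖ₑ * r ^ k
  · ext n
    rw [coeff_subst_X_pow hd]
    split_ifs with hn
    · obtain ⟨k, rfl⟩ := hn
      simp [Nat.mul_div_cancel_left k (Nat.pos_of_ne_zero hd)]
    · have h1 := congrArg (coeff n) h
      rw [coeff_rescale] at h1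
      have h2 : (ζ ^ n - 1) * coeff n f = 0 := by linear_combination h1
      rcases mul_eq_zero.1 h2 with h3 | h3
      · exact absurd (hζ.pow_eq_one_iff_dvd n |>.1 (sub_eq_zero.1 h3)) hn
      · exact h3

lemma mvSubst_powerSeries_subst_X {p : Fin 2 → ℂ⟦X⟧} (hp : ∀ l, constantCoeff (p l) = 0)
    (g : ℂ⟦X⟧) (a : Fin 2) :
    (MvPowerSeries.subst p (PowerSeries.subst (MvPowerSeries.X a : MvPowerSeries (Fin 2) ℂ) g) :
      ℂ⟦X⟧) = PowerSeries.subst (p a) g := by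
  have := MvPowerSeries.subst_comp_subst_apply (R := ℂ) (S := ℂ)
    (a := fun _ : Unit => (MvPowerSeries.X a : MvPowerSeries (Fin 2) ℂ)) (b := p)
    (hasSubst_of_zero (by simp)) (hasSubst_of_zero (κ := Unit) hp) g
  simp only [mvSubst_X hp] at this
  exact this

/-- Invariance under `t ↦ ζ t` makes the coefficients of `P` series in `t ^ m`; replacing `t ^ m` by
one plane coordinate and the polynomial variable by the other gives `H`. The parameter `w` allows
evaluation on any curve whose coordinate `a` is an `m`-th power. -/
lemma exists_mvPowerSeries_of_polynomial {m : ℕ} (hm : m ≠ 0) {a b : Fin 2}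
    {P : Polynomial ℂ⟦X⟧} (hP : ∀ j, IsConvergent (P.coeff j))
    (hinv : ∀ ζ : ℂ, ζ ^ m = 1 → P.map (rescale ζ) = P) :
    ∃ H : MvPowerSeries (Fin 2) ℂ, IsConvergent H ∧
      ∀ (p : Fin 2 → ℂ⟦X⟧) (w : ℂ⟦X⟧) (_ : ∀ l, constantCoeff (p l) = 0)
        (hw : HasSubst w), constantCoeff w = 0 → p a = w ^ m →
        (MvPowerSeries.subst p H : ℂ⟦X⟧) =
          P.eval₂ (substAlgHom (R := ℂ) hw : ℂ⟦X⟧ →+* ℂ⟦X⟧) (p b) := by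
  have hζ := Complex.isPrimitiveRoot_exp m hm
  choose g hg e using fun j => exists_subst_X_pow (hP j) hm hζ (by
    have := congrArg (fun Q => Polynomial.coeff Q j) (hinv _ hζ.pow_eq_one)
    simpa using this)
  refine ⟨∑ j ∈ Finset.range (P.natDegree + 1),
    PowerSeries.subst (MvPowerSeries.X a : MvPowerSeries (Fin 2) ℂ) (g j) *
      MvPowerSeries.X b ^ j, IsConvergent.sum fun j _ =>
        ((hg j).powerSeries_subst (isConvergent_X a) (by simp)).mul ((isConvergent_X b).pow j), ?_⟩
  intro p w hp hw hw0 hpa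
  rw [Polynomial.eval₂_eq_sum_range,
    ← MvPowerSeries.coe_substAlgHom (hasSubst_of_zero (κ := Unit) hp)]
  simp only [map_sum, map_mul, map_pow]
  refine Finset.sum_congr rfl fun j _ => ?_
  rw [MvPowerSeries.substAlgHom_X, MvPowerSeries.coe_substAlgHom, mvSubst_powerSeries_subst_X hp,
    hpa]
  congr 1
  change _ = substAlgHom (R := ℂ) hw (P.coeff j)
  rw [coe_substAlgHom]
  conv_rhs => rw [e j]
  rw [subst_subst (by simp [hm]) hw0, subst_pow hw, subst_X hw]

/-- The conjugates of a series under the action of the `m`-th roots of unity. -/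
noncomputable def conjPoly (S : Finset ℂ) (y : ℂ⟦X⟧) : Polynomial ℂ⟦X⟧ :=
  ∏ ζ ∈ S, (Polynomial.X - Polynomial.C (rescale ζ y))

lemma coeff_conjPoly (S : Finset ℂ) {y : ℂ⟦X⟧} (hy : IsConvergent y) :
    conjPoly S y ∈ Polynomial.lifts (convergentSubalgebra Unit).toSubring.subtype := by
  refine Subsemiring.prod_mem _ fun ζ _ => ?_
  rw [sub_eq_add_neg, ← Polynomial.C_neg]
  refine Subsemiring.add_mem _ (Polynomial.X_mem_lifts _)
    (Polynomial.C_mem_lifts (convergentSubalgebra Unit).toSubring.subtype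
      ⟨-rescale ζ y, (isConvergent_rescale hy ζ).neg⟩)

lemma isConvergent_coeff_of_mem_lifts {P : Polynomial ℂ⟦X⟧}
    (h : P ∈ Polynomial.lifts (convergentSubalgebra Unit).toSubring.subtype) (j : ℕ) :
    IsConvergent (P.coeff j) := by
  obtain ⟨x, hx⟩ := (Polynomial.lifts_iff_coeff_lifts P).1 h j
  rw [← hx]
  exact x.2

lemma map_conjPoly {S S' : Finset ℂ} {ξ : ℂ} (hξ : ξ ≠ 0) (h : ∀ ζ, ζ ∈ S ↔ ξ * ζ ∈ S')
    (y : ℂ⟦X⟧) : (conjPoly S y).map (rescale ξ) = conjPoly S' y := by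
  rw [conjPoly, conjPoly, Polynomial.map_prod]
  refine Finset.prod_nbij' (ξ * ·) (ξ⁻¹ * ·) (fun ζ hζ => (h ζ).1 hζ) (fun ζ hζ => ?_)
    (fun ζ _ => by simp [hξ]) (fun ζ _ => by simp [hξ]) (fun ζ _ => ?_)
  · rw [h, mul_inv_cancel_left₀ hξ]
    exact hζ
  · rw [Polynomial.map_sub, Polynomial.map_X, Polynomial.map_C, rescale_rescale, mul_comm]

lemma eval₂_conjPoly (S : Finset ℂ) (y v : ℂ⟦X⟧) (F : ℂ⟦X⟧ →+* ℂ⟦X⟧) :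
    (conjPoly S y).eval₂ F v = ∏ ζ ∈ S, (v - F (rescale ζ y)) := by
  rw [conjPoly, Polynomial.eval₂_finsetProd]
  simp

lemma mem_nthRoots_mul_iff {m : ℕ} (hm : m ≠ 0) {ξ : ℂ} (hξ : ξ ^ m = 1) (ζ : ℂ) :
    ζ ∈ Polynomial.nthRootsFinset m (1 : ℂ) ↔ ξ * ζ ∈ Polynomial.nthRootsFinset m (1 : ℂ) := by
  rw [Polynomial.mem_nthRootsFinset (Nat.pos_of_ne_zero hm),
    Polynomial.mem_nthRootsFinset (Nat.pos_of_ne_zero hm), mul_pow, hξ, one_mul]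

/-- An equation of a branch in Puiseux form, as a product over the conjugates. -/
theorem exists_equation {m : ℕ} (hm : m ≠ 0) {a b : Fin 2} {y : ℂ⟦X⟧}
    (hy : IsConvergent y) :
    ∃ H : MvPowerSeries (Fin 2) ℂ, IsConvergent H ∧
      ∀ (p : Fin 2 → ℂ⟦X⟧) (w : ℂ⟦X⟧), (∀ l, constantCoeff (p l) = 0) →
        constantCoeff w = 0 → p a = w ^ m →
        (MvPowerSeries.subst p H : ℂ⟦X⟧) =
          ∏ ζ ∈ Polynomial.nthRootsFinset m (1 : ℂ), (p b - (rescale ζ y).subst w) := by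
  obtain ⟨H, hH, h⟩ := exists_mvPowerSeries_of_polynomial (a := a) (b := b) hm
    (isConvergent_coeff_of_mem_lifts (coeff_conjPoly (Polynomial.nthRootsFinset m (1 : ℂ)) hy))
    (fun ξ hξ => map_conjPoly (by rintro rfl; simp [hm] at hξ) (mem_nthRoots_mul_iff hm hξ) y)
  refine ⟨H, hH, fun p w hp hw hpa => ?_⟩
  rw [h p w hp (HasSubst.of_constantCoeff_zero' hw) hw hpa, eval₂_conjPoly]
  refine Finset.prod_congr rfl fun ζ _ => ?_
  congr 1
  exact congrFun (coe_substAlgHom (HasSubst.of_constantCoeff_zero' hw)) _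

/-- Lagrange interpolation along the conjugates of a branch in Puiseux form. -/
theorem exists_interpolation {m : ℕ} (hm : m ≠ 0) {a b : Fin 2}
    {p : Fin 2 → ℂ⟦X⟧} (hp : ∀ l, constantCoeff (p l) = 0) (hpa : p a = X ^ m)
    (hpb : IsConvergent (p b)) {g : ℂ⟦X⟧} (hg : IsConvergent g) :
    ∃ H : MvPowerSeries (Fin 2) ℂ, IsConvergent H ∧
      (MvPowerSeries.subst p H : ℂ⟦X⟧) =
        g * ∏ ζ ∈ (Polynomial.nthRootsFinset m (1 : ℂ)).erase 1, (p b - rescale ζ (p b)) := by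
  set S := Polynomial.nthRootsFinset m (1 : ℂ) with hS
  have h1S : (1 : ℂ) ∈ S := by
    rw [hS, Polynomial.mem_nthRootsFinset (Nat.pos_of_ne_zero hm), one_pow]
  -- The Lagrange numerator: roots of unity permute its summands, and at the point `p b` only the
  -- summand `ζ = 1` survives.
  obtain ⟨H, hH, h⟩ := exists_mvPowerSeries_of_polynomial (a := a) (b := b) hm
    (P := ∑ ζ ∈ S, Polynomial.C (rescale ζ g) * conjPoly (S.erase ζ) (p b))
    (isConvergent_coeff_of_mem_lifts (Subsemiring.sum_mem _ fun ζ _ => Subsemiring.mul_mem _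
      (Polynomial.C_mem_lifts (convergentSubalgebra Unit).toSubring.subtype
        ⟨rescale ζ g, isConvergent_rescale hg ζ⟩) (coeff_conjPoly _ hpb)))
    (fun ξ hξ => by
      have hξ0 : ξ ≠ 0 := by rintro rfl; simp [hm] at hξ
      have hmem := mem_nthRoots_mul_iff hm hξ
      rw [Polynomial.map_sum]
      refine Finset.sum_nbij' (ξ * ·) (ξ⁻¹ * ·) (fun ζ hζ => (hmem ζ).1 hζ) (fun ζ hζ => ?_)
        (fun ζ _ => by simp [hξ0]) (fun ζ _ => by simp [hξ0]) (fun ζ _ => ?_)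
      · rw [hS, hmem, mul_inv_cancel_left₀ hξ0]
        exact hζ
      · rw [Polynomial.map_mul, Polynomial.map_C, rescale_rescale, mul_comm ζ ξ]
        rw [map_conjPoly hξ0 (S' := S.erase (ξ * ζ))]
        intro z
        rw [Finset.mem_erase, Finset.mem_erase, ← hmem z]
        rw [← hS]
        simp [hξ0])
  refine ⟨H, hH, ?_⟩
  have hid : ∀ f : ℂ⟦X⟧, (substAlgHom (R := ℂ) (HasSubst.X' (R := ℂ)) : ℂ⟦X⟧ →+* ℂ⟦X⟧) f = f :=
    fun f => (congrFun (coe_substAlgHom HasSubst.X') f).trans (X_subst f)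
  rw [h p X hp HasSubst.X' constantCoeff_X hpa, Polynomial.eval₂_finsetSum,
    Finset.sum_eq_single_of_mem 1 h1S]
  · rw [Polynomial.eval₂_mul, Polynomial.eval₂_C, eval₂_conjPoly]
    simp only [hid, rescale_one, RingHom.id_apply]
  · intro ζ hζ hζ1
    rw [Polynomial.eval₂_mul, eval₂_conjPoly, Finset.prod_eq_zero (i := 1), mul_zero]
    · exact Finset.mem_erase.2 ⟨hζ1.symm, h1S⟩
    · rw [rescale_one, RingHom.id_apply]
      exact sub_eq_zero.2 (hid _).symm

/-- If `ζ` of order `d` fixes both coordinates, the branch is a series in `t ^ d`, and primitivity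
forces `d = 1`. -/
lemma eq_one_of_rescale_eq {p : Fin 2 → ℂ⟦X⟧} (hp : IsPrimitive p) {m : ℕ} (hm : m ≠ 0)
    {a b : Fin 2} (hab : ∀ l, l = a ∨ l = b) (hpa : p a = X ^ m) (hpb : IsConvergent (p b)) {ζ : ℂ}
    (hζ : ζ ^ m = 1) (h : rescale ζ (p b) = p b) : ζ = 1 := by
  have hd0 : orderOf ζ ≠ 0 :=
    (orderOf_pos_iff.2 (isOfFinOrder_iff_pow_eq_one.2 ⟨m, Nat.pos_of_ne_zero hm, hζ⟩)).ne'
  obtain ⟨k, hk⟩ := orderOf_dvd_of_pow_eq_one hζ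
  obtain ⟨g, hg, e⟩ := exists_subst_X_pow hpb hd0 (IsPrimitiveRoot.orderOf ζ) h
  have h1 := hp (fun l => if l = a then X ^ k else g) (X ^ orderOf ζ)
    (fun l => by
      split_ifs
      · exact isConvergent_powerSeries_X.pow k
      · exact hg) (isConvergent_powerSeries_X.pow _) (by simp [hd0])
    (fun l => by
      split_ifs with hl
      · have hs : HasSubst (X ^ orderOf ζ : ℂ⟦X⟧) := HasSubst.X_pow hd0
        rw [hl, hpa, subst_pow hs, subst_X hs, ← pow_mul, ← hk]
      · rw [(hab l).resolve_left hl, ← e])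
  rw [coeff_X_pow] at h1
  have h2 : orderOf ζ = 1 := by
    by_contra hne
    simp [Ne.symm hne] at h1
  exact orderOf_eq_one_iff.1 h2

end Descent
end PlaneBigerm

namespace PlaneBigerm
open PowerSeries

/-! ### Separating the two branches and lifting series of large order -/

section Conductor

lemma rescale_subst_X_pow {n : ℕ} (hn : n ≠ 0) (ξ : ℂ) (f : ℂ⟦X⟧) :
    rescale ξ (f.subst (X ^ n : ℂ⟦X⟧) : ℂ⟦X⟧) = (rescale (ξ ^ n) f).subst (X ^ n : ℂ⟦X⟧) := by
  ext k
  rw [coeff_rescale, coeff_subst_X_pow hn, coeff_subst_X_pow hn]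
  split_ifs with hk
  · obtain ⟨j, rfl⟩ := hk
    simp [Nat.mul_div_cancel_left j (Nat.pos_of_ne_zero hn), coeff_rescale, pow_mul]
  · simp

lemma subst_X_pow_injective {n : ℕ} (hn : n ≠ 0) {f g : ℂ⟦X⟧}
    (h : (f.subst (X ^ n : ℂ⟦X⟧) : ℂ⟦X⟧) = g.subst (X ^ n : ℂ⟦X⟧)) : f = g := by
  ext k
  have := congrArg (coeff (n * k)) h
  rw [coeff_subst_X_pow hn, coeff_subst_X_pow hn] at this
  simpa [Nat.mul_div_cancel_left k (Nat.pos_of_ne_zero hn)] using this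

lemma rescale_inv_rescale {ζ : ℂ} (hζ : ζ ≠ 0) (f : ℂ⟦X⟧) : rescale ζ⁻¹ (rescale ζ f) = f := by
  rw [rescale_rescale, mul_inv_cancel₀ hζ, rescale_one, RingHom.id_apply]

/-- Rotating the parameter by a primitive `m`-th root `ξ` of unity fixes the right side of `h`, so
`p 1` is invariant under `ξ ^ n`. Primitivity yields `ξ ^ n = 1`, that is `m ∣ n`; the other
divisibility is symmetric. -/
lemma eq_rescale_of_subst_eq {p q : Fin 2 → ℂ⟦X⟧} {m n : ℕ} (hm : m ≠ 0) (hn : n ≠ 0)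
    (hp : IsPrimitive p) (hq : IsPrimitive q) (hp0 : p 0 = X ^ m) (hq0 : q 0 = X ^ n)
    (hp1 : IsConvergent (p 1)) (hq1 : IsConvergent (q 1)) {ζ : ℂ} (hζ : ζ ^ n = 1)
    (h : ((p 1).subst (X ^ n : ℂ⟦X⟧) : ℂ⟦X⟧) = (rescale ζ (q 1)).subst (X ^ m : ℂ⟦X⟧)) :
    m = n ∧ p 1 = rescale ζ (q 1) := by
  have hab : ∀ l : Fin 2, l = 0 ∨ l = 1 := by decide
  have hζ0 : ζ ≠ 0 := by rintro rfl; simp [hn] at hζ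
  have hmn : m ∣ n := by
    obtain ⟨ξ, hξ⟩ : ∃ ξ : ℂ, IsPrimitiveRoot ξ m := ⟨_, Complex.isPrimitiveRoot_exp m hm⟩
    rw [← hξ.pow_eq_one_iff_dvd]
    refine eq_one_of_rescale_eq hp hm hab hp0 hp1 (by rw [pow_right_comm,
      hξ.pow_eq_one, one_pow]) (subst_X_pow_injective hn ?_)
    rw [← rescale_subst_X_pow hn, h, rescale_subst_X_pow hm, hξ.pow_eq_one, rescale_one,
      RingHom.id_apply]
  have hnm : n ∣ m := by
    obtain ⟨ξ, hξ⟩ : ∃ ξ : ℂ, IsPrimitiveRoot ξ n := ⟨_, Complex.isPrimitiveRoot_exp n hn⟩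
    rw [← hξ.pow_eq_one_iff_dvd]
    refine eq_one_of_rescale_eq hq hn hab hq0 hq1 (by rw [pow_right_comm,
      hξ.pow_eq_one, one_pow]) ?_
    have h1 : rescale (ξ ^ m) (rescale ζ (q 1)) =
        rescale ζ (q 1) := by
      refine subst_X_pow_injective hm ?_
      rw [← rescale_subst_X_pow hm, ← h, rescale_subst_X_pow hn, hξ.pow_eq_one, rescale_one,
        RingHom.id_apply]
    rw [rescale_rescale, mul_comm, ← rescale_rescale] at h1
    have h2 := congrArg (rescale ζ⁻¹) h1
    rwa [rescale_inv_rescale hζ0, rescale_inv_rescale hζ0] at h2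
  obtain rfl := Nat.dvd_antisymm hmn hnm
  exact ⟨rfl, subst_X_pow_injective hm h⟩

lemma isReparam_smul_X {ζ : ℂ} (hζ : ζ ≠ 0) : IsReparam (ζ • X : ℂ⟦X⟧) :=
  ⟨isConvergent_powerSeries_X.smul ζ, by simp, by simpa using hζ⟩

lemma not_exists_conjugate {φ : BranchPair} (hφ : IsBigerm φ) {m : Fin 2 → ℕ}
    (hm : ∀ i, m i ≠ 0) (hm0 : ∀ i, φ i 0 = X ^ m i) {i j : Fin 2} (hij : i ≠ j) {ζ : ℂ}
    (hζ : ζ ^ m j = 1)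
    (h : ((φ i 1).subst (X ^ m j : ℂ⟦X⟧) : ℂ⟦X⟧) =
      (rescale ζ (φ j 1)).subst (X ^ m i : ℂ⟦X⟧)) : False := by
  obtain ⟨hmm, he⟩ := eq_rescale_of_subst_eq (hm i) (hm j) (hφ.primitive i) (hφ.primitive j)
    (hm0 i) (hm0 j) (hφ.convergent i 1) (hφ.convergent j 1) hζ h
  have hζ0 : ζ ≠ 0 := by rintro rfl; simp [hm j] at hζ
  have h0 : φ i 0 = rescale ζ (φ j 0) := by
    rw [hm0, hm0, hmm, map_pow, rescale_X, mul_pow, ← map_pow, hζ, map_one, one_mul]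
  have hij' : (i = 1 ∧ j = 0) ∨ (i = 0 ∧ j = 1) := by omega
  rcases hij' with ⟨rfl, rfl⟩ | ⟨rfl, rfl⟩
  · refine hφ.distinct ⟨ζ • X, isReparam_smul_X hζ0, fun l => ?_⟩
    rw [← rescale_eq_subst]
    fin_cases l
    · exact h0
    · exact he
  · refine hφ.distinct ⟨ζ⁻¹ • X, isReparam_smul_X (inv_ne_zero hζ0), fun l => ?_⟩
    rw [← rescale_eq_subst]
    fin_cases l
    · exact ((congrArg _ h0).trans (rescale_inv_rescale hζ0 _)).symm
    · exact ((congrArg _ he).trans (rescale_inv_rescale hζ0 _)).symm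

/-- Write `y = X ^ d u` with `u` a unit. The unit has an `n`-th root, and `X ^ d` becomes an `n`-th
power after `X ↦ X ^ n`. -/
lemma exists_root_subst_X_pow {y : ℂ⟦X⟧} (hy : IsConvergent y) {n : ℕ} (hn : n ≠ 0) {e : ℕ}
    (he : X ^ e ∣ y) :
    ∃ w : ℂ⟦X⟧, X ^ e ∣ w ∧ w ^ n = y.subst (X ^ n : ℂ⟦X⟧) := by
  have hs : HasSubst (X ^ n : ℂ⟦X⟧) := HasSubst.X_pow hn
  rcases eq_or_ne y 0 with rfl | hy0
  · exact ⟨0, dvd_zero _, by rw [zero_pow hn, ← coe_substAlgHom hs, map_zero]⟩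
  set d := y.order.toNat with hd
  have hyd : y = X ^ d * divXPowOrder y := (X_pow_order_mul_divXPowOrder).symm
  have hed : e ≤ d := by
    have := X_pow_dvd_iff_le_order.1 he
    rw [← coe_toNat_order hy0] at this
    exact_mod_cast this
  set u := divXPowOrder y with hu
  have hu0 : constantCoeff u ≠ 0 := by
    rw [Ne, constantCoeff_divXPowOrder_eq_zero_iff]; exact hy0
  have huc : IsConvergent u := isConvergent_of_X_pow_mul (hyd ▸ hy)
  obtain ⟨κ, hκ⟩ := IsAlgClosed.exists_pow_nat_eq (constantCoeff u) (Nat.pos_of_ne_zero hn)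
  obtain ⟨x, -, -, hx⟩ := exists_root (huc.smul (constantCoeff u)⁻¹)
    (by
      rw [← coeff_zero_eq_constantCoeff_apply, map_smul, smul_eq_mul,
        coeff_zero_eq_constantCoeff_apply, inv_mul_cancel₀ hu0]) hn
  refine ⟨X ^ d * (κ • x.subst (X ^ n : ℂ⟦X⟧)), (pow_dvd_pow X hed).mul_right _, ?_⟩
  have h1 : y = X ^ d * (constantCoeff u • x ^ n) := by
    rw [hx, smul_smul, mul_inv_cancel₀ hu0, one_smul]
    exact hyd
  rw [mul_pow, smul_pow, hκ]
  conv_rhs => rw [h1]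
  rw [subst_mul hs, subst_pow hs, subst_smul hs, subst_pow hs, subst_X hs, ← pow_mul, ← pow_mul,
    mul_comm n d]

/-- `H` is the equation of branch `j`, a product over conjugates. If it vanished on branch `i`, one
factor would vanish after the base change `t ↦ t ^ m_j`: impossible by orders for distinct tangents,
and a coincidence of the branches for equal ones. -/
theorem exists_separating {δ : ℕ} (hδ : δ = 1 ∨ δ = 2) {φ : BranchPair} (hφ : IsBigerm φ)
    (hP : IsPuiseux δ φ) {i j : Fin 2} (hij : i ≠ j) :
    ∃ H : MvPowerSeries (Fin 2) ℂ, IsConvergent H ∧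
      (MvPowerSeries.subst (φ j) H : ℂ⟦X⟧) = 0 ∧ (MvPowerSeries.subst (φ i) H : ℂ⟦X⟧) ≠ 0 := by
  choose m hm1 hm hlow using hP
  have hm0 : ∀ i, m i ≠ 0 := fun i => by have := hm1 i; omega
  have hdvd : ∀ i l, l ≠ mainCoord δ i → X ^ (m i + 1) ∣ φ i l := fun i l hl => by
    rw [X_pow_dvd_iff]; exact fun n hn => hlow i l hl n (by omega)
  set a := mainCoord δ j with ha
  obtain ⟨b, hba⟩ : ∃ b, b ≠ a := ⟨a + 1, by omega⟩
  obtain ⟨H, hH, h⟩ := exists_equation (hm0 j) (a := a) (b := b) (hφ.convergent j b)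
  refine ⟨H, hH, ?_, fun hzero => ?_⟩
  · rw [h (φ j) X (hφ.zero j) constantCoeff_X (hm j)]
    refine Finset.prod_eq_zero (i := 1) ?_ ?_
    · rw [Polynomial.mem_nthRootsFinset (hm1 j), one_pow]
    · rw [rescale_one, RingHom.id_apply, X_subst, sub_self]
  have hX0 : constantCoeff (X ^ m j : ℂ⟦X⟧) = 0 := by simp [hm0 j]
  have hs : HasSubst (X ^ m j : ℂ⟦X⟧) := HasSubst.X_pow (hm0 j)
  have h1 := subst_mvSubst (hφ.zero i) hX0 H
  rw [hzero, ← coe_substAlgHom hs, map_zero, coe_substAlgHom hs] at h1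
  have hz : ∀ l, constantCoeff (subst (X ^ m j : ℂ⟦X⟧) (φ i l) : ℂ⟦X⟧) = 0 :=
    fun l => constantCoeff_subst' (hφ.zero i l) hX0
  have hfin : ∀ w : ℂ⟦X⟧, constantCoeff w = 0 →
      (subst (X ^ m j : ℂ⟦X⟧) (φ i a) : ℂ⟦X⟧) = w ^ m j → ∃ ζ : ℂ, ζ ^ m j = 1 ∧
        (subst (X ^ m j : ℂ⟦X⟧) (φ i b) : ℂ⟦X⟧) = (rescale ζ (φ j b)).subst w := by
    intro w hw0 hw
    rw [h _ w hz hw0 hw] at h1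
    obtain ⟨ζ, hζ, hζ'⟩ := Finset.prod_eq_zero_iff.1 h1.symm
    exact ⟨ζ, (Polynomial.mem_nthRootsFinset (hm1 j) 1).1 hζ, sub_eq_zero.1 hζ'⟩
  rcases hδ with rfl | rfl
  · have haj : a = j := by simp [ha, mainCoord]
    have hbi : b = i := by omega
    have hmi : mainCoord 1 i = i := by simp [mainCoord]
    obtain ⟨w, hw, hwe⟩ := exists_root_subst_X_pow (hφ.convergent i a) (hm0 j)
      (hdvd i a (by rw [hmi, haj]; exact hij.symm))
    have hw0 : constantCoeff w = 0 := X_dvd_iff.1 ((dvd_pow_self X (by omega)).trans hw)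
    obtain ⟨ζ, -, hζ⟩ := hfin w hw0 hwe.symm
    rw [hbi] at hζ
    have hφii : φ i i = X ^ m i := by rw [← hm i, hmi]
    rw [hφii, subst_pow hs, subst_X hs, ← pow_mul] at hζ
    obtain ⟨c, hc⟩ : X ^ (m j + 1) ∣ rescale ζ (φ j i) := by
      rw [X_pow_dvd_iff]
      intro n hn
      rw [coeff_rescale, X_pow_dvd_iff.1 (hdvd j i (by rw [← hbi]; exact hba)) n hn, mul_zero]
    have hsw := HasSubst.of_constantCoeff_zero' hw0
    rw [hc, subst_mul hsw, subst_pow hsw, subst_X hsw] at hζ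
    -- Transversality: `w` has order at least `m i + 1` and the conjugate of `φ j i` order at least
    -- `m j + 1`, so their composite cannot equal `X ^ (m j * m i)`.
    have h3 : (X : ℂ⟦X⟧) ^ ((m i + 1) * (m j + 1)) ∣ X ^ (m j * m i) := by
      rw [hζ, pow_mul]
      exact (pow_dvd_pow_of_dvd hw _).mul_right _
    have h4 := (pow_dvd_pow_iff X_ne_zero X_prime.not_isUnit).1 h3
    nlinarith
  · have ha0 : ∀ i, mainCoord 2 i = 0 := fun i => by simp [mainCoord]
    have haz : a = 0 := ha0 j
    have hb1 : b = 1 := by omega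
    have hmz : ∀ i, φ i 0 = X ^ m i := fun i => by rw [← hm i, ha0]
    obtain ⟨ζ, hζ, hζ'⟩ := hfin (X ^ m i) (by simp [hm0 i]) (by
      rw [haz, hmz i, subst_pow hs, subst_X hs, ← pow_mul, ← pow_mul, mul_comm])
    rw [hb1] at hζ'
    exact not_exists_conjugate hφ hm0 hmz hij hζ hζ'

/-- All pairs of convergent series of large order are pulled back from the plane. -/
theorem exists_conductor_exponent {δ : ℕ} (hδ : δ = 1 ∨ δ = 2) {φ : BranchPair} (hφ : IsBigerm φ)
    (hP : IsPuiseux δ φ) (i : Fin 2) :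
    ∃ e : ℕ, ∀ g : ℂ⟦X⟧, IsConvergent g → X ^ e ∣ g →
      ∃ η : MvPowerSeries (Fin 2) ℂ, IsConvergent η ∧
        (MvPowerSeries.subst (φ i) η : ℂ⟦X⟧) = g ∧
        ∀ j, j ≠ i → (MvPowerSeries.subst (φ j) η : ℂ⟦X⟧) = 0 := by
  obtain ⟨j, hij⟩ : ∃ j, i ≠ j := ⟨i + 1, by omega⟩
  obtain ⟨H, hH, hHj, hHi⟩ := exists_separating hδ hφ hP hij
  obtain ⟨m, hm1, hm, -⟩ := hP i
  have hm0 : m ≠ 0 := by omega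
  obtain ⟨b, hba⟩ : ∃ b, b ≠ mainCoord δ i := ⟨mainCoord δ i + 1, by omega⟩
  have hpi := fun g (hg : IsConvergent g) => exists_interpolation hm0 (b := b) (hφ.zero i) hm
    (hφ.convergent i b) (g := g) hg
  set Δ := ∏ ζ ∈ (Polynomial.nthRootsFinset m (1 : ℂ)).erase 1, (φ i b - rescale ζ (φ i b)) with hΔ
  have hΔ0 : Δ ≠ 0 := by
    rw [hΔ, Finset.prod_ne_zero_iff]
    intro ζ hζ h0
    obtain ⟨h1, h2⟩ := Finset.mem_erase.1 hζ
    exact h1 (eq_one_of_rescale_eq (hφ.primitive i) hm0 (a := mainCoord δ i) (b := b)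
      (fun l => by omega) hm (hφ.convergent i b)
      ((Polynomial.mem_nthRootsFinset hm1 1).1 h2) (sub_eq_zero.1 h0).symm)
  have hs := hasSubst_of_zero (κ := Unit) (hφ.zero i)
  obtain ⟨H1, hH1, h1⟩ := hpi 1 isConvergent_one
  rw [one_mul] at h1
  -- Interpolation reaches every multiple of `Δ` on branch `i`, and the factor `H` kills the other
  -- branch. So all multiples of `E` are attained, and the exponent is the order of `E`.
  set E : ℂ⟦X⟧ := Δ * MvPowerSeries.subst (φ i) H with hE
  have hE0 : E ≠ 0 := mul_ne_zero hΔ0 hHi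
  have hEc : IsConvergent E := by
    rw [hE, ← h1]
    exact (hH1.subst (hφ.convergent i) (hφ.zero i)).mul (hH.subst (hφ.convergent i) (hφ.zero i))
  have hEd : E = X ^ E.order.toNat * divXPowOrder E := (X_pow_order_mul_divXPowOrder).symm
  obtain ⟨v, hv, hv1⟩ := exists_inv (isConvergent_of_X_pow_mul (hEd ▸ hEc))
    (by rw [Ne, constantCoeff_divXPowOrder_eq_zero_iff]; exact hE0)
  refine ⟨E.order.toNat, fun g hg ⟨c, hc⟩ => ?_⟩
  have hcc : IsConvergent c := isConvergent_of_X_pow_mul (hc ▸ hg)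
  obtain ⟨K, hK, hK'⟩ := hpi (c * v) (hcc.mul hv)
  refine ⟨K * H, hK.mul hH, ?_, fun l hl => ?_⟩
  · rw [MvPowerSeries.subst_mul hs, hK', mul_assoc, ← hE, hEd, hc]
    linear_combination X ^ E.order.toNat * c * hv1
  · obtain rfl : l = j := by omega
    rw [MvPowerSeries.subst_mul (hasSubst_of_zero (κ := Unit) (hφ.zero l)), hHj, mul_zero]

end Conductor
end PlaneBigerm

namespace PlaneBigerm
open PowerSeries

/-! ### Lifting series from the conductor on -/

section Absorption

/-- Needed before `conductor` carries any information, because the infimum of the empty set of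
naturals is `0`. -/
lemma conductor_set_nonempty {δ : ℕ} (hδ : δ = 1 ∨ δ = 2) {φ : BranchPair} (hφ : IsBigerm φ)
    (hP : IsPuiseux δ φ) :
    ∃ c : Fin 2 → ℕ, ∀ a : Fin 2 → ℕ, c ≤ a → (fun j => (a j : ℕ∞)) ∈ valueSemigroup φ := by
  choose e he using exists_conductor_exponent hδ hφ hP
  refine ⟨e, fun a ha => ?_⟩
  choose η hη h1 h2 using fun i => he i (X ^ a i) (isConvergent_powerSeries_X.pow _)
    (pow_dvd_pow X (ha i))
  refine ⟨∑ i, η i, IsConvergent.sum (fun i _ => hη i), fun j => ?_⟩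
  rw [← MvPowerSeries.coe_substAlgHom (hasSubst_of_zero (κ := Unit) (hφ.zero j)), map_sum,
    MvPowerSeries.coe_substAlgHom, Finset.sum_eq_single j (fun i _ hij => h2 i j hij.symm)
      (by simp), h1, order_X_pow]

lemma exists_order_eq {δ : ℕ} (hδ : δ = 1 ∨ δ = 2) {φ : BranchPair} (hφ : IsBigerm φ)
    (hP : IsPuiseux δ φ) {i : Fin 2} {n : ℕ} (hn : conductor (valueSemigroup φ) i ≤ n) (B : ℕ) :
    ∃ η : MvPowerSeries (Fin 2) ℂ, IsConvergent η ∧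
      PowerSeries.order (MvPowerSeries.subst (φ i) η : ℂ⟦X⟧) = n ∧
      ∀ j, j ≠ i → X ^ B ∣ (MvPowerSeries.subst (φ j) η : ℂ⟦X⟧) := by
  obtain ⟨c₀, hc₀⟩ := conductor_set_nonempty hδ hφ hP
  obtain ⟨c, hci, hc⟩ := Nat.sInf_mem (s := {n | ∃ c : Fin 2 → ℕ, c i = n ∧
    ∀ a : Fin 2 → ℕ, c ≤ a → (fun j => (a j : ℕ∞)) ∈ valueSemigroup φ}) ⟨_, c₀, rfl, hc₀⟩
  obtain ⟨η, hη, h⟩ := hc (fun j => if j = i then n else max (c j) B) (fun j => by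
    dsimp only
    split_ifs with hj
    · rw [hj, hci]; exact hn
    · exact le_max_left _ _)
  refine ⟨η, hη, ?_, fun j hj => ?_⟩
  · simpa using (h i).symm
  · have hj' := h j
    simp only [if_neg hj] at hj'
    rw [X_pow_dvd_iff_le_order, ← hj']
    exact_mod_cast le_max_right _ _

/-- Pairs of convergent series whose orders are at least those of the conductor are pulled back
from the plane. -/
theorem exists_mvSubst_eq {δ : ℕ} (hδ : δ = 1 ∨ δ = 2) {φ : BranchPair} (hφ : IsBigerm φ)
    (hP : IsPuiseux δ φ) {n : ℕ} {i : Fin 2} (hn : conductor (valueSemigroup φ) i ≤ n)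
    {g : ℂ⟦X⟧} (hg : IsConvergent g) (hgn : X ^ n ∣ g) :
    ∃ η : MvPowerSeries (Fin 2) ℂ, IsConvergent η ∧
      (MvPowerSeries.subst (φ i) η : ℂ⟦X⟧) = g ∧
      ∀ j, j ≠ i → (MvPowerSeries.subst (φ j) η : ℂ⟦X⟧) = 0 := by
  choose e he using exists_conductor_exponent hδ hφ hP
  have hs := fun j => hasSubst_of_zero (κ := Unit) (hφ.zero j)
  rcases le_total (e i) n with hen | hen
  · exact he i g hg ((pow_dvd_pow X hen).trans hgn)
  -- Descend from the exponent `e i` to `n`. Here `η` realizes order `n` on branch `i`, `n` being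
  -- the current lower bound `k`, up to the correction below.
  induction hen using Nat.decreasingInduction generalizing g with
  | self => exact he i g hg hgn
  | of_succ k hk ih =>
    obtain ⟨j, hji, hj⟩ : ∃ j, j ≠ i ∧ ∀ l, l ≠ i → l = j := ⟨i + 1, by omega, by omega⟩
    obtain ⟨η, hη, h1, h2⟩ := exists_order_eq hδ hφ hP hn (e j)
    have hηc := fun j => hη.subst (hφ.convergent j) (hφ.zero j)
    -- `η` has order at least `e j` on branch `j`, so some `ζ` cancels it there and vanishes on
    -- branch `i`. Subtracting a multiple of `η - ζ` thus kills the leading term of `g` without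
    -- touching branch `j`.
    obtain ⟨ζ, hζ, h3, h4⟩ := he j _ (hηc j) (h2 j hji)
    obtain ⟨h5, h6⟩ := order_eq_nat.1 h1
    set f : ℂ⟦X⟧ := MvPowerSeries.subst (φ i) η with hf
    set c : ℂ := coeff k g / coeff k f with hc
    obtain ⟨θ, hθ, h7, h8⟩ := ih (by omega) (hg.sub ((hηc i).smul c)) (by
      rw [X_pow_dvd_iff] at hgn ⊢
      intro l hl
      rw [map_sub, map_smul, smul_eq_mul]
      rcases Nat.lt_succ_iff_lt_or_eq.1 hl with hl' | rfl
      · rw [hgn l hl', h6 l hl', mul_zero, sub_zero]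
      · rw [hc, div_mul_cancel₀ _ h5, sub_self])
    refine ⟨θ + c • (η - ζ), hθ.add ((hη.sub hζ).smul c), ?_, fun l hl => ?_⟩
    · rw [← MvPowerSeries.coe_substAlgHom (hs i), map_add, map_smul, map_sub,
        MvPowerSeries.coe_substAlgHom, h7, h4 i hji.symm, sub_zero, sub_add_cancel]
    · obtain rfl := hj l hl
      rw [← MvPowerSeries.coe_substAlgHom (hs l), map_add, map_smul, map_sub,
        MvPowerSeries.coe_substAlgHom, h8 l hl, h3, sub_self, smul_zero, zero_add]

end Absorption
end PlaneBigerm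

namespace PlaneBigerm
open PowerSeries

/-! ### Displacing both branches by a differential -/

section Flow

lemma X_pow_dvd_mvSubst {p : Fin 2 → ℂ⟦X⟧} {n : ℕ} (hn : n ≠ 0) (hp : ∀ l, X ^ n ∣ p l)
    {f : MvPowerSeries (Fin 2) ℂ} (hf : 2 ≤ f.order) :
    X ^ (n + 1) ∣ (MvPowerSeries.subst p f : ℂ⟦X⟧) := by
  have hp0 : ∀ l, constantCoeff (p l) = 0 := fun l =>
    X_dvd_iff.1 ((dvd_pow_self X hn).trans (hp l))
  obtain ⟨h0, -⟩ := two_le_order_iff.1 hf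
  have h := le_order_subst_sub_subst (κ := Unit) (a := p) (b := 0) (j := 1) (n := n)
    hp0 (fun _ => map_zero _) (fun l => by
      rw [Pi.zero_apply, sub_zero]
      exact X_pow_dvd_iff_le_mvOrder.1 (hp l)) (f := f) (fun d _ hd =>
        (natCast_le_order_iff (n := 2)).1 hf d (by omega))
  rw [MvPowerSeries.subst_zero_of_constantCoeff_zero h0, sub_zero] at h
  exact X_pow_dvd_iff_le_mvOrder.2 h

/-- Choose `τ` so that `τ d/dt` accounts for all of `V` in the main coordinate `a`. The determinant
condition `h` then says that the rest of `V` is precisely `ε` in the coordinate `b`. The exponential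
of the tangential part is a reparametrization, so only `ε` remains after returning to Puiseux form.
-/
theorem exists_flow_branch {p : Fin 2 → ℂ⟦X⟧} {V : Fin 2 → MvPowerSeries (Fin 2) ℂ} {a b : Fin 2}
    (hab : a ≠ b) {m K M : ℕ} (hm : 1 ≤ m) (hmK : m + 1 ≤ K) (hKM : K + 1 ≤ M)
    (hp : ∀ l, IsConvergent (p l)) (hp0 : ∀ l, constantCoeff (p l) = 0)
    (hpa : p a = X ^ m) (hpb : X ^ (m + 1) ∣ p b)
    (hV1 : ∀ l, 1 ≤ (V l).order) (hVb : 2 ≤ (V b).order)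
    {c : ℂ} (hs : IsUnipotent c fun l => truncExp (planeField V) M (MvPowerSeries.X l))
    (hVp : X ^ (m + 1) ∣ (MvPowerSeries.subst p (V a) : ℂ⟦X⟧)) {ε : ℂ⟦X⟧} (hε : X ^ K ∣ ε)
    (h : (MvPowerSeries.subst p (V b) : ℂ⟦X⟧) * derivative ℂ (p a) -
      (MvPowerSeries.subst p (V a) : ℂ⟦X⟧) * derivative ℂ (p b) = derivative ℂ (p a) * ε) :
    ∃ ρ z : ℂ⟦X⟧, IsConvergent ρ ∧ constantCoeff ρ = 0 ∧ coeff 1 ρ = 1 ∧ IsConvergent z ∧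
      ((p a).subst ρ : ℂ⟦X⟧) =
        MvPowerSeries.subst p (truncExp (planeField V) M (MvPowerSeries.X a)) ∧
      (z.subst ρ : ℂ⟦X⟧) =
        MvPowerSeries.subst p (truncExp (planeField V) M (MvPowerSeries.X b)) ∧
      X ^ (K + 1) ∣ z - p b - ε := by
  obtain ⟨m, rfl⟩ : ∃ k, m = k + 1 := ⟨m - 1, by omega⟩
  obtain ⟨w, hw⟩ := hVp
  have hd : derivative ℂ (p a) = ((m + 1 : ℕ) : ℂ⟦X⟧) * X ^ m := by
    rw [hpa]
    simp [Derivation.leibniz_pow]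
  have hmC : ((m + 1 : ℕ) : ℂ) ≠ 0 := by exact_mod_cast Nat.succ_ne_zero m
  have hmC' : ((m + 1 : ℕ) : ℂ⟦X⟧) = C ((m + 1 : ℕ) : ℂ) := by simp
  have hd0 : derivative ℂ (p a) ≠ 0 := by
    rw [hd, hmC']
    exact mul_ne_zero ((map_ne_zero_iff _ C_injective).2 hmC) (pow_ne_zero _ X_ne_zero)
  set τ : ℂ⟦X⟧ := C ((m + 1 : ℕ) : ℂ)⁻¹ * (X ^ 2 * w) with hτ
  have hτ2 : X ^ 2 ∣ τ := (dvd_mul_right _ _).mul_left _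
  have hVa : (MvPowerSeries.subst p (V a) : ℂ⟦X⟧) = τ * derivative ℂ (p a) := by
    rw [hw, hd, hτ, hmC']
    have : C ((m + 1 : ℕ) : ℂ)⁻¹ * C ((m + 1 : ℕ) : ℂ) = (1 : ℂ⟦X⟧) := by
      rw [← map_mul, inv_mul_cancel₀ hmC, map_one]
    linear_combination (-(X ^ (m + 2) * w)) * this
  have hVb' : (MvPowerSeries.subst p (V b) : ℂ⟦X⟧) = τ * derivative ℂ (p b) + ε := by
    apply mul_left_cancel₀ hd0
    rw [hVa] at h
    linear_combination h
  have hall : ∀ l, l = a ∨ l = b := by omega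
  have hVl : ∀ l, (MvPowerSeries.subst p (V l) : ℂ⟦X⟧) =
      τ * derivative ℂ (p l) + (if l = b then ε else 0) := by
    intro l
    rcases hall l with rfl | rfl
    · rw [if_neg hab, add_zero, hVa]
    · rw [if_pos rfl, hVb']
  have hεl : ∀ l, X ^ K ∣ (if l = b then ε else 0) := by
    intro l
    split_ifs
    exacts [hε, dvd_zero _]
  have h1 := mvSubst_truncExp_X hp0 hτ2 hVl hεl M a
  have h2 := mvSubst_truncExp_X_of_order hp0 hτ2 hV1 hVl hεl (M := M) (by omega) hVb
  rw [if_pos rfl] at h2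
  have h3 := fun f => (pow_dvd_pow X hKM).trans (truncExp_sub_subst hτ2 (M := M) (by omega) f)
  have hr := X_pow_dvd_iff.1 (truncExp_sub_self hτ2 (M := M) (by omega) (f := X) (a := 1) (by simp))
  obtain ⟨r, hre⟩ : ∃ r, r = truncExp (vectorField τ) M (X : ℂ⟦X⟧) := ⟨_, rfl⟩
  rw [← hre] at h3 hr
  have hr0 : constantCoeff r = 0 := by
    have := hr 0 (by omega)
    simpa using this
  have hr1 : coeff 1 r = 1 := by
    have := hr 1 (by omega)
    simpa [sub_eq_zero] using this
  obtain ⟨ρ, z, hρ, hρ0, hρ1, hz, hu, hzv, hze⟩ := exists_puiseux_of_close (m := m + 1) (K := K)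
    (y := p b) (r := r) (e := ε) (by omega) hmK hpb
    (IsConvergent.subst (hs.convergent a) hp hp0) (IsConvergent.subst (hs.convergent b) hp hp0)
    hr0 hr1 hε (by
      have h4 := (pow_dvd_pow X (Nat.le_succ K)).trans (h3 (p a))
      have h5 := dvd_add h1 h4
      rw [hpa] at h5
      rw [subst_pow (HasSubst.of_constantCoeff_zero' hr0),
        subst_X (HasSubst.of_constantCoeff_zero' hr0)] at h5
      rw [← hpa] at h5
      convert h5 using 1
      ring) (by
      convert dvd_add h2 (h3 (p b)) using 1
      ring)
  refine ⟨ρ, z, hρ, hρ0, hρ1, hz, ?_, hzv, hze⟩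
  rw [hpa, subst_pow (HasSubst.of_constantCoeff_zero' hρ0),
    subst_X (HasSubst.of_constantCoeff_zero' hρ0), hu]

lemma smul_mem_Omega {δ : ℕ} {ω : Fin 2 → MvPowerSeries (Fin 2) ℂ} (hω : ω ∈ Omega δ) (c : ℂ) :
    c • ω ∈ Omega δ := by
  obtain ⟨η, β, hη, h2, h0, h1⟩ := hω
  refine ⟨c • η, c * β, fun l => (hη l).smul c, fun l => two_le_order_smul (h2 l) c, ?_, ?_⟩
  · rw [Pi.smul_apply, h0, Pi.smul_apply]
  · rw [Pi.smul_apply, h1, Pi.smul_apply, smul_add, mul_assoc, map_mul _ c,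
      MvPowerSeries.smul_eq_C_mul, mul_assoc]

lemma pullback_smul {φ : BranchPair} (h0 : ∀ i l, constantCoeff (φ i l) = 0) (i : Fin 2)
    (ω : Fin 2 → MvPowerSeries (Fin 2) ℂ) (c : ℂ) :
    pullback φ i (c • ω) = c • pullback φ i ω := by
  rw [pullback, pullback, Finset.smul_sum]
  refine Finset.sum_congr rfl fun l _ => ?_
  rw [Pi.smul_apply, ← MvPowerSeries.coe_substAlgHom (hasSubst_of_zero (κ := Unit) (h0 i)),
    map_smul, smul_mul_assoc]

theorem exists_flow {δ : ℕ} (hδ : δ = 1 ∨ δ = 2) {φ : BranchPair} (hφ : IsBigerm φ) {m : Fin 2 → ℕ}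
    (hm1 : ∀ i, 1 ≤ m i) (hm : ∀ i, φ i (mainCoord δ i) = X ^ m i)
    (hlow : ∀ i l, l ≠ mainCoord δ i → X ^ (m i + 1) ∣ φ i l)
    {ω : Fin 2 → MvPowerSeries (Fin 2) ℂ} (hω : ω ∈ Omega δ) {K : Fin 2 → ℕ}
    (hmK : ∀ i, m i + 1 ≤ K i) {ε : Fin 2 → ℂ⟦X⟧} (hε : ∀ i, X ^ K i ∣ ε i)
    (h : ∀ i, pullback φ i ω = derivative ℂ (X ^ m i) * ε i) :
    ∃ ψ : BranchPair, (∀ i l, IsConvergent (ψ i l)) ∧ (∀ i l, constantCoeff (ψ i l) = 0) ∧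
      (∀ i, ψ i (mainCoord δ i) = X ^ m i) ∧
      (∀ i l, l ≠ mainCoord δ i →
        X ^ (K i + 1) ∣ ψ i l - φ i l - (if mainCoord δ i = 0 then 1 else -1 : ℂ) • ε i) ∧
      AEquiv δ φ ψ := by
  obtain ⟨η, β, hη, hη2, h0, h1⟩ := hω
  -- With this dual field, `ω(φ_i) = V₁ φ_i0' - V₀ φ_i1'` is the determinant of the tangent vector
  -- and `V`; its sign flips when the main coordinate is `y`.
  obtain ⟨V, hV0, hV1⟩ : ∃ V : Fin 2 → MvPowerSeries (Fin 2) ℂ, V 0 = -ω 1 ∧ V 1 = ω 0 :=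
    ⟨![-ω 1, ω 0], rfl, rfl⟩
  have hη1 : 2 ≤ (-η 1).order := by rw [MvPowerSeries.order_neg]; exact hη2 1
  have hVX : V 0 - MvPowerSeries.C (-β * ((δ : ℂ) - 1)) * MvPowerSeries.X 1 = -η 1 := by
    rw [hV0, h1, neg_mul, map_neg]
    ring
  have hVX' : V 0 = MvPowerSeries.C (-β * ((δ : ℂ) - 1)) * MvPowerSeries.X 1 + -η 1 := by
    rw [← hVX]; ring
  have hV12 : 2 ≤ (V 1).order := by rw [hV1, h0]; exact hη2 0
  have hVc : ∀ l, IsConvergent (V l) := by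
    intro l
    fin_cases l
    · exact hVX' ▸ ((isConvergent_C _).mul (isConvergent_X 1)).add (hη 1).neg
    · show IsConvergent (V 1)
      rw [hV1, h0]; exact hη 0
  have hV1o : ∀ l, 1 ≤ (V l).order := by
    intro l
    refine one_le_order ?_
    fin_cases l
    · show MvPowerSeries.constantCoeff (V 0) = 0
      rw [hVX', map_add, (two_le_order_iff.1 hη1).1]
      simp
    · exact (two_le_order_iff.1 hV12).1
  obtain ⟨M, hM⟩ : ∃ M, ∀ i, K i + 1 ≤ M := ⟨K 0 + K 1 + 1, fun i => by
    fin_cases i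
    · show K 0 + 1 ≤ _; omega
    · show K 1 + 1 ≤ _; omega⟩
  have hM2 : 2 ≤ M := by have := hM 0; have := hmK 0; omega
  have hs := isUnipotent_truncExp hVc (hVX ▸ hη1) hV12 hM2
  have hdiv : ∀ i l, X ^ m i ∣ φ i l := by
    intro i l
    by_cases hl : l = mainCoord δ i
    · rw [hl, hm]
    · exact (pow_dvd_pow X (Nat.le_succ _)).trans (hlow i l hl)
  have hVp2 : ∀ i l, 2 ≤ (V l).order →
      X ^ (m i + 1) ∣ (MvPowerSeries.subst (φ i) (V l) : ℂ⟦X⟧) := fun i l hl =>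
    X_pow_dvd_mvSubst (by have := hm1 i; omega) (hdiv i) hl
  have hV02 : δ = 1 → 2 ≤ (V 0).order := by
    rintro rfl
    rw [hVX']
    simpa using hη1
  have key : ∀ i, ∃ ρ : ℂ⟦X⟧, ∃ q : Fin 2 → ℂ⟦X⟧, (IsConvergent ρ ∧ constantCoeff ρ = 0 ∧
      coeff 1 ρ = 1) ∧ (∀ l, IsConvergent (q l)) ∧ q (mainCoord δ i) = X ^ m i ∧
      (∀ l, (PowerSeries.subst ρ (q l) : ℂ⟦X⟧) =
        MvPowerSeries.subst (φ i) (truncExp (planeField V) M (MvPowerSeries.X l))) ∧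
      ∀ l, l ≠ mainCoord δ i → X ^ (K i + 1) ∣
        q l - φ i l - (if mainCoord δ i = 0 then 1 else -1 : ℂ) • ε i := by
    intro i
    obtain ⟨a, ha⟩ : ∃ a, a = mainCoord δ i := ⟨_, rfl⟩
    obtain ⟨b, hba⟩ : ∃ b, b ≠ a := ⟨a + 1, by omega⟩
    have hd := h i
    rw [pullback, Fin.sum_univ_two, ← hV1, ← neg_neg (ω 1), ← hV0,
      ← MvPowerSeries.coe_substAlgHom (hasSubst_of_zero (κ := Unit) (hφ.zero i)), map_neg,
      MvPowerSeries.coe_substAlgHom, ← hm, ← ha] at hd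
    have hfl : ∃ ρ z : ℂ⟦X⟧, IsConvergent ρ ∧ constantCoeff ρ = 0 ∧ coeff 1 ρ = 1 ∧
        IsConvergent z ∧ ((φ i a).subst ρ : ℂ⟦X⟧) =
          MvPowerSeries.subst (φ i) (truncExp (planeField V) M (MvPowerSeries.X a)) ∧
        (z.subst ρ : ℂ⟦X⟧) =
          MvPowerSeries.subst (φ i) (truncExp (planeField V) M (MvPowerSeries.X b)) ∧
        X ^ (K i + 1) ∣ z - φ i b - (if a = 0 then 1 else -1 : ℂ) • ε i := by
      refine exists_flow_branch hba.symm (hm1 i) (hmK i) (hM i) (hφ.convergent i) (hφ.zero i)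
        (ha ▸ hm i) (hlow i b (ha ▸ hba)) hV1o ?_ hs ?_ (X_pow_dvd_smul (hε i) _) ?_
      · rcases hδ with hδ | rfl
        · rcases (by omega : b = 0 ∨ b = 1) with rfl | rfl
          exacts [hV02 hδ, hV12]
        · obtain rfl : b = 1 := by
            have : a = 0 := by simp [ha, mainCoord]
            omega
          exact hV12
      · rcases hδ with hδ | rfl
        · rcases (by omega : a = 0 ∨ a = 1) with h | h <;> rw [h]
          exacts [hVp2 i 0 (hV02 hδ), hVp2 i 1 hV12]
        -- For equal tangents `V₀` has the linear term `-β y`, but `y` itself starts in degree `m i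
        -- + 1` on each branch.
        · have ha0 : a = 0 := by simp [ha, mainCoord]
          rw [ha0, hVX', ← MvPowerSeries.smul_eq_C_mul,
            ← MvPowerSeries.coe_substAlgHom (hasSubst_of_zero (κ := Unit) (hφ.zero i)), map_add,
            map_smul, MvPowerSeries.coe_substAlgHom, mvSubst_X (hφ.zero i)]
          exact dvd_add (X_pow_dvd_smul (hlow i 1 (by rw [← ha, ha0]; decide)) _)
            (X_pow_dvd_mvSubst (by have := hm1 i; omega) (hdiv i) hη1)
      · rcases (by omega : a = 0 ∧ b = 1 ∨ a = 1 ∧ b = 0) with ⟨rfl, rfl⟩ | ⟨rfl, rfl⟩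
        · rw [if_pos rfl, one_smul]
          linear_combination hd
        · rw [if_neg one_ne_zero, neg_one_smul]
          linear_combination -hd
    obtain ⟨ρ, z, hρ, hρ0, hρ1, hz, hza, hzb, hzd⟩ := hfl
    refine ⟨ρ, fun l => if l = a then φ i a else z, ⟨hρ, hρ0, hρ1⟩, fun l => ?_, ?_, fun l => ?_,
      fun l hl => ?_⟩
    · dsimp only
      split_ifs
      exacts [hφ.convergent i a, hz]
    · dsimp only
      rw [if_pos ha.symm, ha, hm]
    · dsimp only
      split_ifs with hl
      · rw [hl, hza]
      · obtain rfl : l = b := by omega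
        exact hzb
    · dsimp only
      rw [← ha] at hl ⊢
      rw [if_neg hl]
      obtain rfl : l = b := by omega
      exact hzd
  choose ρ ψ hρ hψ hψm hψs hψd using key
  have hψ0 : ∀ i l, constantCoeff (ψ i l) = 0 := by
    intro i l
    have hc := (X_pow_dvd_subst_iff (IsReparam.of_coeff_one (hρ i)) (f := ψ i l) (n := 1)).1 (by
      rw [hψs, pow_one, X_dvd_iff]
      exact constantCoeff_mvSubst (hφ.zero i) (hs.zero l))
    rwa [pow_one, X_dvd_iff] at hc
  exact ⟨ψ, hψ, hψ0, hψm, hψd, ρ, fun l => truncExp (planeField V) M (MvPowerSeries.X l),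
    memGroup_iff.2 ⟨hρ, _, hs⟩, hψs⟩

end Flow
end PlaneBigerm

namespace PlaneBigerm
open PowerSeries

/-! ### Removing the terms of degree greater than `N` -/

section Truncation

lemma isConvergent_trunc (n : ℕ) (f : ℂ⟦X⟧) : IsConvergent ((trunc n f : Polynomial ℂ) : ℂ⟦X⟧) := by
  have h : ((trunc n f : Polynomial ℂ) : ℂ⟦X⟧) =
      ∑ k ∈ Finset.range n, coeff k f • (X : ℂ⟦X⟧) ^ k := by
    ext j
    simp only [Polynomial.coeff_coe, coeff_trunc, map_sum, map_smul, coeff_X_pow, smul_eq_mul,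
      mul_ite, mul_one, mul_zero, Finset.sum_ite_eq, Finset.mem_range]
  rw [h]
  exact IsConvergent.sum fun k _ => (isConvergent_powerSeries_X.pow k).smul _

lemma X_pow_dvd_sub_trunc (n : ℕ) (f : ℂ⟦X⟧) : X ^ n ∣ f - (trunc n f : ℂ⟦X⟧) := by
  rw [X_pow_dvd_iff]
  intro k hk
  rw [map_sub, Polynomial.coeff_coe, coeff_trunc, if_pos hk, sub_self]

lemma X_pow_dvd_trunc {n k : ℕ} {f : ℂ⟦X⟧} (hf : X ^ k ∣ f) : X ^ k ∣ (trunc n f : ℂ⟦X⟧) := by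
  rw [X_pow_dvd_iff] at hf ⊢
  intro j hj
  rw [Polynomial.coeff_coe, coeff_trunc, hf j hj, ite_self]

lemma X_pow_dvd_rescale {n : ℕ} {f : ℂ⟦X⟧} (hf : X ^ n ∣ f) (ζ : ℂ) : X ^ n ∣ rescale ζ f := by
  rw [X_pow_dvd_iff] at hf ⊢
  intro k hk
  rw [coeff_rescale, hf k hk, mul_zero]

lemma mvSubst_rescale {p : Fin 2 → ℂ⟦X⟧} (hp : ∀ l, constantCoeff (p l) = 0)
    (f : MvPowerSeries (Fin 2) ℂ) (ζ : ℂ) :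
    (MvPowerSeries.subst (fun l => rescale ζ (p l)) f : ℂ⟦X⟧) =
      rescale ζ (MvPowerSeries.subst p f : ℂ⟦X⟧) := by
  rw [rescale_eq_subst, subst_mvSubst hp (by simp)]
  simp only [rescale_eq_subst]

lemma two_le_order_sub_linear {f : MvPowerSeries (Fin 2) ℂ} (h0 : MvPowerSeries.constantCoeff f = 0) :
    2 ≤ (f - ∑ l, MvPowerSeries.coeff (Finsupp.single l 1) f • MvPowerSeries.X l).order := by
  rw [two_le_order_iff]
  refine ⟨by simp [h0], fun l => ?_⟩
  fin_cases l <;> simp [MvPowerSeries.coeff_X, Finsupp.single_left_inj]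

lemma mvSubst_smul_X {p : Fin 2 → ℂ⟦X⟧} (hp : ∀ l, constantCoeff (p l) = 0) (c : Fin 2 → ℂ) :
    (MvPowerSeries.subst p (∑ l, c l • (MvPowerSeries.X l : MvPowerSeries (Fin 2) ℂ)) : ℂ⟦X⟧) =
      ∑ l, c l • p l := by
  rw [← MvPowerSeries.coe_substAlgHom (hasSubst_of_zero (κ := Unit) hp), map_sum]
  refine Finset.sum_congr rfl fun l _ => ?_
  rw [map_smul, MvPowerSeries.coe_substAlgHom, mvSubst_X hp]

lemma mvSubst_sub {p : Fin 2 → ℂ⟦X⟧} (hp : ∀ l, constantCoeff (p l) = 0)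
    (f g : MvPowerSeries (Fin 2) ℂ) :
    (MvPowerSeries.subst p (f - g) : ℂ⟦X⟧) = MvPowerSeries.subst p f - MvPowerSeries.subst p g := by
  rw [← MvPowerSeries.coe_substAlgHom (hasSubst_of_zero (κ := Unit) hp), map_sub]

/-- An implicit function argument: once `p 1` and `q 1` agree to order `n`, the nonlinear part of
`f` agrees to order `n + 1`, and the nonzero coefficient of `y` transfers this to `p 1 - q 1`. -/
lemma X_pow_dvd_sub_of_linear {p q : Fin 2 → ℂ⟦X⟧} (hp : ∀ l, constantCoeff (p l) = 0)
    (hq : ∀ l, constantCoeff (q l) = 0) (hpq : p 0 = q 0) {f : MvPowerSeries (Fin 2) ℂ}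
    (h0 : MvPowerSeries.constantCoeff f = 0)
    (h1 : MvPowerSeries.coeff (Finsupp.single 1 1) f ≠ 0) {n : ℕ}
    (h : X ^ n ∣ (MvPowerSeries.subst p f - MvPowerSeries.subst q f : ℂ⟦X⟧)) :
    X ^ n ∣ p 1 - q 1 := by
  induction n with
  | zero => simp
  | succ n ih =>
    have ih' := ih ((pow_dvd_pow X (Nat.le_succ n)).trans h)
    have h2 := two_le_order_sub_linear h0
    have h3 := X_pow_dvd_iff_le_mvOrder.2 (le_order_subst_sub_subst (κ := Unit) (n := n) hp hq
      (fun l => by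
        rcases (by omega : l = 0 ∨ l = 1) with rfl | rfl
        · rw [hpq, sub_self, MvPowerSeries.order_zero]; exact le_top
        · exact X_pow_dvd_iff_le_mvOrder.1 ih') (j := 1)
      (fun d _ hd => (natCast_le_order_iff (n := 2)).1 h2 d (by omega)))
    rw [mvSubst_sub hp, mvSubst_sub hq, mvSubst_smul_X hp, mvSubst_smul_X hq, Fin.sum_univ_two,
      Fin.sum_univ_two, hpq] at h3
    have h4 : X ^ (n + 1) ∣ MvPowerSeries.coeff (Finsupp.single 1 1) f • (p 1 - q 1) := by
      rw [smul_sub]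
      convert dvd_sub h h3 using 1
      ring
    have h5 := X_pow_dvd_smul h4 (MvPowerSeries.coeff (Finsupp.single 1 1) f)⁻¹
    rwa [smul_smul, inv_mul_cancel₀ h1, one_smul] at h5

lemma eq_of_X_pow_dvd_sub {f g : ℂ⟦X⟧} {N : ℕ} (h : X ^ (N + 1) ∣ f - g)
    (hf : ∀ n, N < n → coeff n f = 0) (hg : ∀ n, N < n → coeff n g = 0) : f = g := by
  ext n
  rcases Nat.lt_or_ge N n with hn | hn
  · rw [hf n hn, hg n hn]
  · have := X_pow_dvd_iff.1 h n (by omega)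
    rwa [map_sub, sub_eq_zero] at this

/-- Two tangent branches given by polynomials of degree at most `N` are not both tangent up to order
`N` to a smooth curve transversal to the vertical axis. -/
lemma coeff_eq_zero_of_X_pow_dvd {φ : BranchPair} (hφ : IsBigerm φ) {m : Fin 2 → ℕ}
    (hm1 : ∀ i, 1 ≤ m i) (hm : ∀ i, φ i 0 = X ^ m i) {N : ℕ}
    (hN : ∀ i n, N < n → coeff n (φ i 1) = 0) {f : MvPowerSeries (Fin 2) ℂ}
    (h0 : MvPowerSeries.constantCoeff f = 0)
    (hf : ∀ i, X ^ (N + 1) ∣ (MvPowerSeries.subst (φ i) f : ℂ⟦X⟧)) :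
    MvPowerSeries.coeff (Finsupp.single 1 1) f = 0 := by
  by_contra h1
  -- A rotation by an `m i`-th root of unity keeps `x = t ^ m i`, so by the previous lemma it
  -- preserves `y` modulo `t ^ (N + 1)`, hence exactly, the degree being at most `N`. Primitivity
  -- gives `m i = 1`; both branches are then graphs over `x`, and the same comparison identifies
  -- them.
  have hone : ∀ i, m i = 1 := by
    intro i
    have hmi : m i ≠ 0 := by have := hm1 i; omega
    obtain ⟨ζ, hζ⟩ : ∃ ζ : ℂ, IsPrimitiveRoot ζ (m i) := ⟨_, Complex.isPrimitiveRoot_exp _ hmi⟩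
    have h2 : rescale ζ (φ i 1) = φ i 1 := by
      refine eq_of_X_pow_dvd_sub (N := N) (X_pow_dvd_sub_of_linear
        (p := fun l => rescale ζ (φ i l)) (q := φ i) (fun l => ?_) (hφ.zero i) ?_ h0 h1 ?_) ?_ (hN i)
      · rw [constantCoeff_rescale, hφ.zero]
      · rw [hm, map_pow, rescale_X, mul_pow, ← map_pow, hζ.pow_eq_one, map_one, one_mul]
      · rw [mvSubst_rescale (hφ.zero i)]
        exact dvd_sub (X_pow_dvd_rescale (hf i) ζ) (hf i)
      · intro n hn
        rw [coeff_rescale, hN i n hn, mul_zero]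
    have h3 := eq_one_of_rescale_eq (hφ.primitive i) hmi (a := 0) (b := 1) (by omega) (hm i)
      (hφ.convergent i 1) hζ.pow_eq_one h2
    rw [h3] at hζ
    exact hζ.unique IsPrimitiveRoot.one
  refine hφ.distinct ⟨X, ⟨isConvergent_powerSeries_X, by simp, by simp⟩, fun l => ?_⟩
  have h00 : φ 1 0 = φ 0 0 := by rw [hm, hm, hone, hone]
  rw [X_subst]
  rcases (by omega : l = 0 ∨ l = 1) with rfl | rfl
  · exact h00
  · exact eq_of_X_pow_dvd_sub (X_pow_dvd_sub_of_linear (hφ.zero 1) (hφ.zero 0) h00 h0 h1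
      (dvd_sub (hf 1) (hf 0))) (hN 1) (hN 0)

/-- The tails of `ψ` beyond `N` are restrictions of plane functions `η l`, and `(x, y) - η` removes
them. Membership in the group requires `η` of order two; the truncated bigerm `φ` enters only to
prove this. -/
theorem exists_truncation {δ : ℕ} (hδ : δ = 1 ∨ δ = 2) {φ ψ : BranchPair} (hφ : IsBigerm φ)
    (hψ : IsBigerm ψ) {m : Fin 2 → ℕ} (hm1 : ∀ i, 1 ≤ m i)
    (hφm : ∀ i, φ i (mainCoord δ i) = X ^ m i) (hψm : ∀ i, ψ i (mainCoord δ i) = X ^ m i)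
    (hψl : ∀ i l, l ≠ mainCoord δ i → X ^ (m i + 1) ∣ ψ i l) (h : AEquiv δ φ ψ) {N : ℕ}
    (hφN : DegreeLE δ N φ) (hN : ∀ i, conductor (valueSemigroup ψ) i ≤ N + 1) :
    ∃ χ : BranchPair, (∀ i l, IsConvergent (χ i l)) ∧ (∀ i l, constantCoeff (χ i l) = 0) ∧
      (∀ i, χ i (mainCoord δ i) = X ^ m i) ∧
      (∀ i l, l ≠ mainCoord δ i → X ^ (m i + 1) ∣ χ i l) ∧
      (∀ i l, X ^ (N + 1) ∣ χ i l - ψ i l) ∧ DegreeLE δ N χ ∧ AEquiv δ ψ χ := by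
  have hψP : IsPuiseux δ ψ := fun i => ⟨m i, hm1 i, hψm i, fun l hl n hn =>
    X_pow_dvd_iff.1 (hψl i l hl) n (by omega)⟩
  obtain ⟨χ, hχ⟩ : ∃ χ : BranchPair, ∀ i l, χ i l =
      if l = mainCoord δ i then ψ i l else ((trunc (N + 1) (ψ i l) : Polynomial ℂ) : ℂ⟦X⟧) :=
    ⟨_, fun _ _ => rfl⟩
  have hχm : ∀ i, χ i (mainCoord δ i) = X ^ m i := fun i => by rw [hχ, if_pos rfl, hψm]
  have hχl : ∀ i l, l ≠ mainCoord δ i → X ^ (m i + 1) ∣ χ i l := fun i l hl => by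
    rw [hχ, if_neg hl]
    exact X_pow_dvd_trunc (hψl i l hl)
  have hχc : ∀ i l, IsConvergent (χ i l) := fun i l => by
    rw [hχ]
    split_ifs
    exacts [hψ.convergent i l, isConvergent_trunc _ _]
  have hχd : ∀ i l, X ^ (N + 1) ∣ ψ i l - χ i l := fun i l => by
    rw [hχ]
    split_ifs
    · rw [sub_self]; exact dvd_zero _
    · exact X_pow_dvd_sub_trunc _ _
  have hχ0 : ∀ i l, constantCoeff (χ i l) = 0 := fun i l => by
    have := X_pow_dvd_iff.1 (hχd i l) 0 (by omega)
    rw [map_sub, coeff_zero_eq_constantCoeff_apply, coeff_zero_eq_constantCoeff_apply,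
      hψ.zero, zero_sub, neg_eq_zero] at this
    exact this
  have htail : ∀ i l, X ^ (m i + 1) ∣ ψ i l - χ i l := fun i l => by
    by_cases hl : l = mainCoord δ i
    · rw [hχ, if_pos hl, sub_self]; exact dvd_zero _
    · exact dvd_sub (hψl i l hl) (hχl i l hl)
  have hη : ∀ l, ∃ η : MvPowerSeries (Fin 2) ℂ, IsConvergent η ∧
      ∀ i, (MvPowerSeries.subst (ψ i) η : ℂ⟦X⟧) = ψ i l - χ i l := fun l => by
    choose η hη h1 h2 using fun i => exists_mvSubst_eq hδ hψ hψP (hN i)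
      ((hψ.convergent i l).sub (hχc i l)) (hχd i l)
    refine ⟨∑ i, η i, IsConvergent.sum (fun i _ => hη i), fun j => ?_⟩
    rw [← MvPowerSeries.coe_substAlgHom (hasSubst_of_zero (κ := Unit) (hψ.zero j)), map_sum,
      MvPowerSeries.coe_substAlgHom, Finset.sum_eq_single j (fun i _ hij => h2 i j hij.symm)
        (by simp), h1]
  choose η hη hηψ using hη
  have hη0 : ∀ l, MvPowerSeries.constantCoeff (η l) = 0 := fun l => by
    have h1 := constantCoeff_mvSubst (hψ.zero 0)
      (f := η l - MvPowerSeries.C (MvPowerSeries.constantCoeff (η l))) (by simp)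
    rw [mvSubst_sub (hψ.zero 0), hηψ, map_sub, map_sub, hψ.zero, hχ0,
      ← mul_one (MvPowerSeries.C _), ← MvPowerSeries.smul_eq_C_mul,
      ← MvPowerSeries.coe_substAlgHom (hasSubst_of_zero (κ := Unit) (hψ.zero 0)), map_smul,
      map_one] at h1
    simpa using h1
  -- A linear term in the main coordinate would be visible in degree `m i`, where the tails vanish.
  -- For `δ = 1` the two branches cover both variables.
  have hηm : ∀ i l, MvPowerSeries.coeff (Finsupp.single (mainCoord δ i) 1) (η l) = 0 := by
    intro i l
    obtain ⟨f, hf⟩ : ∃ f, f = η l := ⟨_, rfl⟩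
    have hdiv : ∀ l, X ^ m i ∣ ψ i l := by
      intro l
      by_cases hl : l = mainCoord δ i
      · rw [hl, hψm]
      · exact (pow_dvd_pow X (Nat.le_succ _)).trans (hψl i l hl)
    have h1 := X_pow_dvd_mvSubst (by have := hm1 i; omega) hdiv (two_le_order_sub_linear (hη0 l))
    rw [mvSubst_sub (hψ.zero i), mvSubst_smul_X (hψ.zero i), hηψ,
      dvd_sub_right (htail i l)] at h1
    have h2 := X_pow_dvd_iff.1 h1 (m i) (by omega)
    rw [map_sum, Finset.sum_eq_single (mainCoord δ i), map_smul, hψm, coeff_X_pow_self,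
      smul_eq_mul, mul_one] at h2
    · exact h2
    · intro l _ hl
      rw [map_smul, X_pow_dvd_iff.1 (hψl i l hl) (m i) (by omega), smul_zero]
    · simp
  have hη2 : ∀ l, 2 ≤ (η l).order := by
    intro l
    rw [two_le_order_iff]
    refine ⟨hη0 l, fun j => ?_⟩
    rcases hδ with rfl | rfl
    · simpa [mainCoord] using hηm j l
    rcases (by omega : j = 0 ∨ j = 1) with rfl | rfl
    · simpa [mainCoord] using hηm 0 l
    have hx : MvPowerSeries.coeff (Finsupp.single 0 1) (η l) = 0 := by
      simpa [mainCoord] using hηm 0 l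
    -- The coefficient of `y` for equal tangents: `η l ∘ s` has the same one and is divisible by `t
    -- ^ (N + 1)` on both branches of `φ`, whose degrees are at most `N`.
    obtain ⟨ρ, s, hρs, hs⟩ := h
    obtain ⟨hρ, b, hsb⟩ := memGroup_iff.1 hρs
    obtain ⟨β, hβ⟩ : ∃ β, β = MvPowerSeries.coeff (Finsupp.single 1 1) (η l) := ⟨_, rfl⟩
    have hg := two_le_order_sub_linear (hη0 l)
    rw [Fin.sum_univ_two, hx, zero_smul, zero_add, ← hβ] at hg
    have hg2 := two_le_order_subst hsb.zero hg
    have h3 : 2 ≤ (MvPowerSeries.subst s (η l) - β • MvPowerSeries.X 1).order := by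
      rw [← MvPowerSeries.coe_substAlgHom (hasSubst_of_zero hsb.zero), map_sub, map_smul,
        MvPowerSeries.coe_substAlgHom, MvPowerSeries.subst_X (hasSubst_of_zero hsb.zero)] at hg2
      convert le_order_add hg2 (two_le_order_smul hsb.order_y β) using 2
      rw [smul_sub]
      ring
    obtain ⟨h4, h5⟩ := two_le_order_iff.1 h3
    have h6 := h5 1
    rw [map_sub, map_smul, MvPowerSeries.coeff_X, if_pos rfl, smul_eq_mul, mul_one, sub_eq_zero]
      at h6
    rw [← hβ, ← h6]
    refine coeff_eq_zero_of_X_pow_dvd hφ hm1 (N := N) (fun i => by simpa [mainCoord] using hφm i)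
      (fun i n hn => hφN i 1 (by simp [mainCoord]) n (by exact_mod_cast hn)) (by simpa using h4)
      fun i => ?_
    rw [mvSubst_mvSubst (hφ.zero i) hsb.zero]
    simp_rw [← hs]
    rw [← subst_mvSubst (hψ.zero i) (hρ i).2.1, hηψ]
    exact X_pow_dvd_subst (hρ i).2.1 (hχd i l)
  refine ⟨χ, hχc, hχ0, hχm, hχl, fun i l => ?_, fun i l hl n hn => ?_, fun _ => X,
    fun l => MvPowerSeries.X l - η l, memGroup_iff.2
      ⟨fun _ => ⟨isConvergent_powerSeries_X, by simp, by simp⟩, 0,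
        fun l => (isConvergent_X l).sub (hη l), ?_, ?_⟩, fun i l => ?_⟩
  · rw [← neg_sub, dvd_neg]; exact hχd i l
  · have hn' : N < n := by exact_mod_cast hn
    rw [hχ, if_neg hl, Polynomial.coeff_coe, coeff_trunc, if_neg (by omega)]
  · rw [zero_mul, map_zero, zero_mul, sub_zero, sub_sub_cancel_left, MvPowerSeries.order_neg]
    exact hη2 0
  · rw [sub_sub_cancel_left, MvPowerSeries.order_neg]
    exact hη2 1
  · rw [X_subst, mvSubst_sub (hψ.zero i), mvSubst_X (hψ.zero i), hηψ, sub_sub_cancel]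

end Truncation
end PlaneBigerm

namespace PlaneBigerm
open PowerSeries

/-! ### Displacements and the elimination of a term -/

section Elimination

lemma mult_eq {δ : ℕ} {φ : BranchPair} {m : Fin 2 → ℕ} (hm : ∀ i, φ i (mainCoord δ i) = X ^ m i)
    (hlow : ∀ i l, l ≠ mainCoord δ i → X ^ (m i + 1) ∣ φ i l) (i : Fin 2) : mult φ i = m i := by
  have h1 : (φ i (mainCoord δ i)).order = m i := by rw [hm, order_X_pow]
  have h2 : ∀ l, (m i : ℕ∞) ≤ (φ i l).order := by
    intro l
    by_cases hl : l = mainCoord δ i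
    · rw [hl, h1]
    · exact X_pow_dvd_iff_le_order.1 ((pow_dvd_pow X (Nat.le_succ _)).trans (hlow i l hl))
  refine le_antisymm ?_ (le_min (h2 0) (h2 1))
  rcases (by omega : mainCoord δ i = 0 ∨ mainCoord δ i = 1) with h | h <;> rw [h] at h1
  exacts [(min_le_left _ _).trans h1.le, (min_le_right _ _).trans h1.le]

/-- The displacement of branch `i` along the main coordinate caused by a differential. -/
lemma exists_displacement {δ : ℕ} (hδ : δ = 1 ∨ δ = 2) {φ : BranchPair}
    (h0 : ∀ i l, constantCoeff (φ i l) = 0) {m : Fin 2 → ℕ}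
    (hm1 : ∀ i, 1 ≤ m i) (hm : ∀ i, φ i (mainCoord δ i) = X ^ m i)
    (hlow : ∀ i l, l ≠ mainCoord δ i → X ^ (m i + 1) ∣ φ i l)
    {ω : Fin 2 → MvPowerSeries (Fin 2) ℂ} (hω : ω ∈ Omega δ) (i : Fin 2) :
    ∃ ε : ℂ⟦X⟧, X ^ (m i + 1) ∣ ε ∧ pullback φ i ω = derivative ℂ (X ^ m i) * ε ∧
      (pullback φ i ω).order + 1 = ε.order + m i := by
  have hdiv : ∀ l, X ^ m i ∣ φ i l := by
    intro l
    by_cases hl : l = mainCoord δ i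
    · rw [hl, hm]
    · exact (pow_dvd_pow X (Nat.le_succ _)).trans (hlow i l hl)
  obtain ⟨n, hn⟩ : ∃ n, m i = n + 1 := ⟨m i - 1, by have := hm1 i; omega⟩
  have hder : derivative ℂ (X ^ (n + 1) : ℂ⟦X⟧) = C ((n + 1 : ℕ) : ℂ) * X ^ n := by
    simp [Derivation.leibniz_pow]
  have hnC : ((n + 1 : ℕ) : ℂ) ≠ 0 := by exact_mod_cast Nat.succ_ne_zero n
  obtain ⟨η, β, -, hη2, e0, e1⟩ := hω
  -- Division by the derivative of `t ^ m`, which is `m t ^ (m - 1)`, therefore leaves a multiple of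
  -- `t ^ (m + 1)`: the displacement respects the Puiseux form.
  have hωd : ∀ l, X ^ (m i + 1) * X ^ n ∣
      (MvPowerSeries.subst (φ i) (ω l) : ℂ⟦X⟧) * derivative ℂ (φ i l) := by
    intro l
    refine mul_dvd_mul ?_ (X_pow_dvd_derivative (hn ▸ hdiv l))
    have hηd := fun l => X_pow_dvd_mvSubst (by omega) hdiv (hη2 l)
    rcases (by omega : l = 0 ∨ l = 1) with rfl | rfl
    · rw [e0]; exact hηd 0
    · rw [e1]
      rcases hδ with rfl | rfl
      · simpa using hηd 1
      · rw [← MvPowerSeries.smul_eq_C_mul,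
          ← MvPowerSeries.coe_substAlgHom (hasSubst_of_zero (κ := Unit) (h0 i)), map_add,
          map_smul, MvPowerSeries.coe_substAlgHom, mvSubst_X (h0 i)]
        exact dvd_add (X_pow_dvd_smul (hlow i 1 (by simp [mainCoord])) _) (hηd 1)
  obtain ⟨w, hw⟩ : X ^ (m i + 1) * X ^ n ∣ pullback φ i ω := Finset.dvd_sum fun l _ => hωd l
  have hC : C ((n + 1 : ℕ) : ℂ) * C ((n + 1 : ℕ) : ℂ)⁻¹ = (1 : ℂ⟦X⟧) := by
    rw [← map_mul, mul_inv_cancel₀ hnC, map_one]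
  have hp : pullback φ i ω =
      derivative ℂ (X ^ m i) * (C ((n + 1 : ℕ) : ℂ)⁻¹ * (X ^ (m i + 1) * w)) := by
    rw [hw, hn, hder]
    linear_combination (-(X ^ (n + 1 + 1) * X ^ n * w)) * hC
  refine ⟨C ((n + 1 : ℕ) : ℂ)⁻¹ * (X ^ (m i + 1) * w), (dvd_mul_right _ _).mul_left _, hp, ?_⟩
  have hC0 : ∀ c : ℂ, c ≠ 0 → (C c : ℂ⟦X⟧).order = 0 := fun c hc => by
    refine order_eq_nat.2 ⟨by simpa using hc, by simp⟩
  rw [hp, hn, hder, order_mul, order_mul, hC0 _ hnC, order_X_pow]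
  push_cast
  ring

lemma AEquiv.refl {δ : ℕ} {φ : BranchPair} (h0 : ∀ i l, constantCoeff (φ i l) = 0) :
    AEquiv δ φ φ :=
  ⟨fun _ => X, MvPowerSeries.X, memGroup_iff.2
    ⟨fun _ => ⟨isConvergent_powerSeries_X, by simp, by simp⟩, 0, isConvergent_X, by simp, by simp⟩,
    fun i l => by rw [X_subst, mvSubst_X (h0 i)]⟩

lemma trunc_eq_of_X_pow_dvd {n : ℕ} {f g : ℂ⟦X⟧} (h : X ^ n ∣ f - g) : trunc n f = trunc n g := by
  ext j
  rw [coeff_trunc, coeff_trunc]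
  split_ifs with hj
  · have := X_pow_dvd_iff.1 h j hj
    rwa [map_sub, sub_eq_zero] at this
  · rfl

lemma trunc_succ_of_coeff_eq_zero {n : ℕ} {f : ℂ⟦X⟧} (h : coeff n f = 0) :
    trunc (n + 1) f = trunc n f := by
  rw [trunc_succ, h, Polynomial.monomial_zero_right, add_zero]

end Elimination
end PlaneBigerm

theorem proposition5 (δ : ℕ) (hδ : δ = 1 ∨ δ = 2) (Γ L : Set (Fin 2 → ℕ∞)) (N : ℕ∞)
    (hN : ∀ i, (conductor Γ i : ℕ∞) ≤ N + 1)
    (φ : BranchPair) (hφ : φ ∈ SigmaSpace δ Γ L N) (k : ℕ) (i : Fin 2)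
    (hk : ((fiber L i (fun _ => (k : ℕ∞))).Nonempty ∧ mult φ i < k) ∨
      (fun _ => (k : ℕ∞)) ∈ maximalPoints L) :
    ∃ ψ ∈ SigmaSpace δ Γ L N, AEquiv δ φ ψ ∧
      -- the jets of order `k - 1` agree (`PowerSeries.trunc k` keeps the degrees below `k`)
      (∀ j l, PowerSeries.trunc k (ψ j l) = PowerSeries.trunc k (φ j l)) ∧
      -- the jet of order `k` of the branch `i` of `ψ` is the jet of order `k - 1` of that of `φ`
      ∀ l, PowerSeries.trunc (k + 1) (ψ i l) = PowerSeries.trunc k (φ i l) := by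
  open PowerSeries in
  have hφ' := hφ
  obtain ⟨hb, hP, rfl, hL, hφN⟩ := hφ'
  choose m hm1 hm hlow using hP
  have hdvd : ∀ i l, l ≠ mainCoord δ i → X ^ (m i + 1) ∣ φ i l := fun i l hl => by
    rw [X_pow_dvd_iff]; exact fun n hn => hlow i l hl n (by omega)
  have hmult := mult_eq hm hdvd
  -- All that is used of either alternative: a value equal to `k` at branch `i` and at least `k` at
  -- the other.
  obtain ⟨a, haL, hai, hak⟩ : ∃ a ∈ L, a i = k ∧ ∀ j, (k : ℕ∞) ≤ a j := by
    rcases hk with ⟨⟨a, haL, hai, haj⟩, -⟩ | ⟨hL, -, -⟩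
    · refine ⟨a, haL, hai, fun j => ?_⟩
      by_cases hj : j = i
      · rw [hj, hai]
      · exact (haj j hj).le
    · exact ⟨_, hL, rfl, fun _ => le_rfl⟩
  rw [← hL] at haL
  obtain ⟨ω, hω, hωa⟩ := haL
  choose ε hε hωε hεo using exists_displacement hδ hb.zero hm1 hm hdvd hω
  have hεa : ∀ j, (ε j).order = a j := fun j => by
    have h1 := hωa j
    rw [hεo, hmult] at h1
    exact (ENat.add_left_injective_of_ne_top (ENat.natCast_ne_top _) h1).symm
  have hεk : ∀ j, X ^ k ∣ ε j := fun j => by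
    rw [X_pow_dvd_iff_le_order, hεa]
    exact hak j
  obtain ⟨hεi, -⟩ := order_eq_nat.1 ((hεa i).trans hai)
  -- Automatic in both cases, because displacements start in degree `m i + 1`.
  have hmk : m i < k := by
    by_contra! h
    exact hεi (X_pow_dvd_iff.1 (hε i) k (by omega))
  -- If `k` exceeds the truncation order, the coefficient is already zero and `φ` itself works.
  rcases lt_or_ge N (k : ℕ∞) with hNk | hkN
  · refine ⟨φ, hφ, AEquiv.refl hb.zero, fun _ _ => rfl, fun l => trunc_succ_of_coeff_eq_zero ?_⟩
    by_cases hl : l = mainCoord δ i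
    · rw [hl, hm, coeff_X_pow, if_neg (by omega)]
    · exact hφN i l hl k hNk
  obtain ⟨b, hba, hb'⟩ : ∃ b, b ≠ mainCoord δ i ∧ ∀ l, l ≠ mainCoord δ i → l = b :=
    ⟨mainCoord δ i + 1, by omega, by omega⟩
  obtain ⟨sgn, hsgn⟩ : ∃ sgn : Fin 2 → ℂ, sgn = fun j => if mainCoord δ j = 0 then 1 else -1 :=
    ⟨_, rfl⟩
  have hsgn2 : sgn i * sgn i = 1 := by
    rw [hsgn]; dsimp only; split_ifs <;> norm_num
  -- Solves `coeff k (φ i b) + sgn i * c * coeff k (ε i) = 0`, using that `sgn i` is its own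
  -- inverse.
  obtain ⟨c, hc⟩ : ∃ c : ℂ, c = -(sgn i * coeff k (φ i b) / coeff k (ε i)) := ⟨_, rfl⟩
  -- The maximum is needed because `k` may be at most `m j` on the other branch, while the flow
  -- argument requires a displacement of order greater than `m j`.
  obtain ⟨ψ, hψc, hψ0, hψm, hψd, hφψ⟩ := exists_flow hδ hb hm1 hm hdvd (smul_mem_Omega hω c)
    (K := fun j => max k (m j + 1)) (fun j => le_max_right _ _) (ε := fun j => c • ε j)
    (fun j => X_pow_dvd_smul (by
      rcases le_total k (m j + 1) with h | h
      · rw [max_eq_right h]; exact hε j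
      · rw [max_eq_left h]; exact hεk j) c)
    (fun j => by rw [pullback_smul hb.zero, hωε, mul_smul_comm])
  have hψd' : ∀ j l, l ≠ mainCoord δ j → ∀ n ≤ max k (m j + 1),
      coeff n (ψ j l) = coeff n (φ j l) + sgn j * (c * coeff n (ε j)) := fun j l hl n hn => by
    have := X_pow_dvd_iff.1 (hψd j l hl) n (by omega)
    rw [map_sub, map_sub, map_smul, map_smul, smul_eq_mul, smul_eq_mul] at this
    rw [hsgn]
    linear_combination this
  have hψl : ∀ j l, l ≠ mainCoord δ j → X ^ (m j + 1) ∣ ψ j l := fun j l hl => by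
    rw [X_pow_dvd_iff]
    intro n hn
    rw [hψd' j l hl n (hn.le.trans (le_max_right _ _)), X_pow_dvd_iff.1 (hdvd j l hl) n hn,
      X_pow_dvd_iff.1 (hε j) n hn, mul_zero, mul_zero, add_zero]
  have hψk : ∀ j l, X ^ k ∣ ψ j l - φ j l := fun j l => by
    by_cases hl : l = mainCoord δ j
    · rw [hl, hψm, hm, sub_self]; exact dvd_zero _
    rw [X_pow_dvd_iff]
    intro n hn
    rw [map_sub, hψd' j l hl n (hn.le.trans (le_max_left _ _)), X_pow_dvd_iff.1 (hεk j) n hn,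
      mul_zero, mul_zero, add_zero, sub_self]
  have hψi : ∀ l, coeff k (ψ i l) = 0 := fun l => by
    by_cases hl : l = mainCoord δ i
    · rw [hl, hψm, coeff_X_pow, if_neg (by omega)]
    rw [hb' l hl, hψd' i b hba k (le_max_left _ _), hc, neg_mul, div_mul_cancel₀ _ hεi]
    linear_combination (-coeff k (φ i b)) * hsgn2
  have hψb := isBigerm_of_aEquiv hb hψc hψ0 hφψ
  obtain ⟨χ, hχc, hχ0, hχm, hχl, hχd, hχN, hψχ⟩ : ∃ χ : BranchPair,
      (∀ i l, IsConvergent (χ i l)) ∧ (∀ i l, constantCoeff (χ i l) = 0) ∧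
      (∀ i, χ i (mainCoord δ i) = X ^ m i) ∧
      (∀ i l, l ≠ mainCoord δ i → X ^ (m i + 1) ∣ χ i l) ∧
      (∀ i l, X ^ (k + 1) ∣ χ i l - ψ i l) ∧ DegreeLE δ N χ ∧ AEquiv δ ψ χ := by
    -- Without truncation the flow is already the answer. For finite `N ≥ k` the tail is removed
    -- modulo `t ^ (N + 1)`, which leaves the degrees up to `k` alone.
    induction N using ENat.recTopCoe with
    | top =>
      exact ⟨ψ, hψc, hψ0, hψm, hψl, fun _ _ => by rw [sub_self]; exact dvd_zero _,
        fun _ _ _ n hn => absurd hn not_top_lt, AEquiv.refl hψ0⟩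
    | coe N =>
      have hkN' : k ≤ N := by exact_mod_cast hkN
      obtain ⟨χ, hχc, hχ0, hχm, hχl, hχd, hχ⟩ := exists_truncation hδ hb hψb hm1 hm hψm hψl hφψ
        hφN (fun j => by rw [valueSemigroup_eq hb.zero hψ0 hφψ]; exact_mod_cast hN j)
      exact ⟨χ, hχc, hχ0, hχm, hχl, fun i l => (pow_dvd_pow X (by omega)).trans (hχd i l), hχ⟩
  have hφχ := hφψ.trans hb.zero hψ0 hψχ
  have hχφ : ∀ j l, X ^ k ∣ χ j l - φ j l := fun j l => by
    rw [← sub_add_sub_cancel _ (ψ j l)]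
    exact dvd_add ((pow_dvd_pow X (Nat.le_succ k)).trans (hχd j l)) (hψk j l)
  have htr := fun j l => trunc_eq_of_X_pow_dvd (hχφ j l)
  refine ⟨χ, ⟨isBigerm_of_aEquiv hb hχc hχ0 hφχ, fun j => ⟨m j, hm1 j, hχm j, fun l hl n hn =>
      X_pow_dvd_iff.1 (hχl j l hl) n (by omega)⟩, valueSemigroup_eq hb.zero hχ0 hφχ, ?_, hχN⟩,
    hφχ, htr, fun l => ?_⟩
  · rw [Lambda_eq hb.zero hχ0 (fun j => (mult_eq hχm hχl j).trans (hmult j).symm) hφχ, hL]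
  · rw [← htr i l]
    refine trunc_succ_of_coeff_eq_zero ?_
    have := X_pow_dvd_iff.1 (hχd i l) k (Nat.lt_succ_self k)
    rwa [map_sub, hψi, sub_zero] at this
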